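/- **Theorem (equivalence of fermionic and ordinary quantum cellular automata).** *Setting.* Fix $d\ge 0$ and $N=(N_1,\dots,N_d)$ with $N_i\in\{0,1,2,\dots\}$, and let $\Lambda_N=\prod_i \mathbb Z/N_i\mathbb Z$ be the $d$-dimensional cubic lattice that is periodic with period $N_i$ in direction $i$ if $N_i\ge 1$ and infinite in direction $i$ if $N_i=0$ (so $\mathbb Z^d$ is included). $B(n,r)\subseteq\Lambda_N$ is the set of sites $n+z$ with $z\in\mathbb Z^d$, $\max_i|z_i|\le r$. *QCA.* A quantum cellular automaton (QCA) on $\Lambda_N$ with cell dimension $D\ge1$ and range at most $L$ is a $*$-automorphism $u$ (one timestep, Heisenberg picture) of the algebra of local operators of $\bigotimes_{n\in\Lambda_N}\mathbb C^D$ that commutes with translations and maps every operator localized on a site $n$ to an operator localized on $B(n,L)$. If $\Lambda_N$ is finite, it is required that $u(A)=U^\dagger AU$ for a unitary $U$ that commutes with the translations. The observables localized on a set $S$ of sites are (linear combinations of) the local operators on $S$. *Fermionic QCA.* A fermionic QCA on $\Lambda_N$ with $m$ modes per site and range at most $L$ is a $*$-automorphism $u$ of the $*$-algebra generated by annihilation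 operators $a_{n,i}$ ($n\in\Lambda_N$, $1\le i\le m$) subject to the canonical anticommutation relations, that commutes with translations, maps each $a_{n,i}$ to a polynomial in the creation and annihilation operators of the sites in $B(n,L)$, and, if finitely many modes are added to the system, extends to the larger system so that the additional annihilation operators are left invariant. If $\Lambda_N$ is finite, it is required that $u(A)=U^\dagger AU$ for a unitary $U$ in this algebra that commutes with the translations and with the annihilation operators of all additional modes. The observables localized on $S$ are (linear combinations of) the products of even numbers of creation and annihilation operators of sites in $S$. *Simulation.* Of two such systems on the same lattice, $Y$ with evolution $u_Y$ *simulates* $X$ with evolution $u_X$ if $X$ is a subsector of $Y$: there are a unital $*$-algebra $\mathcal B$ of observables of $Y$ with $u_Y(\mathcal B)=\mathcal B$ and a unital $*$-homomorphism $q$ from $\mathcal B$ to the observables of $X$ such that $q(u_Y(b))=u_X(q(b))$ for all $b\in\mathcal B$, and such that for every site $n$ and every $r\ge0$ each observable of $X$ localized on $B(n,r)$ equals $q(b)$ for some $b\in\mathcal B$ localized on $B(n,r)$. (Hence states of $X$ are represented by states of $Y$, and the latter reproduce all expectation values of $X$ at all times.) *Claim.* QCAs and fermionic QCAs simulate each other,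 by adding a constant number of systems per site: 1. For all $d,m$ there is a $k$ such that for every $L$ there is an $R$ such that, for every $N$, every fermionic QCA on $\Lambda_N$ with $m$ modes per site and range at most $L$ is simulated by a QCA on $\Lambda_N$ with $m+k$ qubits per site (cell dimension $2^{m+k}$) and range at most $R$. 2. For every $D\ge 1$ there is a $k$ such that for all $d,L$ there is an $R$ such that, for every $N$, every QCA on $\Lambda_N$ with cell dimension $D$ and range at most $L$ is simulated by a fermionic QCA on $\Lambda_N$ with $k$ modes per site and range at most $R$. In particular the numbers of systems per site and the ranges do not depend on the number of sites. -/

import Mathlib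

open scoped lp

noncomputable section

/-! ## Weighted partial permutation operators on `ℓ²` -/

/-- For weights `c` with `‖c x‖ ≤ 1` and a map `g` that is injective where `c` does not vanish, the
bounded operator `ℓ²(Y) → ℓ²(X)` given by `(T ψ) x = c x * ψ (g x)`. -/
def wcomp {X Y : Type} (c : X → ℂ) (g : X → Y) (hc : ∀ x, ‖c x‖ ≤ 1)
    (hg : Set.InjOn g {x | c x ≠ 0}) : ℓ²(Y, ℂ) →L[ℂ] ℓ²(X, ℂ) :=
  have key : ∀ (ψ : ℓ²(Y, ℂ)) (s : Finset X),
      ∑ x ∈ s, ‖c x * ψ (g x)‖ ^ (2 : ENNReal).toReal ≤ ‖ψ‖ ^ (2 : ENNReal).toReal := by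
    intro ψ s
    classical
    calc ∑ x ∈ s, ‖c x * ψ (g x)‖ ^ (2 : ENNReal).toReal
        = ∑ x ∈ s.filter (fun x => c x ≠ 0), ‖c x * ψ (g x)‖ ^ (2 : ENNReal).toReal := by
          rw [Finset.sum_filter]
          refine Finset.sum_congr rfl fun x _ => ?_
          split_ifs with h
          · rfl
          · rw [not_not] at h
            simp [h]
      _ ≤ ∑ x ∈ s.filter (fun x => c x ≠ 0), ‖ψ (g x)‖ ^ (2 : ENNReal).toReal := by
          refine Finset.sum_le_sum fun x _ => ?_
          refine Real.rpow_le_rpow (norm_nonneg _) ?_ (by simp)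
          rw [norm_mul]
          exact mul_le_of_le_one_left (norm_nonneg _) (hc x)
      _ = ∑ y ∈ (s.filter (fun x => c x ≠ 0)).image g, ‖ψ y‖ ^ (2 : ENNReal).toReal := by
          rw [Finset.sum_image]
          intro x hx y hy h
          exact hg (by simpa using (Finset.mem_filter.1 hx).2)
            (by simpa using (Finset.mem_filter.1 hy).2) h
      _ ≤ ‖ψ‖ ^ (2 : ENNReal).toReal := lp.sum_rpow_le_norm_rpow (by simp) ψ _
  LinearMap.mkContinuous
    { toFun := fun ψ => ⟨fun x => c x * ψ (g x), memℓp_gen' (key ψ)⟩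
      map_add' := fun ψ φ => by
        ext x
        exact mul_add (c x) (ψ (g x)) (φ (g x))
      map_smul' := fun a ψ => by
        ext x
        simp [mul_left_comm] }
    1 (fun ψ => by
      rw [one_mul]
      exact lp.norm_le_of_forall_sum_le (by simp) (norm_nonneg _) (key ψ))

/-! ## Lattices -/

/-- The sites of the `d`-dimensional cubic lattice with period `N i` in direction `i`; since
`ZMod 0 = ℤ`, a direction with `N i = 0` is infinite.  So `N = 0` gives `ℤ^d`, and if every `N i`
is positive, the lattice is finite with periodic boundary conditions. -/
def Site {d : ℕ} (N : Fin d → ℕ) : Type := ∀ i, ZMod (N i)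

instance {d : ℕ} (N : Fin d → ℕ) : AddCommGroup (Site N) :=
  inferInstanceAs (AddCommGroup (∀ i, ZMod (N i)))

/-- Some linear order of the sites; it only enters the signs in the Fock representation. -/
instance {d : ℕ} (N : Fin d → ℕ) : LinearOrder (Site N) := by
  classical exact linearOrderOfSTO (WellOrderingRel (α := Site N))

/-- The sites at distance at most `r` from `n`. -/
def siteBall {d : ℕ} {N : Fin d → ℕ} (n : Site N) (r : ℕ) : Set (Site N) :=
  {m | ∃ z : Fin d → ℤ, (∀ i, |z i| ≤ r) ∧ ∀ i, m i = n i + (z i : ZMod (N i))}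

/-! ## Quantum cellular automata -/

/-- Operators on `⨂_n ℂ^D` (the incomplete tensor product with reference vector `|0…0⟩`, if the
lattice is infinite), realised on `ℓ²` over the configurations `f` with finitely many nonzero
values. -/
abbrev QOp {d : ℕ} (N : Fin d → ℕ) (D : ℕ) [NeZero D] : Type :=
  ℓ²(Site N →₀ Fin D, ℂ) →L[ℂ] ℓ²(Site N →₀ Fin D, ℂ)

/-- The operator `|a⟩⟨b|` at site `n`, tensored with the identity at all other sites. -/
def qUnit {d : ℕ} (N : Fin d → ℕ) (D : ℕ) [NeZero D] (n : Site N) (a b : Fin D) : QOp N D :=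
  wcomp (fun f => if f n = a then 1 else 0) (fun f => f.update n b)
    (by intro f; split_ifs <;> simp)
    (by
      intro f hf g hg h
      have hf' : f n = a := by by_contra h'; simp [h'] at hf
      have hg' : g n = a := by by_contra h'; simp [h'] at hg
      ext1 x
      by_cases hx : x = n
      · rw [hx, hf', hg']
      · have := DFunLike.congr_fun h x
        simpa [Finsupp.coe_update, Function.update_of_ne hx] using this)

/-- The unitary that translates all systems by `v`: `|f⟩ ↦ |f(· - v)⟩`. -/
def qTrans {d : ℕ} (N : Fin d → ℕ) (D : ℕ) [NeZero D] (v : Site N) : QOp N D :=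
  wcomp (fun _ => 1) (fun f => f.equivMapDomain (Equiv.addRight (-v))) (by simp)
    (by
      intro f _ g _ h
      ext1 x
      have := DFunLike.congr_fun h (x - v)
      simpa using this)

/-- The *-algebra of operators localized on the set of sites `S`, that is, of finite sums of
products of one-site operators from `S`.  For `S = univ` this is the algebra of all local
operators (all operators, if the lattice is finite). -/
def qLocal {d : ℕ} (N : Fin d → ℕ) (D : ℕ) [NeZero D] (S : Set (Site N)) :
    StarSubalgebra ℂ (QOp N D) :=
  StarAlgebra.adjoin ℂ {A | ∃ n ∈ S, ∃ a b : Fin D, A = qUnit N D n a b}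

/-- The algebra of all local operators of a lattice of `D`-dimensional systems. -/
abbrev QAlg {d : ℕ} (N : Fin d → ℕ) (D : ℕ) [NeZero D] : StarSubalgebra ℂ (QOp N D) :=
  qLocal N D Set.univ

/-- `qUnit` as an element of the algebra of local operators. -/
def qGen {d : ℕ} (N : Fin d → ℕ) (D : ℕ) [NeZero D] (n : Site N) (a b : Fin D) : QAlg N D :=
  ⟨qUnit N D n a b, StarAlgebra.subset_adjoin ℂ _ ⟨n, Set.mem_univ n, a, b, rfl⟩⟩

/-- `u` is the evolution, in the Heisenberg picture and over one timestep, of a quantum cellular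
automaton with a `D`-dimensional system at each site and interaction range at most `L`. -/
structure IsQCA {d : ℕ} (N : Fin d → ℕ) (D : ℕ) [NeZero D] (L : ℕ)
    (u : QAlg N D ≃⋆ₐ[ℂ] QAlg N D) : Prop where
  causal : ∀ (n : Site N) (A : QAlg N D),
    (A : QOp N D) ∈ qLocal N D {n} → (u A : QOp N D) ∈ qLocal N D (siteBall n L)
  translation : ∀ (v n : Site N) (a b : Fin D),
    (u (qGen N D (n + v) a b) : QOp N D)
      = qTrans N D v * (u (qGen N D n a b) : QOp N D) * star (qTrans N D v)
  /-- On a finite lattice the evolution is given by a translationally invariant unitary. -/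
  unitary : Finite (Site N) → ∃ U : QAlg N D,
    (star U * U = 1 ∧ U * star U = 1) ∧ (∀ A : QAlg N D, u A = star U * A * U) ∧
      ∀ v : Site N, (U : QOp N D) * qTrans N D v = qTrans N D v * (U : QOp N D)

/-! ## Fermions -/

/-- Operators on the Fock space of fermionic modes labelled by `ι`, realised on `ℓ²` over the finite
sets of occupied modes. -/
abbrev FOp (ι : Type) : Type := ℓ²(Finset ι, ℂ) →L[ℂ] ℓ²(Finset ι, ℂ)

/-- The annihilation operator of the mode `i`:
`a_i |S⟩ = (-1)^{#{j ∈ S : j < i}} |S \ {i}⟩` if `i ∈ S`, and `a_i |S⟩ = 0` otherwise. -/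
def annih (ι : Type) [LinearOrder ι] (i : ι) : FOp ι :=
  wcomp (fun S => if i ∈ S then 0 else (-1) ^ (S.filter (· < i)).card) (fun S => insert i S)
    (by intro S; split_ifs <;> simp)
    (by
      intro S hS T hT h
      have hS' : i ∉ S := by intro h'; simp [h'] at hS
      have hT' : i ∉ T := by intro h'; simp [h'] at hT
      simpa [Finset.erase_insert hS', Finset.erase_insert hT'] using
        congrArg (fun R : Finset ι => R.erase i) h)

/-- The sign in `σ |S⟩ = ± |σ S⟩`: minus one to the number of pairs in `S` whose order `σ`
reverses. -/
def permSign {ι : Type} [LinearOrder ι] (σ : Equiv.Perm ι) (S : Finset ι) : ℂ :=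
  ∏ i ∈ S, ∏ j ∈ S, if i < j ∧ σ j < σ i then -1 else 1

/-- The unitary on Fock space that fixes the vacuum and maps `a_i` to `a_{σ i}`. -/
def fockPerm {ι : Type} [LinearOrder ι] (σ : Equiv.Perm ι) : FOp ι :=
  wcomp (fun S => permSign σ (S.map σ.symm.toEmbedding)) (fun S => S.map σ.symm.toEmbedding)
    (by
      intro S
      unfold permSign
      rw [norm_prod]
      refine Finset.prod_le_one (fun _ _ => norm_nonneg _) fun i _ => ?_
      rw [norm_prod]
      refine Finset.prod_le_one (fun _ _ => norm_nonneg _) fun j _ => ?_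
      split_ifs <;> simp)
    ((Finset.map_injective _).injOn)

/-- The algebra of the canonical anticommutation relations generated by the modes in `M`: sums of
products of creation and annihilation operators of these modes. -/
def carLocal (ι : Type) [LinearOrder ι] (M : Set ι) : StarSubalgebra ℂ (FOp ι) :=
  StarAlgebra.adjoin ℂ {A | ∃ i ∈ M, A = annih ι i}

/-- Sums of products of even numbers of creation and annihilation operators of the modes in `M`. -/
def carEven (ι : Type) [LinearOrder ι] (M : Set ι) : StarSubalgebra ℂ (FOp ι) :=
  StarAlgebra.adjoin ℂ {A | ∃ i ∈ M, ∃ j ∈ M, A = annih ι i * annih ι j ∨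
    A = annih ι i * star (annih ι j) ∨ A = star (annih ι i) * annih ι j}

/-- The algebra generated by all creation and annihilation operators. -/
abbrev CAR (ι : Type) [LinearOrder ι] : StarSubalgebra ℂ (FOp ι) := carLocal ι Set.univ

/-- `annih` as an element of the algebra `CAR`. -/
def carGen (ι : Type) [LinearOrder ι] (i : ι) : CAR ι :=
  ⟨annih ι i, StarAlgebra.subset_adjoin ℂ _ ⟨i, Set.mem_univ i, rfl⟩⟩

/-- The modes `ι` together with `k` additional modes. -/
abbrev AddModes (ι : Type) (k : ℕ) : Type := Lex (ι ⊕ Fin k)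

/-- An original mode among the modes with additional ones. -/
abbrev oldMode {ι : Type} {k : ℕ} (i : ι) : AddModes ι k := toLex (Sum.inl i)

/-- An additional mode. -/
abbrev newMode {ι : Type} {k : ℕ} (j : Fin k) : AddModes ι k := toLex (Sum.inr j)

/-- `ψ ↦ (S ↦ ψ (S ∪ K))`, for a fixed occupation `K` of the additional modes. -/
def sliceFock (ι : Type) [LinearOrder ι] (k : ℕ) (K : Finset (Fin k)) :
    ℓ²(Finset (AddModes ι k), ℂ) →L[ℂ] ℓ²(Finset ι, ℂ) :=
  wcomp (fun _ => 1) (fun S => (S.disjSum K).map toLex.toEmbedding) (by simp)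
    (by
      intro S _ T _ h
      have h2 : S.disjSum K = T.disjSum K := Finset.map_injective _ h
      have h3 := congrArg Finset.toLeft h2
      simpa using h3)

/-- The operator `A` of the original modes as an operator of the larger system: the same polynomial
in creation and annihilation operators.  In the Fock representation, where the additional modes come
last in the order, this is `A ⊗ 1`. -/
def extendModes (ι : Type) [LinearOrder ι] (k : ℕ) (A : FOp ι) : FOp (AddModes ι k) :=
  ∑ K : Finset (Fin k),
    (ContinuousLinearMap.adjoint (sliceFock ι k K)) ∘L A ∘L (sliceFock ι k K)

/-! ## Fermionic quantum cellular automata -/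

/-- The modes of a lattice with `m` fermionic modes at each site. -/
abbrev Mode {d : ℕ} (N : Fin d → ℕ) (m : ℕ) : Type := Lex (Site N × Fin m)

/-- The mode number `i` at site `n`. -/
abbrev mode {d : ℕ} {N : Fin d → ℕ} {m : ℕ} (n : Site N) (i : Fin m) : Mode N m := toLex (n, i)

/-- The modes at the sites in `S`. -/
def modesOn {d : ℕ} (N : Fin d → ℕ) (m : ℕ) (S : Set (Site N)) : Set (Mode N m) :=
  {x | (ofLex x).1 ∈ S}

/-- Translation of the modes by `v`. -/
def shiftModes {d : ℕ} (N : Fin d → ℕ) (m : ℕ) (v : Site N) : Equiv.Perm (Mode N m) :=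
  ofLex.trans (((Equiv.addRight v).prodCongr (Equiv.refl (Fin m))).trans toLex)

/-- The unitary that translates all modes by `v`. -/
def fTrans {d : ℕ} (N : Fin d → ℕ) (m : ℕ) (v : Site N) : FOp (Mode N m) :=
  fockPerm (shiftModes N m v)

/-- `u` is the evolution, in the Heisenberg picture and over one timestep, of a fermionic quantum
cellular automaton with `m` modes at each site and interaction range at most `L`. -/
structure IsFQCA {d : ℕ} (N : Fin d → ℕ) (m L : ℕ)
    (u : CAR (Mode N m) ≃⋆ₐ[ℂ] CAR (Mode N m)) : Prop where
  causal : ∀ (n : Site N) (i : Fin m),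
    (u (carGen _ (mode n i)) : FOp (Mode N m))
      ∈ carLocal (Mode N m) (modesOn N m (siteBall n L))
  translation : ∀ (v n : Site N) (i : Fin m),
    (u (carGen _ (mode (n + v) i)) : FOp (Mode N m))
      = fTrans N m v * (u (carGen _ (mode n i)) : FOp (Mode N m)) * star (fTrans N m v)
  /-- If modes are added, the evolution extends to the larger system and leaves them invariant. -/
  ancilla : ∀ k : ℕ, ∃ w : CAR (AddModes (Mode N m) k) ≃⋆ₐ[ℂ] CAR (AddModes (Mode N m) k),
    (∀ i : Mode N m, (w (carGen _ (oldMode i)) : FOp (AddModes (Mode N m) k))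
      = extendModes (Mode N m) k (u (carGen _ i) : FOp (Mode N m))) ∧
    ∀ j : Fin k, w (carGen _ (newMode j)) = carGen _ (newMode j)
  /-- On a finite lattice the evolution is given by a translationally invariant unitary that leaves
  additional modes invariant. -/
  unitary : Finite (Site N) → ∃ U : CAR (Mode N m),
    (star U * U = 1 ∧ U * star U = 1) ∧ (∀ A : CAR (Mode N m), u A = star U * A * U) ∧
      (∀ v : Site N, (U : FOp (Mode N m)) * fTrans N m v = fTrans N m v * (U : FOp (Mode N m))) ∧
      ∀ (k : ℕ) (j : Fin k),
        extendModes (Mode N m) k (U : FOp (Mode N m)) * annih _ (newMode j)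
          = annih _ (newMode j) * extendModes (Mode N m) k (U : FOp (Mode N m))

/-- The observables of a fermionic lattice system that are localized on `S` (and their complex
linear combinations): the even operators. -/
def fObs {d : ℕ} (N : Fin d → ℕ) (m : ℕ) (S : Set (Site N)) : StarSubalgebra ℂ (FOp (Mode N m)) :=
  carEven (Mode N m) (modesOn N m S)

/-! ## Simulation -/

/-- The lattice system `Y` (local operators `𝒴`, observables `obsY S` localized on `S`, evolution
`uY`) simulates the lattice system `X` on the same lattice: the evolution of `X` is a subsector of
that of `Y`.

There are a *-algebra `B` of observables of `Y` that is invariant under the evolution, forwards and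
backwards in time, and a unital *-homomorphism `q` from `B` to the observables of `X` (the value of
an operator in the sector) that intertwines the two evolutions.  Every observable of `X` localized on
a ball is encoded by an observable of `Y` localized on the same ball; in particular `q` is onto.
So each state `ω` of `X` is represented by the states of `Y` that restrict to `ω ∘ q` on `B`, and
these reproduce all expectation values of `X` after any number of timesteps. -/
def Simulates {d : ℕ} {N : Fin d → ℕ} {X Y : Type} [Ring X] [Algebra ℂ X] [StarRing X]
    [StarModule ℂ X] [Ring Y] [Algebra ℂ Y] [StarRing Y] [StarModule ℂ Y]
    (𝒴 : StarSubalgebra ℂ Y) (obsY : Set (Site N) → StarSubalgebra ℂ Y) (uY : 𝒴 ≃⋆ₐ[ℂ] 𝒴)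
    (𝒳 : StarSubalgebra ℂ X) (obsX : Set (Site N) → StarSubalgebra ℂ X) (uX : 𝒳 ≃⋆ₐ[ℂ] 𝒳) :
    Prop :=
  ∃ (B : StarSubalgebra ℂ 𝒴) (q : B →⋆ₐ[ℂ] 𝒳),
    (∀ b : B, ((b : 𝒴) : Y) ∈ obsY Set.univ ∧ (q b : X) ∈ obsX Set.univ) ∧
    (∀ y : 𝒴, uY y ∈ B ↔ y ∈ B) ∧
    (∀ b b' : B, (b' : 𝒴) = uY b → q b' = uX (q b)) ∧
    ∀ (n : Site N) (r : ℕ) (x : 𝒳), (x : X) ∈ obsX (siteBall n r) →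
      ∃ b : B, ((b : 𝒴) : Y) ∈ obsY (siteBall n r) ∧ q b = x

end

noncomputable section

/-! ## Weighted composition operators -/

section Wcomp

variable {X Y Z : Type}

/-! The evolution `u` is not transported directly; a circuit built from two copies of the system is.
Put copies ι₁ and ι₂ of the simulated system side by side. For each generator a, one local gate
exchanges ι₁(a) with ι₂(a), and another one exchanges ι₁(u a) with ι₂(a). Within each family the
gates commute, since `u` is an automorphism. The product of the first family carries ι₁(x) to ι₂(x),
that of the second carries ι₂(x) to ι₁(u x); together they act on the first copy as `u`. So it
suffices to find gates of the simulating system that act in the same way on a suitable subspace,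
commute with each other everywhere, have bounded range and are translation covariant. This is
`simulates_of_swaps`: the algebra of the simulation consists of the observables that act as some
ι₁(x), and such an observable has the value x. On an infinite lattice the product of all gates is
only formal, but conjugation of a local operator involves finitely many of them
(`IsGateFamily.aut`); on a finite lattice the product is a translation-invariant unitary.

For matrix algebras the exchange is the flip ∑ A_ab B_ba. For fermions it is 1 - f†f with f = A - b,
which is the parity of the antisymmetric mode f/√2 (`IsCARPair.swap_conj`). This requires evolved
annihilation operators to be odd, which follows from the extension of `u` to an additional mode
(`IsFQCA.odd`).

The Fock space of M modes per site and the state space of 2^M-dimensional cells have the same basis;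
the local operators differ by Jordan–Wigner strings. Operators that preserve the parity of every
single site carry no strings: they are local in both pictures, and both translations act on them
alike (`toQ_mem_qEven`, `toQ_symm_mem_carEven`, `permConj_toQ_symm`). Hence both claims come down to
making the gates preserve all site parities.

Fermions from qubits: an even gate, such as hopping, may change parities of single sites. Two modes
per site and direction are added, and every edge gets a link operator iγγ' made of Majorana
operators at its ends. Links commute with each other and with the matter modes, and under signs on
the sites a link changes by the product of the signs at its ends. Take X times the projection onto
"links near X equal 1" and average it over all site parities. The result `LinkModes.dress` preserves
every site parity and still acts as X where the links are 1, because signs that are constant along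
the links of a ball act trivially on an even X in that ball. Balls of radius 3L make the dressed
gates commute (`dress_commute_of_mem_carEven`). The Fock space need not contain a vector on which
infinitely many links equal 1, so "acts as" refers to all sufficiently large finite sets of links
(`ActsAs`).

Cells from fermions: the D² pairs of states of two cells at a site are coded by even states of D²
modes. A gate acts as the exchange where all sites around it carry code states, and trivially
elsewhere, so it preserves site parities automatically (`PairCode.lift_mem_qEven`). -/

theorem wcomp_apply (c : X → ℂ) (g : X → Y) (hc hg) (ψ : ℓ²(Y, ℂ)) (x : X) :
    wcomp c g hc hg ψ x = c x * ψ (g x) := rfl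

theorem l2op_ext {A B : ℓ²(Y, ℂ) →L[ℂ] ℓ²(X, ℂ)} (h : ∀ ψ x, A ψ x = B ψ x) : A = B :=
  ContinuousLinearMap.ext fun ψ => lp.ext (funext fun x => h ψ x)

theorem l2op_add_apply (A B : ℓ²(Y, ℂ) →L[ℂ] ℓ²(X, ℂ)) (ψ x) :
    (A + B) ψ x = A ψ x + B ψ x := rfl

theorem l2op_sub_apply (A B : ℓ²(Y, ℂ) →L[ℂ] ℓ²(X, ℂ)) (ψ x) :
    (A - B) ψ x = A ψ x - B ψ x := rfl

theorem l2op_neg_apply (A : ℓ²(Y, ℂ) →L[ℂ] ℓ²(X, ℂ)) (ψ x) : (-A) ψ x = -(A ψ x) := rfl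

theorem l2op_smul_apply (a : ℂ) (A : ℓ²(Y, ℂ) →L[ℂ] ℓ²(X, ℂ)) (ψ x) :
    (a • A) ψ x = a * A ψ x := rfl

theorem l2op_one_apply (ψ x) : (1 : ℓ²(X, ℂ) →L[ℂ] ℓ²(X, ℂ)) ψ x = ψ x := rfl

theorem l2op_sum_apply {ι : Type*} (s : Finset ι) (A : ι → ℓ²(Y, ℂ) →L[ℂ] ℓ²(X, ℂ)) (ψ x) :
    (∑ i ∈ s, A i) ψ x = ∑ i ∈ s, A i ψ x := by
  classical
  induction s using Finset.induction with
  | empty => simp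
  | insert a s ha ih => rw [Finset.sum_insert ha, Finset.sum_insert ha, l2op_add_apply, ih]

/-- The weights and maps of two operators that are adjoint to each other. -/
theorem adjoint_wcomp {c : X → ℂ} {g : X → Y} {c' : Y → ℂ} {g' : Y → X} (hc hg hc' hg')
    (h : ∀ x, c x ≠ 0 → g' (g x) = x ∧ c' (g x) = star (c x))
    (h' : ∀ y, c' y ≠ 0 → g (g' y) = y ∧ c (g' y) = star (c' y)) :
    ContinuousLinearMap.adjoint (wcomp c g hc hg) = wcomp c' g' hc' hg' := by
  symm
  rw [ContinuousLinearMap.eq_adjoint_iff]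
  intro ψ φ
  rw [lp.inner_eq_tsum, lp.inner_eq_tsum]
  have e1 : ∀ y, inner ℂ (wcomp c' g' hc' hg' ψ y) (φ y)
      = φ y * (star (c' y) * star (ψ (g' y))) := fun y => by
    rw [wcomp_apply]; simp
  have e2 : ∀ x, inner ℂ (ψ x) (wcomp c g hc hg φ x) = c x * φ (g x) * star (ψ x) := fun x => by
    rw [wcomp_apply]; simp
  simp_rw [e1, e2]
  -- Both sums live on the supports of the weights, between which `g` and `g'` are mutually inverse
  -- bijections.
  rw [← tsum_subtype_eq_of_support_subset (s := {y | c' y ≠ 0}),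
    ← tsum_subtype_eq_of_support_subset (s := {x | c x ≠ 0})]
  · let e : {y | c' y ≠ 0} ≃ {x | c x ≠ 0} :=
      { toFun := fun y => ⟨g' y, by
          have := (h' y y.2).2
          have hy := y.2
          simp only [Set.mem_ofPred_eq] at hy ⊢
          rw [this]; simpa using hy⟩
        invFun := fun x => ⟨g x, by
          have := (h x x.2).2
          have hy := x.2
          simp only [Set.mem_ofPred_eq] at hy ⊢
          rw [this]; simpa using hy⟩
        left_inv := fun y => Subtype.ext (h' y y.2).1
        right_inv := fun x => Subtype.ext (h x x.2).1 }
    rw [← e.tsum_eq]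
    refine tsum_congr fun y => ?_
    have := h' y y.2
    simp only [e, Equiv.coe_fn_mk, this.1, this.2]
    ring
  · intro x hx
    simp only [Function.mem_support, Set.mem_ofPred_eq] at hx ⊢
    contrapose! hx
    simp [hx]
  · intro x hx
    simp only [Function.mem_support, Set.mem_ofPred_eq] at hx ⊢
    contrapose! hx
    simp [hx]

theorem star_wcomp {c : X → ℂ} {g : X → X} {c' : X → ℂ} {g' : X → X} (hc hg hc' hg')
    (h : ∀ x, c x ≠ 0 → g' (g x) = x ∧ c' (g x) = star (c x))
    (h' : ∀ y, c' y ≠ 0 → g (g' y) = y ∧ c (g' y) = star (c' y)) :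
    star (wcomp c g hc hg) = wcomp c' g' hc' hg' :=
  adjoint_wcomp hc hg hc' hg' h h'

theorem adjoint_wcomp_apply {c : X → ℂ} {g : X → Y} (hc hg) (c' : Y → ℂ) (g' : Y → X)
    (hc' : ∀ x, ‖c' x‖ ≤ 1) (hg' : Set.InjOn g' {x | c' x ≠ 0})
    (h : ∀ x, c x ≠ 0 → g' (g x) = x ∧ c' (g x) = star (c x))
    (h' : ∀ y, c' y ≠ 0 → g (g' y) = y ∧ c (g' y) = star (c' y)) (ψ y) :
    ContinuousLinearMap.adjoint (wcomp c g hc hg) ψ y = c' y * ψ (g' y) := by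
  rw [adjoint_wcomp hc hg hc' hg' h h', wcomp_apply]

theorem star_wcomp_apply {c : X → ℂ} {g : X → X} (hc hg) (c' : X → ℂ) (g' : X → X)
    (hc' : ∀ x, ‖c' x‖ ≤ 1) (hg' : Set.InjOn g' {x | c' x ≠ 0})
    (h : ∀ x, c x ≠ 0 → g' (g x) = x ∧ c' (g x) = star (c x))
    (h' : ∀ y, c' y ≠ 0 → g (g' y) = y ∧ c (g' y) = star (c' y)) (ψ y) :
    star (wcomp c g hc hg) ψ y = c' y * ψ (g' y) := by
  rw [star_wcomp hc hg hc' hg' h h', wcomp_apply]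

/-- The unitary that relabels a basis. -/
def relabel (e : X ≃ Y) : ℓ²(X, ℂ) →L[ℂ] ℓ²(Y, ℂ) :=
  wcomp (fun _ => 1) e.symm (by simp) (e.symm.injective.injOn)

theorem relabel_apply (e : X ≃ Y) (ψ y) : relabel e ψ y = ψ (e.symm y) := by
  rw [relabel, wcomp_apply, one_mul]

theorem adjoint_relabel (e : X ≃ Y) :
    ContinuousLinearMap.adjoint (relabel e) = relabel e.symm :=
  adjoint_wcomp _ _ _ _ (by simp) (by simp)

theorem relabel_symm_comp (e : X ≃ Y) (ψ) : relabel e.symm (relabel e ψ) = ψ := by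
  ext x
  simp [relabel_apply]

theorem relabel_comp_symm (e : X ≃ Y) (ψ) : relabel e (relabel e.symm ψ) = ψ := by
  ext x
  simp [relabel_apply]

/-- The isomorphism of operator algebras induced by relabelling a basis. -/
def relabelOp (e : X ≃ Y) :
    (ℓ²(X, ℂ) →L[ℂ] ℓ²(X, ℂ)) ≃⋆ₐ[ℂ] (ℓ²(Y, ℂ) →L[ℂ] ℓ²(Y, ℂ)) where
  toFun A := relabel e ∘L A ∘L relabel e.symm
  invFun A := relabel e.symm ∘L A ∘L relabel e
  left_inv A := by ext1 ψ; simp [relabel_symm_comp]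
  right_inv A := by ext1 ψ; simp [relabel_comp_symm]
  map_mul' A B := by ext1 ψ; simp [relabel_symm_comp]
  map_add' A B := by ext1 ψ; simp
  map_smul' a A := by ext1 ψ; simp
  map_star' A := by
    simp only [ContinuousLinearMap.star_eq_adjoint, ContinuousLinearMap.adjoint_comp,
      adjoint_relabel, Equiv.symm_symm]
    rfl

theorem relabelOp_apply (e : X ≃ Y) (A ψ y) :
    relabelOp e A ψ y = A (relabel e.symm ψ) (e.symm y) := relabel_apply _ _ _

theorem relabelOp_symm_apply (e : X ≃ Y) (A ψ x) :
    (relabelOp e).symm A ψ x = A (relabel e ψ) (e x) := relabel_apply e.symm _ _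

theorem relabelOp_comp_relabel (e : X ≃ Y) (A) :
    relabelOp e A ∘L relabel e = relabel e ∘L A := by
  ext1 ψ
  change relabel e (A (relabel e.symm (relabel e ψ))) = _
  rw [relabel_symm_comp]; rfl

theorem relabelOp_symm_comp_relabel (e : X ≃ Y) (A) :
    (relabelOp e).symm A ∘L relabel e.symm = relabel e.symm ∘L A := by
  ext1 ψ
  change relabel e.symm (A (relabel e (relabel e.symm ψ))) = _
  rw [relabel_comp_symm]; rfl

end Wcomp

/-! ## Generated *-algebras -/

section Adjoin

variable {A B : Type*} [Ring A] [Algebra ℂ A] [StarRing A] [StarModule ℂ A]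
  [Ring B] [Algebra ℂ B] [StarRing B] [StarModule ℂ B]

/-- An element that intertwines two homomorphisms on generators intertwines them everywhere. -/
theorem intertwine_of_mem_adjoin {s : Set A} (f g : A →⋆ₐ[ℂ] B) (z : B)
    (h : ∀ a ∈ s, z * f a = g a * z ∧ z * f (star a) = g (star a) * z) {x : A}
    (hx : x ∈ StarAlgebra.adjoin ℂ s) : z * f x = g x * z := by
  suffices H : z * f x = g x * z ∧ z * f (star x) = g (star x) * z from H.1
  induction hx using StarAlgebra.adjoin_induction with
  | mem x hx => exact h x hx
  | algebraMap r =>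
    rw [← algebraMap_star_comm, AlgHomClass.commutes, AlgHomClass.commutes, AlgHomClass.commutes,
      AlgHomClass.commutes]
    exact ⟨(Algebra.commutes _ _).symm, (Algebra.commutes _ _).symm⟩
  | add x y _ _ hx hy =>
    rw [star_add, map_add, map_add, map_add, map_add, mul_add, mul_add, add_mul, add_mul,
      hx.1, hx.2, hy.1, hy.2]
    exact ⟨rfl, rfl⟩
  | mul x y _ _ hx hy =>
    rw [star_mul, map_mul, map_mul, map_mul, map_mul]
    exact ⟨by rw [← mul_assoc, hx.1, mul_assoc, hy.1, mul_assoc],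
      by rw [← mul_assoc, hy.2, mul_assoc, hx.2, mul_assoc]⟩
  | star x _ hx => rw [star_star]; exact ⟨hx.2, hx.1⟩

theorem commute_of_mem_adjoin {s : Set A} {z : A}
    (h : ∀ a ∈ s, Commute z a ∧ Commute z (star a)) {x : A}
    (hx : x ∈ StarAlgebra.adjoin ℂ s) : Commute z x :=
  intertwine_of_mem_adjoin (StarAlgHom.id ℂ A) (StarAlgHom.id ℂ A) z h hx

theorem map_mem_of_mem_adjoin {s : Set A} (f : A →⋆ₐ[ℂ] B) {T : StarSubalgebra ℂ B}
    (h : ∀ a ∈ s, f a ∈ T) {x : A} (hx : x ∈ StarAlgebra.adjoin ℂ s) : f x ∈ T := by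
  have : StarAlgebra.adjoin ℂ s ≤ T.comap f := StarAlgebra.adjoin_le h
  exact this hx

theorem eq_of_mem_adjoin {s : Set A} (f g : A →⋆ₐ[ℂ] B)
    (h : ∀ a ∈ s, f a = g a) {x : A} (hx : x ∈ StarAlgebra.adjoin ℂ s) : f x = g x := by
  have : StarAlgebra.adjoin ℂ s ≤ StarAlgHom.equalizer f g := StarAlgebra.adjoin_le h
  exact this hx

/-- Conjugation with a unitary. -/
def conjHom (U : A) (h : U * star U = 1) (h' : star U * U = 1) : A ≃⋆ₐ[ℂ] A :=
  Unitary.conjStarAlgAut ℂ A ⟨U, h', h⟩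

theorem conjHom_apply (U : A) (h h') (x : A) : conjHom U h h' x = U * x * star U := rfl

end Adjoin

/-! ## Automorphisms from commuting local gates -/

section Gates

variable {A J : Type*} [Ring A] [Algebra ℂ A] [StarRing A] [StarModule ℂ A]

/-- A locally finite family of commuting self-adjoint involutions. -/
structure IsGateFamily (G : J → A) : Prop where
  comm : ∀ i j, Commute (G i) (G j)
  self : ∀ i, star (G i) = G i
  sq : ∀ i, G i * G i = 1
  fin : ∀ a, {i | ¬ Commute (G i) a}.Finite

/-- The product of finitely many gates. -/
def gateProd (G : J → A) (h : ∀ i j, Commute (G i) (G j)) (F : Finset J) : A :=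
  F.noncommProd G fun i _ j _ _ => h i j

variable {G : J → A}

theorem gateProd_insert [DecidableEq J] (h) {F : Finset J} {i : J} (hi : i ∉ F) :
    gateProd G h (insert i F) = G i * gateProd G h F :=
  Finset.noncommProd_insert_of_notMem _ _ _ _ hi

theorem gateProd_empty (h) : gateProd G h ∅ = 1 := rfl

theorem gateProd_commute (h) (F : Finset J) {z : A} (hz : ∀ i ∈ F, Commute z (G i)) :
    Commute z (gateProd G h F) :=
  Finset.noncommProd_commute _ _ _ _ hz

theorem gateProd_mem (h) (F : Finset J) {S : StarSubalgebra ℂ A} (hS : ∀ i ∈ F, G i ∈ S) :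
    gateProd G h F ∈ S :=
  Finset.noncommProd_induction _ _ _ (· ∈ S) (fun _ _ => mul_mem) (one_mem S) hS

theorem star_gateProd (h) (hs : ∀ i, star (G i) = G i) (F : Finset J) :
    star (gateProd G h F) = gateProd G h F := by
  classical
  induction F using Finset.induction with
  | empty => simp [gateProd_empty]
  | insert i F hi ih =>
    rw [gateProd_insert h hi, star_mul, ih, hs]
    exact (gateProd_commute h F fun j _ => h i j).symm

theorem gateProd_sq (h) (hs : ∀ i, G i * G i = 1) (F : Finset J) :
    gateProd G h F * gateProd G h F = 1 := by
  classical
  induction F using Finset.induction with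
  | empty => simp [gateProd_empty]
  | insert i F hi ih =>
    rw [gateProd_insert h hi]
    nth_rw 1 [(gateProd_commute h F fun j _ => h i j).eq]
    rw [mul_assoc, ← mul_assoc (G i), hs, one_mul, ih]

theorem gateProd_map (h) (e : J ↪ J) (F : Finset J) :
    gateProd G h (F.map e) = gateProd (fun i => G (e i)) (fun i j => h (e i) (e j)) F := by
  classical
  induction F using Finset.induction with
  | empty => rfl
  | insert i F hi ih =>
    rw [gateProd_insert _ hi, Finset.map_insert, gateProd_insert _ (by simpa using hi), ih]

theorem map_gateProd {B M : Type*} [Ring B] [FunLike M A B] [MonoidHomClass M A B] (f : M) (h)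
    (F : Finset J) :
    f (gateProd G h F) = gateProd (fun i => f (G i)) (fun i j => (h i j).map f) F :=
  Finset.map_noncommProd _ _ _ _

/-- A gate that commutes with `a` can be moved through `a` and through the other gates to its second
occurrence, where the two cancel because the gate squares to one. -/
theorem IsGateFamily.conj_eq (hG : IsGateFamily G) (a : A) {F : Finset J}
    (hF : (hG.fin a).toFinset ⊆ F) :
    gateProd G hG.comm F * a * gateProd G hG.comm F
      = gateProd G hG.comm (hG.fin a).toFinset * a * gateProd G hG.comm (hG.fin a).toFinset := by
  classical
  obtain ⟨E, rfl, hd⟩ : ∃ E, F = E ∪ (hG.fin a).toFinset ∧ Disjoint E (hG.fin a).toFinset :=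
    ⟨F \ (hG.fin a).toFinset, by simp [hF], Finset.sdiff_disjoint⟩
  clear hF
  induction E using Finset.induction with
  | empty => simp
  | insert i E hi ih =>
    rw [Finset.disjoint_insert_left] at hd
    have hi' : i ∉ E ∪ (hG.fin a).toFinset := by simpa [hi] using hd.1
    have hia : Commute (G i) a := by simpa using hd.1
    rw [Finset.insert_union, gateProd_insert _ hi', ← ih hd.2]
    have hc := gateProd_commute hG.comm (E ∪ (hG.fin a).toFinset) (z := G i)
      fun j _ => hG.comm i j
    generalize gateProd G hG.comm (E ∪ (hG.fin a).toFinset) = g at hc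
    calc G i * g * a * (G i * g) = G i * (g * a) * G i * g := by noncomm_ring
      _ = (g * a) * (G i * G i) * g := by
        rw [((hc.mul_right hia).eq : G i * (g * a) = _)]; noncomm_ring
      _ = _ := by rw [hG.sq, mul_one]

/-- Allows an identity between finitely many elements to be checked with one common finite product
of gates, although each element has its own set of relevant gates. -/
theorem IsGateFamily.eventually_conj_eq (hG : IsGateFamily G) (a : A) :
    ∀ᶠ F in Filter.atTop, gateProd G hG.comm F * a * gateProd G hG.comm F
      = gateProd G hG.comm (hG.fin a).toFinset * a * gateProd G hG.comm (hG.fin a).toFinset :=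
  Filter.eventually_atTop.2 ⟨_, fun _ h => hG.conj_eq a h⟩

/-- The automorphism `a ↦ G a G`, where `G` is the formal product of all gates. -/
def IsGateFamily.aut (hG : IsGateFamily G) : A ≃⋆ₐ[ℂ] A :=
  have mulp : ∀ a b F, gateProd G hG.comm F * (a * b) * gateProd G hG.comm F
      = (gateProd G hG.comm F * a * gateProd G hG.comm F)
        * (gateProd G hG.comm F * b * gateProd G hG.comm F) := fun a b F => by
    have := gateProd_sq hG.comm hG.sq F
    generalize gateProd G hG.comm F = g at this
    calc g * (a * b) * g = g * a * 1 * b * g := by noncomm_ring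
      _ = _ := by rw [← this]; noncomm_ring
  have invol : ∀ a, gateProd G hG.comm (hG.fin (gateProd G hG.comm (hG.fin a).toFinset * a
        * gateProd G hG.comm (hG.fin a).toFinset)).toFinset
      * (gateProd G hG.comm (hG.fin a).toFinset * a * gateProd G hG.comm (hG.fin a).toFinset)
      * gateProd G hG.comm (hG.fin (gateProd G hG.comm (hG.fin a).toFinset * a
        * gateProd G hG.comm (hG.fin a).toFinset)).toFinset = a := fun a => by
    -- The gates relevant for `a` and for its conjugate may differ; one `F` computes both
    -- conjugations, and its product squares to one.
    obtain ⟨F, h1, h2⟩ := ((hG.eventually_conj_eq a).and (hG.eventually_conj_eq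
      (gateProd G hG.comm (hG.fin a).toFinset * a
        * gateProd G hG.comm (hG.fin a).toFinset))).exists
    rw [← h2, ← h1]
    have := gateProd_sq hG.comm hG.sq F
    generalize gateProd G hG.comm F = g at this
    calc g * (g * a * g) * g = (g * g) * a * (g * g) := by noncomm_ring
      _ = a := by rw [this, one_mul, mul_one]
  { toFun := fun a => gateProd G hG.comm (hG.fin a).toFinset * a
      * gateProd G hG.comm (hG.fin a).toFinset
    invFun := fun a => gateProd G hG.comm (hG.fin a).toFinset * a
      * gateProd G hG.comm (hG.fin a).toFinset
    left_inv := invol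
    right_inv := invol
    map_mul' := fun a b => by
      obtain ⟨F, h1, h2, h3⟩ := ((hG.eventually_conj_eq (a * b)).and
        ((hG.eventually_conj_eq a).and (hG.eventually_conj_eq b))).exists
      rw [← h1, ← h2, ← h3, mulp]
    map_add' := fun a b => by
      obtain ⟨F, h1, h2, h3⟩ := ((hG.eventually_conj_eq (a + b)).and
        ((hG.eventually_conj_eq a).and (hG.eventually_conj_eq b))).exists
      rw [← h1, ← h2, ← h3]
      noncomm_ring
    map_star' := fun a => by
      obtain ⟨F, h1, h2⟩ := ((hG.eventually_conj_eq (star a)).and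
        (hG.eventually_conj_eq a)).exists
      rw [← h1, ← h2, star_mul, star_mul, star_gateProd _ hG.self, mul_assoc]
    map_smul' := fun r a => by
      obtain ⟨F, h1, h2⟩ := ((hG.eventually_conj_eq (r • a)).and
        (hG.eventually_conj_eq a)).exists
      rw [← h1, ← h2]
      simp }

theorem IsGateFamily.aut_eq (hG : IsGateFamily G) (a : A) {F : Finset J}
    (hF : (hG.fin a).toFinset ⊆ F) :
    hG.aut a = gateProd G hG.comm F * a * gateProd G hG.comm F := (hG.conj_eq a hF).symm

theorem IsGateFamily.eventually_aut_eq (hG : IsGateFamily G) (a : A) :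
    ∀ᶠ F in Filter.atTop, hG.aut a = gateProd G hG.comm F * a * gateProd G hG.comm F :=
  Filter.eventually_atTop.2 ⟨_, fun _ h => hG.aut_eq a h⟩

theorem IsGateFamily.aut_aut (hG : IsGateFamily G) (a : A) : hG.aut (hG.aut a) = a :=
  hG.aut.left_inv a

end Gates

end

noncomputable section

/-! ## Signs -/

/-- A sign as a complex number. -/
def signC (u : ℤˣ) : ℂ := ((u : ℤ) : ℂ)

theorem signC_one : signC 1 = 1 := by simp [signC]
theorem signC_neg (u : ℤˣ) : signC (-u) = -signC u := by simp [signC]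
theorem signC_mul (u v : ℤˣ) : signC (u * v) = signC u * signC v := by simp [signC]
theorem signC_mul_self (u : ℤˣ) : signC u * signC u = 1 := by
  rw [← signC_mul, Int.units_mul_self, signC_one]
theorem star_signC (u : ℤˣ) : star (signC u) = signC u := by simp [signC]
theorem norm_signC (u : ℤˣ) : ‖signC u‖ = 1 := by
  rcases Int.units_eq_one_or u with h | h <;> simp [h, signC]
theorem signC_ne_zero (u : ℤˣ) : signC u ≠ 0 := by
  rw [← norm_ne_zero_iff, norm_signC]; exact one_ne_zero

section Fock

variable {ι : Type} [LinearOrder ι]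

/-- The diagonal operator whose eigenvalue is the product of the signs of the occupied modes. -/
def signOp (ε : ι → ℤˣ) : FOp ι :=
  wcomp (fun S => signC (∏ x ∈ S, ε x)) id (fun _ => (norm_signC _).le)
    Function.injective_id.injOn

theorem signOp_apply (ε : ι → ℤˣ) (ψ S) : signOp ε ψ S = signC (∏ x ∈ S, ε x) * ψ S := rfl

theorem signOp_mul (ε δ : ι → ℤˣ) : signOp ε * signOp δ = signOp (ε * δ) :=
  l2op_ext fun ψ S => by
    rw [mul_apply_eq_comp, signOp_apply, signOp_apply, signOp_apply, ← mul_assoc,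
      ← signC_mul, ← Finset.prod_mul_distrib]
    rfl

theorem signOp_one : signOp (1 : ι → ℤˣ) = 1 :=
  l2op_ext fun ψ S => by
    rw [signOp_apply, l2op_one_apply]
    simp [signC_one]

theorem signOp_mul_self (ε : ι → ℤˣ) : signOp ε * signOp ε = 1 := by
  rw [signOp_mul, ← signOp_one]
  congr 1
  ext x
  simp

theorem star_signOp (ε : ι → ℤˣ) : star (signOp ε) = signOp ε :=
  star_wcomp _ _ _ _ (fun _ _ => ⟨rfl, (star_signC _).symm⟩)
    (fun _ _ => ⟨rfl, (star_signC _).symm⟩)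

theorem signOp_commute (ε δ : ι → ℤˣ) : Commute (signOp ε) (signOp δ) := by
  rw [Commute, SemiconjBy, signOp_mul, signOp_mul, mul_comm]

/-- Conjugation with `signOp`. -/
def signConj (ε : ι → ℤˣ) : FOp ι ≃⋆ₐ[ℂ] FOp ι :=
  conjHom (signOp ε) (by rw [star_signOp, signOp_mul_self]) (by rw [star_signOp, signOp_mul_self])

theorem signConj_apply (ε : ι → ℤˣ) (A) : signConj ε A = signOp ε * A * signOp ε := by
  rw [signConj, conjHom_apply, star_signOp]

theorem signConj_signConj (ε δ : ι → ℤˣ) (A) :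
    signConj ε (signConj δ A) = signConj (ε * δ) A := by
  rw [signConj_apply, signConj_apply, signConj_apply, ← signOp_mul]
  nth_rw 2 [(signOp_commute ε δ).eq]
  simp only [mul_assoc]

theorem signConj_one (A : FOp ι) : signConj 1 A = A := by
  rw [signConj_apply, signOp_one, one_mul, mul_one]

theorem signConj_self (ε : ι → ℤˣ) (A) : signConj ε (signConj ε A) = A := by
  rw [signConj_signConj, show ε * ε = 1 from funext fun x => Int.units_mul_self _, signConj_one]

theorem signConj_eq_self_iff (ε : ι → ℤˣ) (A) :
    signConj ε A = A ↔ Commute (signOp ε) A := by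
  rw [signConj_apply]
  constructor
  · intro h
    rw [Commute, SemiconjBy]
    nth_rw 2 [← h]
    rw [mul_assoc, signOp_mul_self, mul_one]
  · intro h
    rw [h.eq, mul_assoc, signOp_mul_self, mul_one]

/-! ## Creation and annihilation operators -/

/-- The signs of the modes before `i`. -/
def below (i : ι) : ι → ℤˣ := fun x => if x < i then -1 else 1

theorem below_self (i : ι) : below i i = 1 := by simp [below]

theorem below_swap {i j : ι} (h : i ≠ j) : below i j = -below j i := by
  rcases lt_or_gt_of_ne h with h | h <;> simp [below, h, h.not_gt]

/-- The Jordan–Wigner sign as a product over occupied modes, so that all sign computations become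
manipulations of products in the group of units. -/
theorem annih_apply (i : ι) (ψ S) :
    annih ι i ψ S = if i ∈ S then 0 else signC (∏ x ∈ S, below i x) * ψ (insert i S) := by
  have h0 : annih ι i ψ S = (if i ∈ S then 0 else (-1) ^ (S.filter (· < i)).card)
    * ψ (insert i S) := rfl
  rw [h0]
  have : ((-1) ^ (S.filter (· < i)).card : ℂ) = signC (∏ x ∈ S, below i x) := by
    rw [signC]
    simp only [below]
    rw [← Finset.prod_filter, Finset.prod_const]
    simp
  rw [this]
  split_ifs <;> simp

theorem prod_below_erase (i : ι) (S : Finset ι) :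
    ∏ x ∈ S.erase i, below i x = ∏ x ∈ S, below i x :=
  Finset.prod_erase _ (below_self i)

theorem prod_below_insert (i j : ι) (S : Finset ι) (h : j ∉ S) :
    ∏ x ∈ insert j S, below i x = below i j * ∏ x ∈ S, below i x :=
  Finset.prod_insert h

theorem star_annih_apply (i : ι) (ψ S) :
    star (annih ι i) ψ S = if i ∈ S then signC (∏ x ∈ S, below i x) * ψ (S.erase i) else 0 := by
  have h0 : annih ι i = wcomp (fun S => if i ∈ S then 0 else signC (∏ x ∈ S, below i x))
      (fun S => insert i S) (by intro S; split_ifs <;> simp [norm_signC])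
      (by
        intro S hS T hT h
        have hS' : i ∉ S := by intro h'; simp [h'] at hS
        have hT' : i ∉ T := by intro h'; simp [h'] at hT
        simpa [Finset.erase_insert hS', Finset.erase_insert hT'] using
          congrArg (fun R : Finset ι => R.erase i) h) :=
    l2op_ext fun ψ S => by
      refine (annih_apply i ψ S).trans (Eq.trans ?_ (wcomp_apply _ _ _ _ ψ S).symm)
      split_ifs <;> simp
  rw [h0]
  refine (star_wcomp_apply _ _ (fun S => if i ∈ S then signC (∏ x ∈ S, below i x) else 0)
    (fun S => S.erase i) (by intro S; split_ifs <;> simp [norm_signC])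
    (by
      intro S hS T hT h
      have hS' : i ∈ S := by by_contra h'; simp [h'] at hS
      have hT' : i ∈ T := by by_contra h'; simp [h'] at hT
      simpa [Finset.insert_erase hS', Finset.insert_erase hT'] using
        congrArg (fun R : Finset ι => insert i R) h) ?_ ?_ ψ S).trans ?_
  · intro S hS
    have hS' : i ∉ S := by intro h'; simp [h'] at hS
    refine ⟨Finset.erase_insert hS', ?_⟩
    simp only [Finset.mem_insert_self, if_true, hS', if_false, star_signC]
    rw [prod_below_insert _ _ _ hS', below_self, one_mul]
  · intro S hS
    have hS' : i ∈ S := by by_contra h'; simp [h'] at hS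
    refine ⟨Finset.insert_erase hS', ?_⟩
    simp only [Finset.notMem_erase, if_false, hS', if_true, star_signC]
    rw [prod_below_erase]
  · split_ifs <;> simp

/-- Of two different modes exactly one precedes the other, so exactly one of the two orders of
application picks up the extra sign `below_swap`. -/
theorem annih_mul_annih (i j : ι) : annih ι i * annih ι j = -(annih ι j * annih ι i) :=
  l2op_ext fun ψ S => by
    rw [l2op_neg_apply, mul_apply_eq_comp, mul_apply_eq_comp]
    simp only [annih_apply, Finset.mem_insert]
    by_cases hij : i = j
    · subst hij; simp
    by_cases hi : i ∈ S <;> by_cases hj : j ∈ S <;>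
      simp only [hi, hj, hij, Ne.symm hij, or_true, or_false, if_true, if_false, mul_zero, neg_zero]
    rw [Finset.prod_insert hi, Finset.prod_insert hj, signC_mul, signC_mul, below_swap hij,
      signC_neg, Finset.insert_comm]
    ring

theorem annih_mul_self (i : ι) : annih ι i * annih ι i = 0 := by
  have := annih_mul_annih i i
  rwa [eq_neg_iff_add_eq_zero, ← two_smul ℂ, smul_eq_zero_iff_right two_ne_zero] at this

theorem annih_mul_star_annih {i j : ι} (hij : i ≠ j) :
    annih ι i * star (annih ι j) = -(star (annih ι j) * annih ι i) :=
  l2op_ext fun ψ S => by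
    rw [l2op_neg_apply, mul_apply_eq_comp, mul_apply_eq_comp]
    simp only [annih_apply, star_annih_apply, Finset.mem_insert, Finset.mem_erase]
    by_cases hi : i ∈ S <;> by_cases hj : j ∈ S <;>
      simp only [hi, hj, hij, Ne.symm hij, or_true, or_false, and_true, ne_eq, not_false_eq_true,
        and_false, if_true, if_false, mul_zero, neg_zero]
    have h1 : ∏ x ∈ S, below i x = below i j * ∏ x ∈ S.erase j, below i x :=
      (Finset.mul_prod_erase _ _ hj).symm
    rw [Finset.prod_insert hi, signC_mul, h1, signC_mul, below_swap hij, signC_neg,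
      Finset.erase_insert_of_ne hij]
    linear_combination (-signC (∏ x ∈ S.erase j, below i x) * signC (∏ x ∈ S, below j x)
      * ψ (insert i (S.erase j))) * signC_mul_self (below j i)

theorem annih_anticomm_self (i : ι) :
    annih ι i * star (annih ι i) + star (annih ι i) * annih ι i = 1 :=
  l2op_ext fun ψ S => by
    rw [l2op_add_apply, mul_apply_eq_comp, mul_apply_eq_comp,
      l2op_one_apply]
    simp only [annih_apply, star_annih_apply]
    by_cases hi : i ∈ S
    · simp only [hi, if_true, Finset.notMem_erase, if_false, Finset.insert_erase, prod_below_erase]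
      rw [← mul_assoc, signC_mul_self, zero_add, one_mul]
    · simp only [hi, if_true, Finset.mem_insert_self, if_false, add_zero]
      rw [Finset.prod_insert hi, below_self, one_mul, ← mul_assoc, signC_mul_self, one_mul,
        Finset.erase_insert hi]

theorem signOp_mul_annih (ε : ι → ℤˣ) (i : ι) :
    signOp ε * annih ι i = signC (ε i) • (annih ι i * signOp ε) :=
  l2op_ext fun ψ S => by
    rw [l2op_smul_apply, mul_apply_eq_comp, mul_apply_eq_comp,
      signOp_apply, annih_apply, annih_apply, signOp_apply]
    split_ifs with h
    · simp
    · rw [Finset.prod_insert h, signC_mul]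
      linear_combination (-signC (∏ x ∈ S, ε x) * signC (∏ x ∈ S, below i x) *
        ψ (insert i S)) * signC_mul_self (ε i)

theorem signConj_annih (ε : ι → ℤˣ) (i : ι) :
    signConj ε (annih ι i) = signC (ε i) • annih ι i := by
  rw [signConj_apply, signOp_mul_annih, smul_mul_assoc, mul_assoc, signOp_mul_self, mul_one]

theorem annih_mem_carLocal {M : Set ι} {i : ι} (h : i ∈ M) : annih ι i ∈ carLocal ι M :=
  StarAlgebra.subset_adjoin ℂ _ ⟨i, h, rfl⟩

theorem carLocal_mono {M M' : Set ι} (h : M ⊆ M') : carLocal ι M ≤ carLocal ι M' :=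
  StarAlgebra.adjoin_mono fun _ ⟨i, hi, e⟩ => ⟨i, h hi, e⟩

theorem carEven_mono {M M' : Set ι} (h : M ⊆ M') : carEven ι M ≤ carEven ι M' :=
  StarAlgebra.adjoin_mono fun _ ⟨i, hi, j, hj, e⟩ => ⟨i, h hi, j, h hj, e⟩

theorem carEven_le_carLocal (M : Set ι) : carEven ι M ≤ carLocal ι M := by
  refine StarAlgebra.adjoin_le ?_
  rintro _ ⟨i, hi, j, hj, rfl | rfl | rfl⟩
  · exact mul_mem (annih_mem_carLocal hi) (annih_mem_carLocal hj)
  · exact mul_mem (annih_mem_carLocal hi) (star_mem (annih_mem_carLocal hj))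
  · exact mul_mem (star_mem (annih_mem_carLocal hi)) (annih_mem_carLocal hj)

/-- On operators of the modes in `M`, only the signs of these modes matter. -/
theorem signConj_congr {M : Set ι} {ε δ : ι → ℤˣ} (h : ∀ i ∈ M, ε i = δ i) {A : FOp ι}
    (hA : A ∈ carLocal ι M) : signConj ε A = signConj δ A := by
  refine eq_of_mem_adjoin (signConj ε : FOp ι →⋆ₐ[ℂ] FOp ι) (signConj δ : FOp ι →⋆ₐ[ℂ] FOp ι) ?_ hA
  rintro _ ⟨i, hi, rfl⟩
  change signConj ε _ = signConj δ _
  rw [signConj_annih, signConj_annih, h i hi]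

theorem signConj_mem {M : Set ι} (ε : ι → ℤˣ) {A : FOp ι} (hA : A ∈ carLocal ι M) :
    signConj ε A ∈ carLocal ι M := by
  refine map_mem_of_mem_adjoin (signConj ε : FOp ι →⋆ₐ[ℂ] FOp ι) ?_ hA
  rintro _ ⟨i, hi, rfl⟩
  change signConj ε _ ∈ _
  rw [signConj_annih]
  exact (carLocal ι M).smul_mem (annih_mem_carLocal hi) _

/-- Each generator of the even algebra contains two creation or annihilation operators, hence the
factor `u` twice. -/
theorem signConj_eq_self_of_carEven {M : Set ι} {ε : ι → ℤˣ} {u : ℤˣ} (h : ∀ i ∈ M, ε i = u)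
    {A : FOp ι} (hA : A ∈ carEven ι M) : signConj ε A = A := by
  refine eq_of_mem_adjoin (signConj ε : FOp ι →⋆ₐ[ℂ] FOp ι) (StarAlgHom.id ℂ _) ?_ hA
  have hs : ∀ i ∈ M, signConj ε (annih ι i) = signC u • annih ι i := fun i hi => by
    rw [signConj_annih, h i hi]
  rintro _ ⟨i, hi, j, hj, rfl | rfl | rfl⟩ <;> change signConj ε _ = _ <;>
    simp only [map_mul, map_star, hs i hi, hs j hj, star_smul, star_signC] <;>
    rw [smul_mul_smul_comm, signC_mul_self, one_smul] <;> rfl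

/-- Operators of disjoint sets of modes commute up to signs. -/
theorem annih_mul_of_mem {M : Set ι} {i : ι} (hi : i ∉ M) {A : FOp ι} (hA : A ∈ carLocal ι M) :
    annih ι i * A = signConj (fun _ => -1) A * annih ι i := by
  refine intertwine_of_mem_adjoin (StarAlgHom.id ℂ _)
    ((signConj (fun _ : ι => (-1 : ℤˣ)) : FOp ι ≃⋆ₐ[ℂ] FOp ι) : FOp ι →⋆ₐ[ℂ] FOp ι)
    (annih ι i) ?_ hA
  rintro _ ⟨j, hj, rfl⟩
  have hij : i ≠ j := fun h => hi (h ▸ hj)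
  change annih ι i * annih ι j = signConj _ _ * _ ∧
    annih ι i * star (annih ι j) = signConj _ (star (annih ι j)) * _
  rw [map_star, signConj_annih, signC_neg, signC_one, neg_one_smul, star_neg, neg_mul, neg_mul]
  exact ⟨annih_mul_annih i j, annih_mul_star_annih hij⟩

theorem annih_commute_of_carEven {M : Set ι} {i : ι} (hi : i ∉ M) {A : FOp ι}
    (hA : A ∈ carEven ι M) : Commute (annih ι i) A := by
  have := annih_mul_of_mem hi (carEven_le_carLocal M hA)
  rwa [signConj_eq_self_of_carEven (fun _ _ => rfl) hA] at this

/-- This is locality for fermions: an even operator commutes even with odd operators elsewhere. It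
is why gates have to be observables. -/
theorem carEven_commute_carLocal {M M' : Set ι} (hd : Disjoint M M') {A B : FOp ι}
    (hA : A ∈ carEven ι M) (hB : B ∈ carLocal ι M') : Commute A B := by
  refine commute_of_mem_adjoin ?_ hB
  rintro _ ⟨i, hi, rfl⟩
  have hi' := Set.disjoint_right.1 hd hi
  exact ⟨(annih_commute_of_carEven hi' hA).symm,
    by simpa using (annih_commute_of_carEven hi' (star_mem hA)).symm.star_star⟩

/-! ## Permutations of modes -/

/-- The sign of a pair of modes whose order is reversed by `σ`. -/
def invSign (σ : Equiv.Perm ι) (i j : ι) : ℤˣ := if i < j ∧ σ j < σ i then -1 else 1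

theorem permSign_eq (σ : Equiv.Perm ι) (S : Finset ι) :
    permSign σ S = signC (∏ i ∈ S, ∏ j ∈ S, invSign σ i j) := by
  simp only [permSign, invSign, signC, Units.coe_prod, Int.cast_prod]
  refine Finset.prod_congr rfl fun i _ => Finset.prod_congr rfl fun j _ => ?_
  split_ifs <;> simp

theorem fockPerm_apply (σ : Equiv.Perm ι) (ψ S) :
    fockPerm σ ψ S = permSign σ (S.map σ.symm.toEmbedding) * ψ (S.map σ.symm.toEmbedding) := rfl

theorem star_fockPerm_apply (σ : Equiv.Perm ι) (ψ S) :
    star (fockPerm σ) ψ S = permSign σ S * ψ (S.map σ.toEmbedding) := by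
  have e1 : ∀ S : Finset ι, (S.map σ.toEmbedding).map σ.symm.toEmbedding = S := fun S => by
    ext; simp
  have e2 : ∀ S : Finset ι, (S.map σ.symm.toEmbedding).map σ.toEmbedding = S := fun S => by
    ext; simp
  rw [fockPerm, star_wcomp (c' := fun S => permSign σ S) (g' := fun S => S.map σ.toEmbedding) _ _
    (fun S => by rw [permSign_eq, norm_signC]) (Finset.map_injective _).injOn, wcomp_apply]
  · intro S _
    exact ⟨e2 S, by rw [permSign_eq, star_signC]⟩
  · intro S _
    refine ⟨e1 S, ?_⟩
    rw [e1, permSign_eq, star_signC]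

theorem fockPerm_mul_star (σ : Equiv.Perm ι) : fockPerm σ * star (fockPerm σ) = 1 :=
  l2op_ext fun ψ S => by
    rw [mul_apply_eq_comp, fockPerm_apply, star_fockPerm_apply, permSign_eq,
      ← mul_assoc, signC_mul_self, one_mul, l2op_one_apply]
    have e2 : (S.map σ.symm.toEmbedding).map σ.toEmbedding = S := by ext; simp
    rw [e2]

theorem star_mul_fockPerm (σ : Equiv.Perm ι) : star (fockPerm σ) * fockPerm σ = 1 :=
  l2op_ext fun ψ S => by
    have e1 : (S.map σ.toEmbedding).map σ.symm.toEmbedding = S := by ext; simp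
    rw [mul_apply_eq_comp, star_fockPerm_apply, fockPerm_apply, e1, permSign_eq,
      ← mul_assoc, signC_mul_self, one_mul, l2op_one_apply]

/-- At most one of the two factors on the left is nontrivial, and it is so when `σ` reverses the
pair, that is, when "before `i`" and "before `σ i`" disagree on the other mode. -/
theorem invSign_mul_invSign (σ : Equiv.Perm ι) {i j : ι} (h : i ≠ j) :
    invSign σ i j * invSign σ j i = below i j * below (σ i) (σ j) := by
  have h' : σ i ≠ σ j := fun e => h (σ.injective e)
  rcases lt_or_gt_of_ne h with h | h <;> rcases lt_or_gt_of_ne h' with h' | h' <;>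
    simp [invSign, below, h, h', h.not_gt, h'.not_gt]

theorem invSign_self (σ : Equiv.Perm ι) (i : ι) : invSign σ i i = 1 := by simp [invSign]

/-- Adding `i` to `T` changes the permutation sign by the reversed pairs that contain `i`, which is
exactly the discrepancy between the strings before `i` and before `σ i`. -/
theorem fockPerm_mul_annih (σ : Equiv.Perm ι) (i : ι) :
    fockPerm σ * annih ι i = annih ι (σ i) * fockPerm σ :=
  l2op_ext fun ψ S => by
    obtain ⟨T, rfl⟩ : ∃ T : Finset ι, S = T.map σ.toEmbedding :=
      ⟨S.map σ.symm.toEmbedding, by ext; simp⟩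
    have e1 : ∀ S : Finset ι, (S.map σ.toEmbedding).map σ.symm.toEmbedding = S := fun S => by
      ext; simp
    have e3 : insert (σ i) (T.map σ.toEmbedding) = (insert i T).map σ.toEmbedding := by
      rw [Finset.map_insert]; rfl
    rw [mul_apply_eq_comp, mul_apply_eq_comp, fockPerm_apply, annih_apply,
      annih_apply, e3, fockPerm_apply, e1, e1]
    have e4 : σ i ∈ T.map σ.toEmbedding ↔ i ∈ T := by simp
    simp only [e4]
    split_ifs with hi
    · simp
    · rw [← mul_assoc, ← mul_assoc, permSign_eq, permSign_eq, ← signC_mul, ← signC_mul]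
      congr 2
      rw [Finset.prod_insert hi, Finset.prod_insert hi, invSign_self, one_mul, Finset.prod_map]
      have : ∀ x ∈ T, ∏ j ∈ insert i T, invSign σ x j
          = invSign σ x i * ∏ j ∈ T, invSign σ x j := fun x _ => Finset.prod_insert hi
      rw [Finset.prod_congr rfl this, Finset.prod_mul_distrib, ← mul_assoc (∏ x ∈ T, invSign σ i x)]
      nth_rw 2 [← Finset.prod_mul_distrib]
      have : ∀ x ∈ T, invSign σ i x * invSign σ x i = below i x * below (σ i) (σ x) := fun x hx =>
        invSign_mul_invSign σ fun e => hi (e ▸ hx)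
      rw [Finset.prod_congr rfl this, Finset.prod_mul_distrib]
      simp only [Equiv.coe_toEmbedding]
      generalize ∏ x ∈ T, below i x = a
      generalize ∏ x ∈ T, below (σ i) (σ x) = b
      generalize (∏ x ∈ T, ∏ j ∈ T, invSign σ x j) = c
      have hb := Int.units_mul_self b
      calc c * a = (b * b) * a * c := by rw [hb, one_mul, mul_comm]
        _ = _ := by simp only [mul_comm, mul_left_comm]

/-- Conjugation with `fockPerm`. -/
def permConj (σ : Equiv.Perm ι) : FOp ι ≃⋆ₐ[ℂ] FOp ι :=
  conjHom (fockPerm σ) (fockPerm_mul_star σ) (star_mul_fockPerm σ)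

theorem permConj_apply (σ : Equiv.Perm ι) (A) :
    permConj σ A = fockPerm σ * A * star (fockPerm σ) := rfl

theorem permConj_annih (σ : Equiv.Perm ι) (i : ι) : permConj σ (annih ι i) = annih ι (σ i) := by
  rw [permConj_apply, fockPerm_mul_annih, mul_assoc, fockPerm_mul_star, mul_one]

end Fock

end

noncomputable section

/-! ## Amplification `T ↦ T ⊗ 1` -/

section Ampl

variable {X Z : Type}

/-- `ψ ↦ ψ (·, z)`. -/
def slice (z : Z) : ℓ²(X × Z, ℂ) →L[ℂ] ℓ²(X, ℂ) :=
  wcomp (fun _ => 1) (fun x => (x, z)) (by simp) (by intro x _ y _ h; simpa using h)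

theorem slice_apply (z : Z) (ψ : ℓ²(X × Z, ℂ)) (x : X) : slice z ψ x = ψ (x, z) := by
  exact (wcomp_apply _ _ _ _ ψ x).trans (one_mul _)

open Classical in
theorem adjoint_slice_apply (z : Z) (ψ : ℓ²(X, ℂ)) (p : X × Z) :
    ContinuousLinearMap.adjoint (slice z) ψ p = if p.2 = z then ψ p.1 else 0 := by
  refine (adjoint_wcomp_apply _ _ (fun p : X × Z => if p.2 = z then 1 else 0) Prod.fst
    (by intro p; split_ifs <;> simp)
    (by
      intro p hp q hq h
      have hp' : p.2 = z := by by_contra h'; simp [h'] at hp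
      have hq' : q.2 = z := by by_contra h'; simp [h'] at hq
      exact Prod.ext h (hp'.trans hq'.symm)) ?_ ?_ ψ p).trans ?_
  · intro x _; simp
  · intro p hp
    have hp' : p.2 = z := by by_contra h'; simp [h'] at hp
    exact ⟨Prod.ext rfl hp'.symm, by simp [hp']⟩
  · split_ifs <;> simp

/-- Different slices involve disjoint sets of coordinates of `ψ`, so their squared norms add up to
at most that of `ψ`. -/
theorem sum_norm_slice_le (ψ : ℓ²(X × Z, ℂ)) (s : Finset Z) :
    ∑ z ∈ s, ‖slice z ψ‖ ^ (2 : ENNReal).toReal ≤ ‖ψ‖ ^ (2 : ENNReal).toReal := by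
  classical
  have h : HasSum (fun x => ∑ z ∈ s, ‖slice z ψ x‖ ^ (2 : ENNReal).toReal)
      (∑ z ∈ s, ‖slice z ψ‖ ^ (2 : ENNReal).toReal) :=
    hasSum_sum fun z _ => lp.hasSum_norm (by simp) (slice z ψ)
  refine hasSum_le_of_sum_le h fun t => ?_
  simp_rw [slice_apply]
  exact (Finset.sum_product t s fun p => ‖ψ p‖ ^ (2 : ENNReal).toReal).symm.trans_le
    (lp.sum_rpow_le_norm_rpow (by simp) ψ (t ×ˢ s))

theorem sum_ampl_le (T : ℓ²(X, ℂ) →L[ℂ] ℓ²(X, ℂ)) (ψ : ℓ²(X × Z, ℂ)) (s : Finset (X × Z)) :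
    ∑ p ∈ s, ‖T (slice p.2 ψ) p.1‖ ^ (2 : ENNReal).toReal
      ≤ (‖T‖ * ‖ψ‖) ^ (2 : ENNReal).toReal := by
  classical
  calc ∑ p ∈ s, ‖T (slice p.2 ψ) p.1‖ ^ (2 : ENNReal).toReal
      ≤ ∑ p ∈ s.image Prod.fst ×ˢ s.image Prod.snd,
          ‖T (slice p.2 ψ) p.1‖ ^ (2 : ENNReal).toReal :=
        Finset.sum_le_sum_of_subset_of_nonneg Finset.subset_product
          fun _ _ _ => by positivity
    _ = ∑ z ∈ s.image Prod.snd, ∑ x ∈ s.image Prod.fst,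
          ‖T (slice z ψ) x‖ ^ (2 : ENNReal).toReal := Finset.sum_product_right _ _ _
    _ ≤ ∑ z ∈ s.image Prod.snd, ‖T‖ ^ (2 : ENNReal).toReal
          * ‖slice z ψ‖ ^ (2 : ENNReal).toReal := by
        refine Finset.sum_le_sum fun z _ => ?_
        refine (lp.sum_rpow_le_norm_rpow (by simp) (T (slice z ψ)) _).trans ?_
        rw [← Real.mul_rpow (norm_nonneg _) (norm_nonneg _)]
        exact Real.rpow_le_rpow (norm_nonneg _) (T.le_opNorm _) (by simp)
    _ ≤ (‖T‖ * ‖ψ‖) ^ (2 : ENNReal).toReal := by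
        rw [← Finset.mul_sum, Real.mul_rpow (norm_nonneg _) (norm_nonneg _)]
        exact mul_le_mul_of_nonneg_left (sum_norm_slice_le ψ _) (by positivity)

/-- The operator `T ⊗ 1`. -/
def amplOp (T : ℓ²(X, ℂ) →L[ℂ] ℓ²(X, ℂ)) : ℓ²(X × Z, ℂ) →L[ℂ] ℓ²(X × Z, ℂ) :=
  LinearMap.mkContinuous
    { toFun := fun ψ => ⟨fun p => T (slice p.2 ψ) p.1, memℓp_gen' (sum_ampl_le T ψ)⟩
      map_add' := fun ψ φ => by
        ext p
        change T (slice p.2 (ψ + φ)) p.1 = T (slice p.2 ψ) p.1 + T (slice p.2 φ) p.1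
        rw [map_add, map_add]; rfl
      map_smul' := fun a ψ => by
        ext p
        change T (slice p.2 (a • ψ)) p.1 = a • T (slice p.2 ψ) p.1
        rw [map_smul, map_smul]; rfl }
    ‖T‖ (fun ψ => lp.norm_le_of_forall_sum_le (by simp) (by positivity) (sum_ampl_le T ψ))

theorem amplOp_apply (T : ℓ²(X, ℂ) →L[ℂ] ℓ²(X, ℂ)) (ψ : ℓ²(X × Z, ℂ)) (p : X × Z) :
    amplOp T ψ p = T (slice p.2 ψ) p.1 := rfl

theorem slice_amplOp (T : ℓ²(X, ℂ) →L[ℂ] ℓ²(X, ℂ)) (z : Z) (ψ : ℓ²(X × Z, ℂ)) :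
    slice z (amplOp T ψ) = T (slice z ψ) := by
  ext x
  rw [slice_apply, amplOp_apply]

theorem amplOp_adjoint_slice (T : ℓ²(X, ℂ) →L[ℂ] ℓ²(X, ℂ)) (z : Z) (ψ : ℓ²(X, ℂ)) :
    amplOp T (ContinuousLinearMap.adjoint (slice z) ψ)
      = ContinuousLinearMap.adjoint (slice z) (T ψ) := by
  classical
  ext p
  rw [amplOp_apply, adjoint_slice_apply]
  split_ifs with h
  · have : slice p.2 (ContinuousLinearMap.adjoint (slice z) ψ) = ψ := by
      ext x
      rw [slice_apply, adjoint_slice_apply, if_pos h]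
    rw [this]
  · have : slice p.2 (ContinuousLinearMap.adjoint (slice z) ψ) = 0 := by
      ext x
      rw [slice_apply, adjoint_slice_apply, if_neg h]; rfl
    rw [this, map_zero]; rfl

theorem slice_joint_injective {A B : ℓ²(X × Z, ℂ) →L[ℂ] ℓ²(X × Z, ℂ)}
    (h : ∀ z ψ, slice z (A ψ) = slice z (B ψ)) : A = B :=
  l2op_ext fun ψ p => by
    rw [← slice_apply p.2 (A ψ) p.1, h, slice_apply]

/-- The adjoint of the relation between `amplOp T` and the inclusion of the slice at `z` says that
the slices of both sides agree. -/
theorem star_amplOp (T : ℓ²(X, ℂ) →L[ℂ] ℓ²(X, ℂ)) :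
    star (amplOp (Z := Z) T) = amplOp (star T) := by
  refine slice_joint_injective fun z ψ => ?_
  have h1 : amplOp T ∘L ContinuousLinearMap.adjoint (slice (X := X) z)
      = ContinuousLinearMap.adjoint (slice z) ∘L T :=
    ContinuousLinearMap.ext fun φ => amplOp_adjoint_slice T z φ
  have h2 := congrArg ContinuousLinearMap.adjoint h1
  rw [ContinuousLinearMap.adjoint_comp, ContinuousLinearMap.adjoint_comp,
    ContinuousLinearMap.adjoint_adjoint] at h2
  rw [slice_amplOp]
  exact DFunLike.congr_fun h2 ψ

/-- The homomorphism `T ↦ T ⊗ 1`. -/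
def ampl (X Z : Type) : (ℓ²(X, ℂ) →L[ℂ] ℓ²(X, ℂ)) →⋆ₐ[ℂ] (ℓ²(X × Z, ℂ) →L[ℂ] ℓ²(X × Z, ℂ)) where
  toFun := amplOp
  map_one' := l2op_ext fun ψ p => by
    rw [amplOp_apply, l2op_one_apply, l2op_one_apply, slice_apply]
  map_zero' := l2op_ext fun ψ p => rfl
  map_mul' A B := slice_joint_injective fun z ψ => by
    rw [mul_apply_eq_comp, slice_amplOp, slice_amplOp, slice_amplOp, mul_apply_eq_comp]
  map_add' A B := l2op_ext fun ψ p => rfl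
  commutes' r := l2op_ext fun ψ p => by
    rw [amplOp_apply, Algebra.algebraMap_eq_smul_one, Algebra.algebraMap_eq_smul_one,
      l2op_smul_apply, l2op_smul_apply, l2op_one_apply, l2op_one_apply, slice_apply]
  map_star' A := (star_amplOp A).symm

theorem ampl_apply (T : ℓ²(X, ℂ) →L[ℂ] ℓ²(X, ℂ)) (ψ : ℓ²(X × Z, ℂ)) (p : X × Z) :
    ampl X Z T ψ p = T (slice p.2 ψ) p.1 := rfl

theorem ampl_injective [Nonempty Z] {T : ℓ²(X, ℂ) →L[ℂ] ℓ²(X, ℂ)} (h : ampl X Z T = 0) :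
    T = 0 := by
  classical
  obtain ⟨z⟩ := ‹Nonempty Z›
  refine l2op_ext fun ψ x => ?_
  have h1 := amplOp_adjoint_slice T z ψ
  rw [show amplOp T = 0 from h] at h1
  have h2 := congrArg (fun φ : ℓ²(X × Z, ℂ) => φ (x, z)) h1
  dsimp only at h2
  rw [adjoint_slice_apply, if_pos rfl] at h2
  exact h2.symm

/-- A diagonal operator with eigenvalues `± 1`. -/
def diagOp (d : X → ℤˣ) : ℓ²(X, ℂ) →L[ℂ] ℓ²(X, ℂ) :=
  wcomp (fun x => signC (d x)) id (fun _ => (norm_signC _).le) Function.injective_id.injOn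

theorem diagOp_apply (d : X → ℤˣ) (ψ x) : diagOp d ψ x = signC (d x) * ψ x := rfl

theorem diagOp_mul_self (d : X → ℤˣ) : diagOp d * diagOp d = 1 :=
  l2op_ext fun ψ x => by
    rw [mul_apply_eq_comp, diagOp_apply, diagOp_apply, ← mul_assoc, signC_mul_self, one_mul,
      l2op_one_apply]

theorem star_diagOp (d : X → ℤˣ) : star (diagOp d) = diagOp d :=
  star_wcomp _ _ _ _ (fun _ _ => ⟨rfl, (star_signC _).symm⟩)
    (fun _ _ => ⟨rfl, (star_signC _).symm⟩)

end Ampl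

/-! ## Embedding a set of modes into a larger one -/

section Embed

variable {ι κ : Type} [LinearOrder ι] [LinearOrder κ]

open Classical in
/-- A set of modes consists of a set of embedded modes and of a set of other modes. -/
def splitModes (e : ι ↪o κ) : Finset κ ≃ Finset ι × Finset {x // x ∉ Set.range e} where
  toFun T := (T.preimage e e.injective.injOn, T.subtype _)
  invFun p := p.1.map e.toEmbedding ∪ p.2.map (Function.Embedding.subtype _)
  left_inv T := by
    ext x
    by_cases hx : x ∈ Set.range e
    · obtain ⟨i, rfl⟩ := hx
      simp
    · have : ∀ i, e i ≠ x := fun i h => hx ⟨i, h⟩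
      simp [this]
  right_inv p := by
    refine Prod.ext ?_ ?_
    · ext i
      rw [Finset.mem_preimage, Finset.mem_union]
      simp
    · ext ⟨x, hx⟩
      have : ∀ i, e i ≠ x := fun i h => hx ⟨i, h⟩
      simp [this]

open Classical in
/-- The sign from moving the embedded modes in front of the others. -/
def splitSign (e : ι ↪o κ) (T : Finset κ) : ℤˣ :=
  ∏ x ∈ T, ∏ y ∈ T, if x ∈ Set.range e ∧ y ∉ Set.range e ∧ y < x then -1 else 1

/-- The homomorphism that maps each annihilation operator to that of the embedded mode. -/
def embHom (e : ι ↪o κ) : FOp ι →⋆ₐ[ℂ] FOp κ :=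
  ((conjHom (diagOp (splitSign e)) (by rw [star_diagOp, diagOp_mul_self])
    (by rw [star_diagOp, diagOp_mul_self]) : FOp κ ≃⋆ₐ[ℂ] FOp κ) : FOp κ →⋆ₐ[ℂ] FOp κ).comp
    ((StarAlgHomClass.toStarAlgHom (relabelOp (splitModes e).symm)).comp (ampl _ _))

theorem embHom_eq (e : ι ↪o κ) (A : FOp ι) : embHom e A
    = diagOp (splitSign e) * relabelOp (splitModes e).symm (ampl _ _ A)
      * diagOp (splitSign e) := by
  have : embHom e A = diagOp (splitSign e) * relabelOp (splitModes e).symm (ampl _ _ A)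
      * star (diagOp (splitSign e)) := rfl
  rw [this, star_diagOp]

theorem embHom_apply (e : ι ↪o κ) (A : FOp ι) (ψ T) : embHom e A ψ T
    = signC (splitSign e T) * A (slice (splitModes e T).2
        (relabel (splitModes e) (diagOp (splitSign e) ψ))) (splitModes e T).1 := by
  rw [embHom_eq, mul_apply_eq_comp, mul_apply_eq_comp, diagOp_apply, relabelOp_apply]
  rfl

theorem embHom_injective (e : ι ↪o κ) {A : FOp ι} (h : embHom e A = 0) : A = 0 := by
  rw [embHom_eq] at h
  have hd := diagOp_mul_self (splitSign e)
  generalize diagOp (splitSign e) = D at h hd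
  refine ampl_injective (Z := Finset {x // x ∉ Set.range e}) ?_
  have h2 : relabelOp (splitModes e).symm (ampl _ _ A) = D * (D *
      relabelOp (splitModes e).symm (ampl _ _ A) * D) * D := by
    simp only [mul_assoc, hd, mul_one]
    rw [← mul_assoc, hd, one_mul]
  rw [h, mul_zero, zero_mul] at h2
  exact (map_eq_zero_iff _ (relabelOp (splitModes e).symm).injective).1 h2

/-- The string of `e i` also runs over modes outside the range of `e`; conjugation with `splitSign`
supplies precisely this part. -/
theorem embHom_annih (e : ι ↪o κ) (i : ι) : embHom e (annih ι i) = annih κ (e i) :=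
  l2op_ext fun ψ T => by
    classical
    have hm : i ∈ (splitModes e T).1 ↔ e i ∈ T := by simp [splitModes]
    rw [embHom_apply, annih_apply, annih_apply]
    simp only [hm]
    split_ifs with hi
    · simp
    · have hT : (splitModes e).symm (insert i (splitModes e T).1, (splitModes e T).2)
          = insert (e i) T := by
        nth_rw 3 [← (splitModes e).symm_apply_apply T]
        simp [splitModes, Finset.map_insert, Finset.insert_union]
      rw [slice_apply, relabel_apply, diagOp_apply, hT, ← mul_assoc, ← mul_assoc, ← signC_mul,
        ← signC_mul]
      congr 2
      have h1 : ∏ x ∈ (splitModes e T).1, below i x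
          = ∏ y ∈ T, if y ∈ Set.range e then below (e i) y else 1 := by
        have : ∀ x, below i x = below (e i) (e x) := fun x => by simp [below]
        simp_rw [this]
        rw [← Finset.prod_filter]
        exact Finset.prod_preimage' _ _ e.injective.injOn _
      -- The new embedded mode forms counted pairs only with the other modes in front of it; it
      -- never is the non-embedded member of a pair.
      have h2 : splitSign e (insert (e i) T)
          = (∏ y ∈ T, if y ∈ Set.range e then 1 else below (e i) y) * splitSign e T := by
        rw [splitSign, Finset.prod_insert hi, Finset.prod_insert hi, splitSign]
        have h3 : ∀ x ∈ T, (∏ y ∈ insert (e i) T,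
            if x ∈ Set.range e ∧ y ∉ Set.range e ∧ y < x then (-1 : ℤˣ) else 1)
            = ∏ y ∈ T, if x ∈ Set.range e ∧ y ∉ Set.range e ∧ y < x then -1 else 1 :=
          fun x _ => by
            rw [Finset.prod_insert hi, if_neg (by simp), one_mul]
        rw [Finset.prod_congr rfl h3, if_neg (by simp), one_mul]
        congr 1
        refine Finset.prod_congr rfl fun y _ => ?_
        by_cases hy : y ∈ Set.range e <;> simp [hy, below]
      have h4 : ∏ y ∈ T, below (e i) y = (∏ y ∈ T, if y ∈ Set.range e then below (e i) y else 1)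
          * ∏ y ∈ T, if y ∈ Set.range e then 1 else below (e i) y := by
        rw [← Finset.prod_mul_distrib]
        refine Finset.prod_congr rfl fun y _ => ?_
        split_ifs <;> simp
      rw [h1, h2, h4]
      have h5 := Int.units_mul_self (splitSign e T)
      generalize splitSign e T = s at h5
      calc _ = (∏ y ∈ T, if y ∈ Set.range e then below (e i) y else 1)
            * (∏ y ∈ T, if y ∈ Set.range e then 1 else below (e i) y) * (s * s) := by
            generalize (∏ y ∈ T, if y ∈ Set.range e then below (e i) y else 1) = p
            generalize (∏ y ∈ T, if y ∈ Set.range e then 1 else below (e i) y) = q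
            rw [mul_comm (p * q), mul_assoc s s, mul_left_comm s p q, mul_comm q s, mul_assoc]
        _ = _ := by rw [h5, mul_one]

theorem embHom_mem (e : ι ↪o κ) {M : Set ι} {A : FOp ι} (hA : A ∈ carLocal ι M) :
    embHom e A ∈ carLocal κ (e '' M) := by
  refine map_mem_of_mem_adjoin (embHom e) ?_ hA
  rintro _ ⟨i, hi, rfl⟩
  rw [embHom_annih]
  exact annih_mem_carLocal ⟨i, hi, rfl⟩

theorem embHom_mem_carEven (e : ι ↪o κ) {M : Set ι} {A : FOp ι} (hA : A ∈ carEven ι M) :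
    embHom e A ∈ carEven κ (e '' M) := by
  refine map_mem_of_mem_adjoin (embHom e) ?_ hA
  rintro _ ⟨i, hi, j, hj, h⟩
  refine StarAlgebra.subset_adjoin ℂ _ ⟨e i, ⟨i, hi, rfl⟩, e j, ⟨j, hj, rfl⟩, ?_⟩
  rcases h with rfl | rfl | rfl <;> simp [map_mul, map_star, embHom_annih]

theorem signConj_embHom (e : ι ↪o κ) (ε : κ → ℤˣ) {A : FOp ι} (hA : A ∈ CAR ι) :
    signConj ε (embHom e A) = embHom e (signConj (fun i => ε (e i)) A) := by
  refine eq_of_mem_adjoin (((signConj ε : FOp κ ≃⋆ₐ[ℂ] FOp κ) : FOp κ →⋆ₐ[ℂ] FOp κ).comp (embHom e))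
    ((embHom e).comp ((signConj (fun i => ε (e i)) : FOp ι ≃⋆ₐ[ℂ] FOp ι) : FOp ι →⋆ₐ[ℂ] FOp ι))
    ?_ hA
  rintro _ ⟨i, _, rfl⟩
  change signConj ε (embHom e _) = embHom e (signConj _ _)
  rw [embHom_annih, signConj_annih, signConj_annih, map_smul, embHom_annih]

theorem permConj_embHom (e : ι ↪o κ) (σ : Equiv.Perm κ) (τ : Equiv.Perm ι)
    (h : ∀ i, σ (e i) = e (τ i)) {A : FOp ι} (hA : A ∈ CAR ι) :
    permConj σ (embHom e A) = embHom e (permConj τ A) := by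
  refine eq_of_mem_adjoin (((permConj σ : FOp κ ≃⋆ₐ[ℂ] FOp κ) : FOp κ →⋆ₐ[ℂ] FOp κ).comp (embHom e))
    ((embHom e).comp ((permConj τ : FOp ι ≃⋆ₐ[ℂ] FOp ι) : FOp ι →⋆ₐ[ℂ] FOp ι))
    ?_ hA
  rintro _ ⟨i, _, rfl⟩
  change permConj σ (embHom e _) = embHom e (permConj _ _)
  rw [embHom_annih, permConj_annih, permConj_annih, embHom_annih, h]

end Embed

/-! ## Additional modes -/

section AddModes

variable {ι : Type} [LinearOrder ι] {k : ℕ}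

/-- The set of modes that consists of old and new ones. -/
def joinModes (L : Finset ι) (K : Finset (Fin k)) : Finset (AddModes ι k) :=
  (L.disjSum K).map toLex.toEmbedding

theorem joinModes_surj (S : Finset (AddModes ι k)) :
    ∃ (L : Finset ι) (K : Finset (Fin k)), S = joinModes L K := by
  refine ⟨(S.map ofLex.toEmbedding).toLeft, (S.map ofLex.toEmbedding).toRight, ?_⟩
  rw [joinModes, Finset.toLeft_disjSum_toRight]
  ext x; simp

theorem oldMode_mem_joinModes {i : ι} {L : Finset ι} {K : Finset (Fin k)} :
    oldMode i ∈ joinModes L K ↔ i ∈ L := by simp [joinModes]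

theorem newMode_mem_joinModes {j : Fin k} {L : Finset ι} {K : Finset (Fin k)} :
    newMode j ∈ joinModes L K ↔ j ∈ K := by simp [joinModes]

theorem insert_oldMode [DecidableEq (AddModes ι k)] {i : ι} {L : Finset ι} {K : Finset (Fin k)} :
    insert (oldMode i) (joinModes L K) = joinModes (insert i L) K := by
  ext x
  rcases h : ofLex x with y | y <;> obtain rfl : x = toLex _ := h <;> simp [joinModes]

theorem insert_newMode [DecidableEq (AddModes ι k)] {j : Fin k} {L : Finset ι} {K : Finset (Fin k)} :
    insert (newMode j) (joinModes L K) = joinModes L (insert j K) := by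
  ext x
  rcases h : ofLex x with y | y <;> obtain rfl : x = toLex _ := h <;> simp [joinModes]

theorem prod_joinModes (f : AddModes ι k → ℤˣ) (L : Finset ι) (K : Finset (Fin k)) :
    ∏ x ∈ joinModes L K, f x = (∏ i ∈ L, f (oldMode i)) * ∏ j ∈ K, f (newMode j) := by
  rw [joinModes, Finset.prod_map, Finset.prod_disjSum]
  rfl

theorem sliceFock_apply (K : Finset (Fin k)) (ψ L) :
    sliceFock ι k K ψ L = ψ (joinModes L K) := by
  exact (wcomp_apply _ _ _ _ ψ L).trans (one_mul _)

theorem adjoint_sliceFock_apply (K : Finset (Fin k)) (ψ) (L : Finset ι) (K' : Finset (Fin k)) :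
    ContinuousLinearMap.adjoint (sliceFock ι k K) ψ (joinModes L K')
      = if K' = K then ψ L else 0 := by
  have hS : ∀ (L : Finset ι) (K : Finset (Fin k)),
      ((joinModes L K).map ofLex.toEmbedding).toLeft = L := fun L K => by ext; simp [joinModes]
  have hS' : ∀ (L : Finset ι) (K : Finset (Fin k)),
      ((joinModes L K).map ofLex.toEmbedding).toRight = K := fun L K => by ext; simp [joinModes]
  refine (adjoint_wcomp_apply _ _
    (fun S : Finset (AddModes ι k) => if (S.map ofLex.toEmbedding).toRight = K then 1 else 0)
    (fun S : Finset (AddModes ι k) => (S.map ofLex.toEmbedding).toLeft)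
    (by intro p; split_ifs <;> simp)
    (by
      intro p hp q hq h
      obtain ⟨L1, K1, rfl⟩ := joinModes_surj p
      obtain ⟨L2, K2, rfl⟩ := joinModes_surj q
      have hp' : K1 = K := by by_contra h'; simp [hS', h'] at hp
      have hq' : K2 = K := by by_contra h'; simp [hS', h'] at hq
      simp only [hS] at h
      rw [hp', hq', h]) ?_ ?_ ψ (joinModes L K')).trans ?_
  · intro x _
    exact ⟨hS x K, by rw [star_one]; exact if_pos (hS' x K)⟩
  · intro p hp
    obtain ⟨L1, K1, rfl⟩ := joinModes_surj p
    have hp' : K1 = K := by by_contra h'; simp [hS', h'] at hp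
    subst hp'
    simp only [hS, hS']
    exact ⟨rfl, by simp⟩
  · rw [hS, hS']; split_ifs <;> simp

theorem extendModes_apply (A : FOp ι) (ψ) (L : Finset ι) (K : Finset (Fin k)) :
    extendModes ι k A ψ (joinModes L K) = A (sliceFock ι k K ψ) L := by
  rw [extendModes, l2op_sum_apply, Finset.sum_eq_single K]
  · exact (adjoint_sliceFock_apply K _ L K).trans (if_pos rfl)
  · intro K' _ hK
    exact (adjoint_sliceFock_apply K' _ L K).trans (if_neg hK.symm)
  · simp

theorem sliceFock_extendModes (A : FOp ι) (K : Finset (Fin k)) (ψ) :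
    sliceFock ι k K (extendModes ι k A ψ) = A (sliceFock ι k K ψ) := by
  ext L
  rw [sliceFock_apply, extendModes_apply]

theorem addModes_op_ext {A B : FOp (AddModes ι k)}
    (h : ∀ ψ L K, A ψ (joinModes L K) = B ψ (joinModes L K)) : A = B :=
  l2op_ext fun ψ S => by
    obtain ⟨L, K, rfl⟩ := joinModes_surj S
    exact h ψ L K

/-- `extendModes` as a homomorphism. -/
def extendHom (ι : Type) [LinearOrder ι] (k : ℕ) : FOp ι →⋆ₐ[ℂ] FOp (AddModes ι k) where
  toFun := extendModes ι k
  map_one' := addModes_op_ext fun ψ L K => by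
    rw [extendModes_apply, l2op_one_apply, l2op_one_apply, sliceFock_apply]
  map_zero' := addModes_op_ext fun ψ L K => by
    rw [extendModes_apply]; rfl
  map_mul' A B := addModes_op_ext fun ψ L K => by
    rw [extendModes_apply, mul_apply_eq_comp, mul_apply_eq_comp, extendModes_apply,
      sliceFock_extendModes]
  map_add' A B := addModes_op_ext fun ψ L K => by
    rw [extendModes_apply, l2op_add_apply, l2op_add_apply, extendModes_apply, extendModes_apply]
  commutes' r := addModes_op_ext fun ψ L K => by
    rw [extendModes_apply, Algebra.algebraMap_eq_smul_one, Algebra.algebraMap_eq_smul_one,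
      l2op_smul_apply, l2op_smul_apply, l2op_one_apply, l2op_one_apply, sliceFock_apply]
  map_star' A := by
    simp only [extendModes, star_sum, ContinuousLinearMap.star_eq_adjoint,
      ContinuousLinearMap.adjoint_comp, ContinuousLinearMap.adjoint_adjoint]
    rfl

theorem extendHom_apply (A : FOp ι) : extendHom ι k A = extendModes ι k A := rfl

theorem extendModes_injective {A : FOp ι} (h : extendModes ι k A = 0) : A = 0 :=
  l2op_ext fun ψ L => by
    have h1 := extendModes_apply A (ContinuousLinearMap.adjoint (sliceFock ι k ∅) ψ) L ∅
    rw [h] at h1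
    have h2 : sliceFock ι k ∅ (ContinuousLinearMap.adjoint (sliceFock ι k ∅) ψ) = ψ := by
      ext L
      rw [sliceFock_apply, adjoint_sliceFock_apply, if_pos rfl]
    rw [h2] at h1
    exact h1.symm

theorem extendModes_annih (i : ι) : extendModes ι k (annih ι i) = annih _ (oldMode i) :=
  addModes_op_ext fun ψ L K => by
    have h1 : ∏ x ∈ joinModes L K, below (oldMode i) x = ∏ x ∈ L, below i x := by
      rw [prod_joinModes, Finset.prod_eq_one (s := K), mul_one]
      · refine Finset.prod_congr rfl fun x _ => ?_
        simp [below]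
      · intro j _
        simp [below]
    rw [extendModes_apply, annih_apply, annih_apply, sliceFock_apply, insert_oldMode, h1]
    simp only [oldMode_mem_joinModes]

/-- Additional modes come last in the order, so their strings contain all old modes. Passing such a
string through `A` is conjugation with the total parity of the old modes. -/
theorem annih_newMode_mul (A : FOp ι) (j : Fin k) :
    annih _ (newMode j) * extendModes ι k A
      = extendModes ι k (signConj (fun _ => -1) A) * annih _ (newMode j) :=
  addModes_op_ext fun ψ L K => by
    have h1 : ∀ L : Finset ι, ∏ x ∈ joinModes L K, below (newMode j) x
        = (∏ x ∈ L, (-1)) * ∏ x ∈ K, below j x := fun L => by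
      rw [prod_joinModes]
      congr 1
      refine Finset.prod_congr rfl fun x _ => ?_
      simp [below]
    have h2 : j ∉ K → signOp (fun _ : ι => (-1 : ℤˣ))
        (sliceFock ι k K (annih (AddModes ι k) (newMode j) ψ))
        = signC (∏ x ∈ K, below j x) • sliceFock ι k (insert j K) ψ := fun hj => by
      ext L
      rw [signOp_apply, sliceFock_apply, annih_apply, if_neg (mt newMode_mem_joinModes.1 hj), h1,
        signC_mul, ← mul_assoc, ← mul_assoc, signC_mul_self, one_mul]
      change _ = _ * sliceFock ι k (insert j K) ψ L
      rw [sliceFock_apply, insert_newMode]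
    rw [mul_apply_eq_comp, mul_apply_eq_comp, annih_apply,
      extendModes_apply, signConj_apply, mul_apply_eq_comp, mul_apply_eq_comp, signOp_apply,
      insert_newMode, extendModes_apply, h1]
    simp only [newMode_mem_joinModes]
    split_ifs with hj
    · have h3 : sliceFock ι k K (annih (AddModes ι k) (newMode j) ψ) = 0 := by
        ext L
        rw [sliceFock_apply, annih_apply, if_pos (newMode_mem_joinModes.2 hj)]; rfl
      rw [h3, map_zero, map_zero]
      exact (mul_zero _).symm
    · rw [h2 hj, map_smul, signC_mul, mul_assoc]
      rfl

theorem extendModes_mem (k : ℕ) {M : Set ι} {A : FOp ι} (hA : A ∈ carLocal ι M) :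
    extendModes ι k A ∈ carLocal (AddModes ι k) (oldMode '' M) := by
  refine map_mem_of_mem_adjoin (extendHom ι k) ?_ hA
  rintro _ ⟨i, hi, rfl⟩
  rw [extendHom_apply, extendModes_annih]
  exact annih_mem_carLocal ⟨i, hi, rfl⟩

end AddModes

end

noncomputable section

/-! ## Local operators of a lattice of finite-dimensional systems -/

section QLocal

variable {d : ℕ} {N : Fin d → ℕ} {D : ℕ} [NeZero D]

open Classical in
theorem qUnit_apply (n : Site N) (a b : Fin D) (ψ f) :
    qUnit N D n a b ψ f = if f n = a then ψ (f.update n b) else 0 := by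
  refine (wcomp_apply _ _ _ _ ψ f).trans ?_
  split_ifs <;> simp

theorem qUnit_mul (n : Site N) (a b c e : Fin D) :
    qUnit N D n a b * qUnit N D n c e = if b = c then qUnit N D n a e else 0 :=
  l2op_ext fun ψ f => by
    classical
    rw [mul_apply_eq_comp, qUnit_apply, qUnit_apply]
    have h1 : (f.update n b) n = b := by simp [Finsupp.coe_update]
    have h2 : (f.update n b).update n e = f.update n e := by
      ext x; simp [Finsupp.coe_update]
    rw [h1, h2]
    by_cases hbc : b = c
    · simp only [hbc, if_true, qUnit_apply]
    · simp only [hbc, if_false, ite_self]; rfl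

theorem qUnit_mul_same (n : Site N) (a b e : Fin D) :
    qUnit N D n a b * qUnit N D n b e = qUnit N D n a e := by rw [qUnit_mul, if_pos rfl]

theorem sum_qUnit (n : Site N) : ∑ a, qUnit N D n a a = 1 :=
  l2op_ext fun ψ f => by
    classical
    rw [l2op_sum_apply, l2op_one_apply]
    simp only [qUnit_apply]
    rw [Finset.sum_ite_eq, if_pos (Finset.mem_univ _), Finsupp.update_self]

theorem qUnit_commute {n m : Site N} (h : n ≠ m) (a b c e : Fin D) :
    Commute (qUnit N D n a b) (qUnit N D m c e) :=
  l2op_ext fun ψ f => by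
    classical
    rw [mul_apply_eq_comp, mul_apply_eq_comp]
    simp only [qUnit_apply]
    have h1 : (f.update n b) m = f m := by
      simp [Finsupp.coe_update, Function.update_of_ne h.symm]
    have h2 : (f.update m e) n = f n := by
      simp [Finsupp.coe_update, Function.update_of_ne h]
    have h3 : (f.update n b).update m e = (f.update m e).update n b := by
      ext1 x; simp only [Finsupp.coe_update]; rw [Function.update_comm h]
    rw [h1, h2, h3]
    split_ifs <;> rfl

theorem star_qUnit (n : Site N) (a b : Fin D) : star (qUnit N D n a b) = qUnit N D n b a := by
  classical
  have key : ∀ (a b : Fin D) (f : Site N →₀ Fin D),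
      (if f n = a then (1 : ℂ) else 0) ≠ 0 → (f.update n b).update n a = f ∧
        (if (f.update n b) n = b then (1 : ℂ) else 0) = star (if f n = a then (1 : ℂ) else 0) := by
    intro a b f hf
    have hf' : f n = a := by by_contra h'; simp [h'] at hf
    refine ⟨?_, by simp [hf', Finsupp.coe_update]⟩
    ext1 x
    rw [← hf']
    simp
  have hk : ∀ a b f, (fun f : Site N →₀ Fin D => if f n = a then (1 : ℂ) else 0) f ≠ 0 →
      (f.update n b).update n a = f ∧
        (if (f.update n b) n = b then (1 : ℂ) else 0) = star (if f n = a then (1 : ℂ) else 0) :=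
    key
  unfold qUnit
  refine star_wcomp _ _ _ _ ?_ ?_
  · intro f hf
    obtain ⟨h1, h2⟩ := hk a b f (by convert hf)
    exact ⟨h1, by convert h2⟩
  · intro f hf
    obtain ⟨h1, h2⟩ := hk b a f (by convert hf)
    exact ⟨h1, by convert h2⟩

theorem qUnit_mem {V : Set (Site N)} {n : Site N} (h : n ∈ V) (a b : Fin D) :
    qUnit N D n a b ∈ qLocal N D V :=
  StarAlgebra.subset_adjoin ℂ _ ⟨n, h, a, b, rfl⟩

theorem qLocal_mono {V W : Set (Site N)} (h : V ⊆ W) : qLocal N D V ≤ qLocal N D W :=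
  StarAlgebra.adjoin_mono fun _ ⟨n, hn, e⟩ => ⟨n, h hn, e⟩

theorem qLocal_commute {V W : Set (Site N)} (hd : Disjoint V W) {A B : QOp N D}
    (hA : A ∈ qLocal N D V) (hB : B ∈ qLocal N D W) : Commute A B := by
  have h1 : ∀ n ∈ V, ∀ a b, Commute B (qUnit N D n a b) := by
    intro n hn a b
    refine Commute.symm (commute_of_mem_adjoin ?_ hB)
    rintro _ ⟨m, hm, c, e, rfl⟩
    have hnm : n ≠ m := fun h => Set.disjoint_left.1 hd hn (h ▸ hm)
    rw [star_qUnit]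
    exact ⟨qUnit_commute hnm _ _ _ _, qUnit_commute hnm _ _ _ _⟩
  refine Commute.symm (commute_of_mem_adjoin ?_ hA)
  rintro _ ⟨n, hn, a, b, rfl⟩
  rw [star_qUnit]
  exact ⟨h1 n hn _ _, h1 n hn _ _⟩

/-- The observable of the sign `par` of the state at site `n`. -/
def qPar (par : Fin D → ℤˣ) (n : Site N) : QOp N D := ∑ a, signC (par a) • qUnit N D n a a

/-- The operators on `V` that preserve the sign `par` of the state at each site. -/
def qEven (N : Fin d → ℕ) {D : ℕ} [NeZero D] (par : Fin D → ℤˣ) (V : Set (Site N)) :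
    StarSubalgebra ℂ (QOp N D) :=
  StarAlgebra.adjoin ℂ {A | ∃ n ∈ V, ∃ a b : Fin D, par a = par b ∧ A = qUnit N D n a b}

variable {par : Fin D → ℤˣ}

theorem qEven_mono {V W : Set (Site N)} (h : V ⊆ W) : qEven N par V ≤ qEven N par W :=
  StarAlgebra.adjoin_mono fun _ ⟨n, hn, e⟩ => ⟨n, h hn, e⟩

theorem qEven_le_qLocal (V : Set (Site N)) : qEven N par V ≤ qLocal N D V :=
  StarAlgebra.adjoin_mono fun _ ⟨n, hn, a, b, _, e⟩ => ⟨n, hn, a, b, e⟩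

theorem qUnit_mem_qEven {V : Set (Site N)} {n : Site N} (h : n ∈ V) {a b : Fin D}
    (hab : par a = par b) : qUnit N D n a b ∈ qEven N par V :=
  StarAlgebra.subset_adjoin ℂ _ ⟨n, h, a, b, hab, rfl⟩

theorem qUnit_mul_qPar (n : Site N) (a b : Fin D) :
    qUnit N D n a b * qPar par n = signC (par b) • qUnit N D n a b := by
  simp only [qPar, Finset.mul_sum, mul_smul_comm, qUnit_mul, smul_ite, smul_zero]
  rw [Finset.sum_ite_eq, if_pos (Finset.mem_univ _)]

theorem qPar_mul_qUnit (n : Site N) (a b : Fin D) :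
    qPar par n * qUnit N D n a b = signC (par a) • qUnit N D n a b := by
  simp only [qPar, Finset.sum_mul, smul_mul_assoc, qUnit_mul, smul_ite, smul_zero]
  rw [Finset.sum_eq_single a]
  · rw [if_pos rfl]
  · intro c _ hc; rw [if_neg hc]
  · simp

theorem qPar_commute {n m : Site N} (h : n ≠ m) (a b : Fin D) :
    Commute (qPar par n) (qUnit N D m a b) :=
  Commute.sum_left _ _ _ fun _ _ => (qUnit_commute h _ _ _ _).smul_left _

/-- An operator that commutes with all local operators is a multiple of the identity. -/
theorem eq_smul_one_of_commute {A : QOp N D}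
    (h : ∀ (n : Site N) (a b : Fin D), Commute (qUnit N D n a b) A) : ∃ c : ℂ, A = c • 1 := by
  classical
  let δ : (Site N →₀ Fin D) → ℓ²(Site N →₀ Fin D, ℂ) := fun g => lp.single 2 g (1 : ℂ)
  have hδ : ∀ g f, δ g f = if f = g then 1 else 0 := fun g f => by
    simp only [δ, lp.single_apply, Pi.single_apply]
  have hu : ∀ (g : Site N →₀ Fin D) (n : Site N) (b : Fin D),
      qUnit N D n (g n) b (δ (g.update n b)) = δ g := fun g n b => by
    ext f
    rw [qUnit_apply, hδ, hδ]
    by_cases hf : f n = g n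
    · rw [if_pos hf]
      congr 1
      refine propext ⟨fun e => ?_, fun e => e ▸ rfl⟩
      ext1 x
      by_cases hx : x = n
      · rw [hx, hf]
      · have := DFunLike.congr_fun e x
        simpa [Finsupp.coe_update, Function.update_of_ne hx] using this
    · rw [if_neg hf, if_neg fun e : f = g => hf (e ▸ rfl)]
  have hA : ∀ (n : Site N) (a b : Fin D) (ψ), A (qUnit N D n a b ψ) = qUnit N D n a b (A ψ) :=
    fun n a b ψ => (DFunLike.congr_fun (h n a b) ψ).symm
  -- At a site `n` where `f` and `g` differ, the projection onto the state `g n` fixes `δ g` and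
  -- kills the component at `f`.
  have hoff : ∀ g f, f ≠ g → A (δ g) f = 0 := fun g f hfg => by
    obtain ⟨n, hn⟩ := DFunLike.ne_iff.1 hfg
    have e := hu g n (g n)
    rw [Finsupp.update_self] at e
    rw [← e, hA, qUnit_apply, if_neg hn]
  have hup : ∀ (g : Site N →₀ Fin D) (n : Site N) (b : Fin D),
      A (δ g) g = A (δ (g.update n b)) (g.update n b) := fun g n b => by
    nth_rw 1 [← hu g n b]
    rw [hA, qUnit_apply, if_pos rfl]
  -- Every configuration arises from 0 by finitely many one-site updates, and none of them changes
  -- the diagonal entry.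
  have hdiag : ∀ g, A (δ g) g = A (δ 0) 0 := fun g => by
    induction g using Finsupp.induction with
    | zero => rfl
    | single_add n b f hn hb ih =>
      have h1 : f.update n b = Finsupp.single n b + f := by
        rw [Finsupp.update_eq_erase_add_single, Finsupp.erase_of_notMem_support hn, add_comm]
      rw [← h1, ← hup, ih]
  refine ⟨A (δ 0) 0, l2op_ext fun ψ f => ?_⟩
  -- The matrix entries determine `A`, since `ψ` is the norm limit of its expansion in basis vectors
  -- and `A` is continuous.
  have hs := (lp.hasSum_single (p := 2) (by simp) ψ).mapL A
  have hs2 : HasSum (fun g => A (lp.single 2 g (ψ g)) f) (A ψ f) := by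
    have := hs.mapL (lp.evalCLM ℂ (fun _ : Site N →₀ Fin D => ℂ) 2 f)
    exact this
  have h3 : ∀ g, A (lp.single 2 g (ψ g)) f = if g = f then A (δ 0) 0 * ψ f else 0 := fun g => by
    have : lp.single 2 g (ψ g) = ψ g • δ g := by
      rw [← lp.single_smul, smul_eq_mul, mul_one]
    rw [this, map_smul]
    change ψ g * A (δ g) f = _
    split_ifs with hg
    · rw [hg, hdiag, mul_comm]
    · rw [hoff g f (Ne.symm hg), mul_zero]
  simp_rw [h3] at hs2
  rw [l2op_smul_apply, l2op_one_apply]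
  exact hs2.unique (hasSum_ite_eq f _)

/-- An operator that commutes with the one-site operators outside of a finite set and with the
signs of the states in that set is a sum of products of sign-preserving one-site operators. -/
theorem mem_qEven_of_commute (V : Finset (Site N)) {A : QOp N D}
    (h : ∀ n ∉ V, ∀ a b : Fin D, Commute (qUnit N D n a b) A)
    (h' : ∀ n ∈ V, Commute (qPar par n) A) : A ∈ qEven N par V := by
  classical
  induction V using Finset.induction generalizing A with
  | empty =>
    obtain ⟨c, rfl⟩ := eq_smul_one_of_commute fun n a b => h n (Finset.notMem_empty n) a b
    exact (qEven N par _).smul_mem (one_mem _) c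
  | insert n V hn ih =>
    -- The coefficients of `A` in the matrix units at `n`: the block of `A` between the states `a`
    -- and `b`, repeated on the diagonal over `c` so that it commutes with all operators of the site
    -- `n`.
    let Aab : Fin D → Fin D → QOp N D := fun a b =>
      ∑ c, qUnit N D n c a * A * qUnit N D n b c
    have hsum : A = ∑ a, ∑ b, Aab a b * qUnit N D n a b := by
      have e1 : ∀ a b, Aab a b * qUnit N D n a b
          = qUnit N D n a a * A * qUnit N D n b b := fun a b => by
        simp only [Aab, Finset.sum_mul, mul_assoc, qUnit_mul, mul_ite, mul_zero]
        rw [Finset.sum_ite_eq' , if_pos (Finset.mem_univ _)]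
      simp_rw [e1, ← Finset.mul_sum, sum_qUnit, mul_one, ← Finset.sum_mul, sum_qUnit, one_mul]
    -- Moving the site sign through `A` gives the block both factors `par a` and `par b`, which are
    -- opposite here.
    have hzero : ∀ a b, par a ≠ par b → Aab a b = 0 := fun a b hab => by
      refine Finset.sum_eq_zero fun c _ => ?_
      have e1 : signC (par a) • (qUnit N D n c a * A * qUnit N D n b c)
          = signC (par b) • (qUnit N D n c a * A * qUnit N D n b c) := by
        rw [← smul_mul_assoc, ← smul_mul_assoc, ← qUnit_mul_qPar, mul_assoc (qUnit N D n c a),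
          (h' n (Finset.mem_insert_self n V)).eq, mul_assoc, mul_assoc, qPar_mul_qUnit,
          mul_smul_comm, mul_smul_comm, mul_assoc]
      have e2 : par b = -par a := by
        rcases Int.units_eq_one_or (par a) with h1 | h1 <;>
          rcases Int.units_eq_one_or (par b) with h2 | h2 <;> simp_all
      rw [e2, signC_neg, neg_smul, eq_neg_iff_add_eq_zero, ← two_smul ℂ, smul_smul] at e1
      exact (smul_eq_zero_iff_right (mul_ne_zero two_ne_zero (signC_ne_zero _))).1 e1
    rw [hsum]
    refine sum_mem fun a _ => sum_mem fun b _ => ?_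
    by_cases hab : par a = par b
    swap
    · rw [hzero a b hab, zero_mul]; exact zero_mem _
    refine mul_mem (qEven_mono (by simp) (ih (A := Aab a b) ?_ ?_))
      (qUnit_mem_qEven (by simp) hab)
    · intro m hm x y
      by_cases hmn : m = n
      · subst hmn
        have e1 : qUnit N D m x y * Aab a b = qUnit N D m x a * A * qUnit N D m b y := by
          simp only [Aab, Finset.mul_sum, ← mul_assoc, qUnit_mul, ite_mul, zero_mul]
          rw [Finset.sum_ite_eq, if_pos (Finset.mem_univ _)]
        have e2 : Aab a b * qUnit N D m x y = qUnit N D m x a * A * qUnit N D m b y := by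
          simp only [Aab, Finset.sum_mul, mul_assoc, qUnit_mul, mul_ite, mul_zero]
          rw [Finset.sum_ite_eq', if_pos (Finset.mem_univ _)]
        exact e1.trans e2.symm
      · refine Commute.sum_right _ _ _ fun c _ => ?_
        exact ((qUnit_commute hmn _ _ _ _).mul_right (h m (by simp [hmn, hm]) x y)).mul_right
          (qUnit_commute hmn _ _ _ _)
    · intro m hm
      have hmn : m ≠ n := fun e => hn (e ▸ hm)
      refine Commute.sum_right _ _ _ fun c _ => ?_
      exact ((qPar_commute hmn _ _).mul_right (h' m (by simp [hm]))).mul_right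
        (qPar_commute hmn _ _)

theorem qTrans_apply (v : Site N) (ψ) (f : Site N →₀ Fin D) :
    qTrans N D v ψ f = ψ (f.equivMapDomain (Equiv.addRight (-v))) :=
  (wcomp_apply _ _ _ _ ψ f).trans (one_mul _)

theorem equivMapDomain_addRight (v : Site N) (f : Site N →₀ Fin D) :
    (f.equivMapDomain (Equiv.addRight v)).equivMapDomain (Equiv.addRight (-v)) = f := by
  ext1 x; simp

theorem star_qTrans (v : Site N) : star (qTrans N D v) = qTrans N D (-v) := by
  unfold qTrans
  refine star_wcomp _ _ _ _ ?_ ?_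
  · intro f _
    exact ⟨by rw [← equivMapDomain_addRight (-v) f]; simp [equivMapDomain_addRight], by simp⟩
  · intro f _
    refine ⟨?_, by simp⟩
    rw [neg_neg, equivMapDomain_addRight]

theorem qTrans_mul_star (v : Site N) : qTrans N D v * star (qTrans N D v) = 1 :=
  l2op_ext fun ψ f => by
    rw [star_qTrans, mul_apply_eq_comp, qTrans_apply, qTrans_apply, l2op_one_apply,
      equivMapDomain_addRight]

theorem star_mul_qTrans (v : Site N) : star (qTrans N D v) * qTrans N D v = 1 := by
  have := qTrans_mul_star (N := N) (D := D) (-v)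
  rwa [star_qTrans, neg_neg, ← star_qTrans] at this

/-- Translation of the operators by `v`. -/
def qShift (N : Fin d → ℕ) (D : ℕ) [NeZero D] (v : Site N) : QOp N D ≃⋆ₐ[ℂ] QOp N D :=
  conjHom (qTrans N D v) (qTrans_mul_star v) (star_mul_qTrans v)

theorem qShift_apply (v : Site N) (A : QOp N D) :
    qShift N D v A = qTrans N D v * A * star (qTrans N D v) := rfl

theorem qShift_qUnit (v n : Site N) (a b : Fin D) :
    qShift N D v (qUnit N D n a b) = qUnit N D (n + v) a b := by
  have : qTrans N D v * qUnit N D n a b = qUnit N D (n + v) a b * qTrans N D v :=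
    l2op_ext fun ψ f => by
      classical
      rw [mul_apply_eq_comp, mul_apply_eq_comp, qTrans_apply, qUnit_apply, qUnit_apply,
        qTrans_apply]
      have h1 : (f.equivMapDomain (Equiv.addRight (-v))) n = f (n + v) := by simp
      have h2 : (f.equivMapDomain (Equiv.addRight (-v))).update n b
          = (f.update (n + v) b).equivMapDomain (Equiv.addRight (-v)) := by
        ext1 x
        simp only [Finsupp.coe_update, Finsupp.equivMapDomain_apply, Equiv.addRight_symm, neg_neg,
          Equiv.coe_addRight, Function.update_apply, add_left_inj]
      rw [h1, h2]
  rw [qShift_apply, this, mul_assoc, qTrans_mul_star, mul_one]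

end QLocal

end

noncomputable section

/-! ## Fermionic modes at a site as a `2 ^ M`-dimensional system -/

section Modes

variable {d : ℕ} {N : Fin d → ℕ} {M : ℕ}

/-- The site of a mode. -/
def siteOf (x : Mode N M) : Site N := (ofLex x).1

theorem siteOf_mode (n : Site N) (i : Fin M) : siteOf (mode n i) = n := rfl

theorem exists_mode (x : Mode N M) : ∃ i, x = mode (siteOf x) i := ⟨(ofLex x).2, rfl⟩

theorem mode_inj {n p : Site N} {i j : Fin M} : mode n i = mode p j ↔ n = p ∧ i = j := by
  simp [mode]

theorem mem_modesOn {V : Set (Site N)} {x : Mode N M} : x ∈ modesOn N M V ↔ siteOf x ∈ V := Iff.rfl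

theorem mode_lt_of_ne {n p : Site N} (h : n ≠ p) (i j : Fin M) : mode n i < mode p j ↔ n < p := by
  rw [Prod.Lex.lt_iff]
  simp [h]

theorem mode_lt_same {n : Site N} (i j : Fin M) : mode n i < mode n j ↔ i < j := by
  rw [Prod.Lex.lt_iff]
  simp

/-- The occupied modes at a site. -/
def sliceAt (n : Site N) (S : Finset (Mode N M)) : Finset (Fin M) :=
  Finset.univ.filter fun i => mode n i ∈ S

theorem mem_sliceAt {n : Site N} {S : Finset (Mode N M)} {i : Fin M} :
    i ∈ sliceAt n S ↔ mode n i ∈ S := by simp [sliceAt]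

/-- A numbering of the sets of modes at a site that starts with the empty set. -/
def modeCode (M : ℕ) : Finset (Fin M) ≃ Fin (2 ^ M) :=
  let e : Finset (Fin M) ≃ Fin (2 ^ M) := Fintype.equivFinOfCardEq (by simp)
  e.trans (Equiv.swap (e ∅) 0)

theorem modeCode_empty (M : ℕ) : modeCode M ∅ = 0 := by simp [modeCode]

theorem modeCode_symm_zero (M : ℕ) : (modeCode M).symm 0 = ∅ := by
  rw [Equiv.symm_apply_eq, modeCode_empty]

/-- Occupied modes as a configuration of `2 ^ M`-dimensional systems. -/
def modeConf (N : Fin d → ℕ) (M : ℕ) : Finset (Mode N M) ≃ (Site N →₀ Fin (2 ^ M)) where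
  toFun S := Finsupp.onFinset (S.image siteOf) (fun n => modeCode M (sliceAt n S)) (by
    intro n hn
    rw [← modeCode_empty, Ne, (modeCode M).apply_eq_iff_eq] at hn
    obtain ⟨i, hi⟩ := Finset.nonempty_iff_ne_empty.2 hn
    exact Finset.mem_image.2 ⟨_, mem_sliceAt.1 hi, rfl⟩)
  invFun f := ((f.support ×ˢ Finset.univ).filter fun p => p.2 ∈ (modeCode M).symm (f p.1)).map
    toLex.toEmbedding
  left_inv S := by
    ext x
    obtain ⟨i, hi⟩ := exists_mode x
    generalize siteOf x = n at hi
    subst hi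
    simp only [Finset.mem_map_equiv, Finset.mem_filter, Finset.mem_product, Finsupp.mem_support_iff,
      Finsupp.onFinset_apply, Finset.mem_univ, and_true, Equiv.symm_apply_apply]
    rw [mem_sliceAt, and_iff_right_of_imp]
    intro h
    rw [← modeCode_empty, Ne, (modeCode M).apply_eq_iff_eq]
    exact Finset.ne_empty_of_mem (mem_sliceAt.2 h)
  right_inv f := by
    ext1 n
    rw [Finsupp.onFinset_apply, ← Equiv.eq_symm_apply]
    ext i
    rw [mem_sliceAt]
    simp only [Finset.mem_map_equiv, Finset.mem_filter, Finset.mem_product, Finsupp.mem_support_iff,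
      Finset.mem_univ, and_true]
    change (f n ≠ 0 ∧ i ∈ (modeCode M).symm (f n)) ↔ _
    rw [and_iff_right_of_imp]
    intro h h0
    rw [h0, modeCode_symm_zero] at h
    simp at h

theorem modeConf_apply (S : Finset (Mode N M)) (n : Site N) :
    modeConf N M S n = modeCode M (sliceAt n S) := rfl

theorem mem_modeConf_symm {f : Site N →₀ Fin (2 ^ M)} {n : Site N} {i : Fin M} :
    mode n i ∈ (modeConf N M).symm f ↔ i ∈ (modeCode M).symm (f n) := by
  rw [← mem_sliceAt, ← (modeCode M).symm_apply_apply (sliceAt n _), ← modeConf_apply,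
    Equiv.apply_symm_apply]

/-- Replace the occupied modes at the site `n` by `B`. -/
def setSlice (n : Site N) (B : Finset (Fin M)) (S : Finset (Mode N M)) : Finset (Mode N M) :=
  (modeConf N M).symm ((modeConf N M S).update n (modeCode M B))

theorem mem_setSlice_same {n : Site N} {B : Finset (Fin M)} {S : Finset (Mode N M)} {i : Fin M} :
    mode n i ∈ setSlice n B S ↔ i ∈ B := by
  rw [setSlice, mem_modeConf_symm]; simp

theorem mem_setSlice_of_ne {n p : Site N} {B : Finset (Fin M)} {S : Finset (Mode N M)} {i : Fin M}
    (h : p ≠ n) : mode p i ∈ setSlice n B S ↔ mode p i ∈ S := by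
  rw [setSlice, mem_modeConf_symm]
  simp only [Finsupp.coe_update, Function.update_of_ne h, modeConf_apply, Equiv.symm_apply_apply]
  exact mem_sliceAt

theorem sliceAt_setSlice (n : Site N) (B : Finset (Fin M)) (S : Finset (Mode N M)) :
    sliceAt n (setSlice n B S) = B := by
  ext i; rw [mem_sliceAt, mem_setSlice_same]

/-- Sets of modes that agree at each site agree. -/
theorem modes_ext {S T : Finset (Mode N M)} (h : ∀ n i, mode n i ∈ S ↔ mode n i ∈ T) : S = T := by
  ext x
  obtain ⟨i, hi⟩ := exists_mode x
  rw [hi]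
  exact h _ _

/-- Products over modes factorize into the modes at a site and the others. -/
theorem prod_modes {G : Type*} [CommMonoid G] (n : Site N) (S : Finset (Mode N M))
    (ε : Mode N M → G) : ∏ x ∈ S, ε x
      = (∏ i ∈ sliceAt n S, ε (mode n i)) * ∏ x ∈ S.filter (fun x => siteOf x ≠ n), ε x := by
  rw [← Finset.prod_filter_mul_prod_filter_not S (fun x => siteOf x = n)]
  congr 1
  symm
  refine Finset.prod_bij (fun i _ => mode n i) ?_ ?_ ?_ ?_
  · intro i hi
    exact Finset.mem_filter.2 ⟨mem_sliceAt.1 hi, rfl⟩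
  · intro i _ j _ h
    exact (mode_inj.1 h).2
  · intro x hx
    obtain ⟨h1, h2⟩ := Finset.mem_filter.1 hx
    obtain ⟨i, hi⟩ := exists_mode x
    rw [h2] at hi
    exact ⟨i, mem_sliceAt.2 (hi ▸ h1), hi.symm⟩
  · intro i _; rfl

theorem filter_setSlice (n : Site N) (B : Finset (Fin M)) (S : Finset (Mode N M)) :
    (setSlice n B S).filter (fun x => siteOf x ≠ n) = S.filter (fun x => siteOf x ≠ n) := by
  refine modes_ext fun p i => ?_
  rw [Finset.mem_filter, Finset.mem_filter]
  refine and_congr_left fun h => ?_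
  exact mem_setSlice_of_ne h

/-- Operators on the Fock space as operators of a lattice of `2 ^ M`-dimensional systems. -/
def toQ (N : Fin d → ℕ) (M : ℕ) : FOp (Mode N M) ≃⋆ₐ[ℂ] QOp N (2 ^ M) := relabelOp (modeConf N M)

/-- The operator `|A⟩⟨B|` at site `n`, without signs. -/
def siteUnit (n : Site N) (A B : Finset (Fin M)) : FOp (Mode N M) :=
  (toQ N M).symm (qUnit N (2 ^ M) n (modeCode M A) (modeCode M B))

theorem toQ_symm_qUnit (n : Site N) (a b : Fin (2 ^ M)) : (toQ N M).symm (qUnit N (2 ^ M) n a b)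
    = siteUnit n ((modeCode M).symm a) ((modeCode M).symm b) := by
  rw [siteUnit, Equiv.apply_symm_apply, Equiv.apply_symm_apply]

theorem siteUnit_apply (n : Site N) (A B : Finset (Fin M)) (ψ S) :
    siteUnit n A B ψ S = if sliceAt n S = A then ψ (setSlice n B S) else 0 := by
  rw [siteUnit, toQ, relabelOp_symm_apply, qUnit_apply, modeConf_apply, relabel_apply]
  simp only [(modeCode M).apply_eq_iff_eq]
  congr

theorem star_siteUnit (n : Site N) (A B : Finset (Fin M)) :
    star (siteUnit n A B) = siteUnit n B A := by
  rw [siteUnit, ← map_star, star_qUnit]; rfl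

theorem siteUnit_mul (n : Site N) (A B C : Finset (Fin M)) :
    siteUnit n A B * siteUnit n B C = siteUnit n A C := by
  rw [siteUnit, siteUnit, ← map_mul, qUnit_mul_same]; rfl

/-- The parity of a number of modes. -/
def parity (A : Finset (Fin M)) : ℤˣ := ∏ _i ∈ A, -1

/-- The parity of a state of a site. -/
def codeParity (M : ℕ) (a : Fin (2 ^ M)) : ℤˣ := parity ((modeCode M).symm a)

/-- The string of the mode at `p` crosses the site `n` only if `n < p`, and then it sees the parity
of `A` on one side and that of `B` on the other. -/
theorem siteUnit_mul_annih {n p : Site N} (h : p ≠ n) (i : Fin M) (A B : Finset (Fin M)) :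
    annih _ (mode p i) * siteUnit n A B
      = signC (if n < p then parity A * parity B else 1)
        • (siteUnit n A B * annih _ (mode p i)) :=
  l2op_ext fun ψ S => by
    rw [l2op_smul_apply, mul_apply_eq_comp, mul_apply_eq_comp, annih_apply, siteUnit_apply,
      siteUnit_apply, annih_apply]
    have e1 : sliceAt n (insert (mode p i) S) = sliceAt n S := by
      ext j; rw [mem_sliceAt, mem_sliceAt, Finset.mem_insert, mode_inj]
      simp [Ne.symm h]
    have e2 : setSlice n B (insert (mode p i) S) = insert (mode p i) (setSlice n B S) := by
      refine modes_ext fun q j => ?_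
      by_cases hq : q = n
      · subst hq
        rw [mem_setSlice_same, Finset.mem_insert, mem_setSlice_same, mode_inj]
        simp [Ne.symm h]
      · rw [mem_setSlice_of_ne hq, Finset.mem_insert, Finset.mem_insert, mem_setSlice_of_ne hq]
    rw [e1, e2]
    simp only [mem_setSlice_of_ne h]
    by_cases hS : sliceAt n S = A
    swap
    · simp [hS]
    subst hS
    by_cases hi : mode p i ∈ S
    · simp [hi]
    rw [if_neg hi, if_neg hi, if_pos rfl, if_pos rfl, ← mul_assoc, ← signC_mul]
    congr 2
    rw [prod_modes n S, prod_modes n (setSlice n B S), filter_setSlice, sliceAt_setSlice]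
    have e3 : ∀ A : Finset (Fin M), ∏ j ∈ A, below (mode p i) (mode n j)
        = if n < p then parity A else 1 := fun A => by
      split_ifs with hnp
      · exact Finset.prod_congr rfl fun j _ => if_pos ((mode_lt_of_ne h.symm _ _).2 hnp)
      · exact Finset.prod_eq_one fun j _ => if_neg fun h' => hnp ((mode_lt_of_ne h.symm _ _).1 h')
    rw [e3, e3]
    split_ifs with hnp
    · rw [← mul_assoc, mul_assoc (parity (sliceAt n S)), Int.units_mul_self, mul_one]
    · simp

/-- Sign-even operators of the modes on `V` commute with operators at other sites. -/
theorem siteUnit_commute {V : Set (Site N)} {X : FOp (Mode N M)}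
    (hX : X ∈ carLocal _ (modesOn N M V))
    (hinv : ∀ g : Site N → ℤˣ, signConj (fun x => g (siteOf x)) X = X) {n : Site N} (hn : n ∉ V)
    (A B : Finset (Fin M)) : Commute (siteUnit n A B) X := by
  -- These are the signs with which `siteUnit n A B` passes annihilation operators at other sites.
  -- They depend only on the site, so `hinv` makes them invisible on `X`.
  let g : Site N → ℤˣ := fun p => if n < p then parity A * parity B else 1
  have h := intertwine_of_mem_adjoin
    ((signConj (fun x => g (siteOf x)) : FOp (Mode N M) ≃⋆ₐ[ℂ] FOp (Mode N M)) :
      FOp (Mode N M) →⋆ₐ[ℂ] FOp (Mode N M)) (StarAlgHom.id ℂ _) (siteUnit n A B) ?_ hX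
  · have h2 : siteUnit n A B * signConj (fun x => g (siteOf x)) X = X * siteUnit n A B := h
    rwa [hinv] at h2
  · rintro _ ⟨x, hx, rfl⟩
    obtain ⟨i, hi⟩ := exists_mode x
    have hp : siteOf x ≠ n := fun h => hn (h ▸ hx)
    generalize siteOf x = p at hi hp
    subst hi
    change siteUnit n A B * signConj _ (annih _ (mode p i)) = annih _ (mode p i) * _ ∧
      siteUnit n A B * signConj _ (star (annih _ (mode p i))) = star (annih _ (mode p i)) * _
    rw [map_star, signConj_annih, siteUnit_mul_annih hp, star_smul, star_signC, mul_smul_comm,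
      mul_smul_comm]
    refine ⟨rfl, ?_⟩
    have h3 := congrArg star (siteUnit_mul_annih hp i B A)
    rw [star_mul, star_smul, star_signC, star_mul, star_siteUnit] at h3
    rw [h3, smul_smul, mul_comm (parity B)]
    change (signC (g p) * signC (g p)) • _ = _
    rw [signC_mul_self, one_smul]

theorem toQ_symm_qPar (n : Site N) : (toQ N M).symm (qPar (codeParity M) n)
    = signOp (fun x => if siteOf x = n then -1 else 1) :=
  l2op_ext fun ψ S => by
    classical
    rw [toQ, relabelOp_symm_apply, qPar, l2op_sum_apply, signOp_apply]
    simp_rw [l2op_smul_apply, qUnit_apply]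
    rw [Finset.sum_eq_single (modeConf N M S n)]
    · rw [if_pos rfl, Finsupp.update_self, relabel_apply, Equiv.symm_apply_apply]
      congr 2
      rw [prod_modes n, Finset.prod_eq_one (s := S.filter _), mul_one, codeParity, modeConf_apply,
        Equiv.symm_apply_apply, parity]
      · refine Finset.prod_congr rfl fun i _ => ?_
        rw [siteOf_mode, if_pos rfl]
      · intro x hx
        exact if_neg (Finset.mem_filter.1 hx).2
    · intro a _ ha
      rw [if_neg ha.symm, mul_zero]
    · simp

/-- Operators of the modes on a finite set of sites that preserve the parities of all sites. -/
theorem toQ_mem_qEven {V : Set (Site N)} (hV : V.Finite) {X : FOp (Mode N M)}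
    (hX : X ∈ carLocal _ (modesOn N M V))
    (hinv : ∀ g : Site N → ℤˣ, signConj (fun x => g (siteOf x)) X = X) :
    toQ N M X ∈ qEven N (codeParity M) V := by
  rw [← hV.coe_toFinset]
  refine mem_qEven_of_commute (hV.toFinset) ?_ ?_
  · intro n hn a b
    have h := siteUnit_commute hX hinv (n := n) (by simpa using hn)
      ((modeCode M).symm a) ((modeCode M).symm b)
    rw [← toQ_symm_qUnit] at h
    simpa using h.map (toQ N M)
  · intro n _
    have h : Commute (signOp _) X := (signConj_eq_self_iff _ _).1
      (hinv fun p => if p = n then -1 else 1)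
    rw [← toQ_symm_qPar] at h
    simpa using h.map (toQ N M)

/-! ### Parity-preserving operators at a site are even -/

/-- Flipping an occupation number needs no case distinction, which makes Majorana operators
convenient for moving between basis states of a site. -/
theorem majorana_apply {ι : Type} [LinearOrder ι] (i : ι) (ψ S) :
    (annih ι i + star (annih ι i)) ψ S
      = signC (∏ x ∈ S, below i x) * ψ (symmDiff S {i}) := by
  rw [l2op_add_apply, annih_apply, star_annih_apply]
  split_ifs with h
  · rw [zero_add, show symmDiff S {i} = S.erase i by ext x; simp [Finset.mem_symmDiff]; grind]
  · rw [add_zero, show symmDiff S {i} = insert i S by ext x; simp [Finset.mem_symmDiff]; grind]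

theorem majorana_mul_mem_carEven {ι : Type} [LinearOrder ι] {K : Set ι} {i j : ι} (hi : i ∈ K)
    (hj : j ∈ K) : (annih ι i + star (annih ι i)) * (annih ι j + star (annih ι j))
      ∈ carEven ι K := by
  have h1 : ∀ i ∈ K, ∀ j ∈ K, annih ι i * annih ι j ∈ carEven ι K := fun i hi j hj =>
    StarAlgebra.subset_adjoin ℂ _ ⟨i, hi, j, hj, Or.inl rfl⟩
  have h2 : annih ι i * star (annih ι j) ∈ carEven ι K :=
    StarAlgebra.subset_adjoin ℂ _ ⟨i, hi, j, hj, Or.inr (Or.inl rfl)⟩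
  have h3 : star (annih ι i) * annih ι j ∈ carEven ι K :=
    StarAlgebra.subset_adjoin ℂ _ ⟨i, hi, j, hj, Or.inr (Or.inr rfl)⟩
  have h4 : star (annih ι i) * star (annih ι j) ∈ carEven ι K := by
    rw [← star_mul]; exact star_mem (h1 j hj i hi)
  rw [add_mul, mul_add, mul_add]
  exact add_mem (add_mem (h1 i hi j hj) h2) (add_mem h3 h4)

/-- This projection is the product over the modes `i` of the site of the number operator, if `i` is
in `A`, or of one minus it. -/
theorem siteUnit_self_mem (n : Site N) (A : Finset (Fin M)) :
    siteUnit n A A ∈ carEven _ (modesOn N M {n}) := by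
  have hnum : ∀ i : Fin M, star (annih _ (mode n i)) * annih _ (mode n i)
      ∈ carEven _ (modesOn N M {n}) := fun i =>
    StarAlgebra.subset_adjoin ℂ _ ⟨_, rfl, _, rfl, Or.inr (Or.inr rfl)⟩
  have hnum_apply : ∀ (i : Fin M) ψ S, (star (annih _ (mode n i)) * annih _ (mode n i)) ψ S
      = if mode n i ∈ S then ψ S else 0 := fun i ψ S => by
    rw [mul_apply_eq_comp, star_annih_apply]
    split_ifs with h
    · rw [annih_apply, if_neg (Finset.notMem_erase _ _), prod_below_erase, ← mul_assoc,
        signC_mul_self, one_mul, Finset.insert_erase h]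
    · rfl
  have key : ∀ T : Finset (Fin M), ∃ P ∈ carEven _ (modesOn N M {n}),
      ∀ ψ S, P ψ S = if ∀ i ∈ T, mode n i ∈ S ↔ i ∈ A then ψ S else 0 := by
    intro T
    classical
    induction T using Finset.induction with
    | empty => exact ⟨1, one_mem _, fun ψ S => by simp⟩
    | insert i T hi ih =>
      obtain ⟨P, hP, hP'⟩ := ih
      by_cases hA : i ∈ A
      · refine ⟨_, mul_mem (hnum i) hP, fun ψ S => ?_⟩
        rw [mul_apply_eq_comp, hnum_apply, hP']
        simp only [Finset.forall_mem_insert, hA, iff_true]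
        by_cases h1 : mode n i ∈ S <;> simp [h1]
      · refine ⟨_, mul_mem (sub_mem (one_mem _) (hnum i)) hP, fun ψ S => ?_⟩
        rw [mul_apply_eq_comp, l2op_sub_apply, hnum_apply, l2op_one_apply, hP']
        simp only [Finset.forall_mem_insert, hA, iff_false]
        by_cases h1 : mode n i ∈ S <;> simp [h1]
  obtain ⟨P, hP, hP'⟩ := key Finset.univ
  convert hP using 1
  refine l2op_ext fun ψ S => ?_
  rw [hP', siteUnit_apply]
  have e : sliceAt n S = A ↔ ∀ i ∈ Finset.univ, mode n i ∈ S ↔ i ∈ A := by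
    rw [Finset.ext_iff]; simp [mem_sliceAt]
  simp only [← e]
  split_ifs with h
  · have : setSlice n A S = S := modes_ext fun p i => by
      by_cases hp : p = n
      · subst hp; rw [mem_setSlice_same, ← h, mem_sliceAt]
      · rw [mem_setSlice_of_ne hp]
    rw [this]
  · rfl

/-- Two Majorana operators flip the modes `i` and `j`. Both modes are at the same site, so their
strings through other sites cancel, and the remaining sign is constant on the states selected by the
projection. -/
theorem siteUnit_flip_mem (n : Site N) {i j : Fin M} (hij : i ≠ j) (A : Finset (Fin M)) :
    siteUnit n (symmDiff A {i, j}) A ∈ carEven _ (modesOn N M {n}) := by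
  -- The product of the two strings inside the site; the first factor accounts for the flip of `i`,
  -- which the string of `j` already sees.
  let c : ℤˣ := below (mode n j) (mode n i) * ∏ l ∈ symmDiff A {i, j},
    below (mode n i) (mode n l) * below (mode n j) (mode n l)
  have h : siteUnit n (symmDiff A {i, j}) A = signC c •
      ((annih _ (mode n i) + star (annih _ (mode n i)))
        * (annih _ (mode n j) + star (annih _ (mode n j))) * siteUnit n A A) := by
    refine l2op_ext fun ψ S => ?_
    rw [l2op_smul_apply, mul_apply_eq_comp, mul_apply_eq_comp, majorana_apply, majorana_apply,
      siteUnit_apply, siteUnit_apply]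
    have e1 : sliceAt n (symmDiff (symmDiff S {mode n i}) {mode n j}) = A
        ↔ sliceAt n S = symmDiff A {i, j} := by
      rw [Finset.ext_iff, Finset.ext_iff]
      refine forall_congr' fun l => ?_
      simp only [mem_sliceAt, Finset.mem_symmDiff, Finset.mem_singleton, Finset.mem_insert, mode_inj,
        true_and]
      grind
    have e2 : setSlice n A (symmDiff (symmDiff S {mode n i}) {mode n j}) = setSlice n A S := by
      refine modes_ext fun p l => ?_
      by_cases hp : p = n
      · subst hp; rw [mem_setSlice_same, mem_setSlice_same]
      · rw [mem_setSlice_of_ne hp, mem_setSlice_of_ne hp]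
        simp [Finset.mem_symmDiff, hp]
    rw [e2]
    simp only [e1]
    split_ifs with hS
    swap
    · simp
    have e3 : ∏ x ∈ symmDiff S {mode n i}, below (mode n j) x
        = below (mode n j) (mode n i) * ∏ x ∈ S, below (mode n j) x := by
      by_cases hi : mode n i ∈ S
      · rw [show symmDiff S {mode n i} = S.erase (mode n i) by
          ext x; simp [Finset.mem_symmDiff]; grind, ← Finset.mul_prod_erase S _ hi, ← mul_assoc,
          Int.units_mul_self, one_mul]
      · rw [show symmDiff S {mode n i} = insert (mode n i) S by
          ext x; simp [Finset.mem_symmDiff]; grind, Finset.prod_insert hi]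
    have e4 : (∏ x ∈ S, below (mode n i) x) * ∏ x ∈ S, below (mode n j) x
        = ∏ l ∈ symmDiff A {i, j}, below (mode n i) (mode n l) * below (mode n j) (mode n l) := by
      rw [← Finset.prod_mul_distrib, prod_modes n, hS,
        Finset.prod_eq_one (s := S.filter _), mul_one]
      intro x hx
      have hx' := (Finset.mem_filter.1 hx).2
      clear hx
      obtain ⟨l, hl⟩ := exists_mode x
      generalize siteOf x = p at hl hx'
      subst hl
      simp only [below, mode_lt_of_ne hx']
      split_ifs <;> simp
    have e5 : c = (∏ x ∈ S, below (mode n i) x) * ∏ x ∈ symmDiff S {mode n i}, below (mode n j) x := by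
      rw [e3, mul_left_comm, e4]
    have e6 : ∀ (p q : ℤˣ) (z : ℂ), z = signC (p * q) * (signC p * (signC q * z)) :=
      fun p q z => by
        rw [← mul_assoc (signC p), ← signC_mul, ← mul_assoc, signC_mul_self, one_mul]
    rw [e5]
    exact e6 _ _ _
  have h' := StarSubalgebra.smul_mem _ (mul_mem (majorana_mul_mem_carEven (i := mode n i)
    (j := mode n j) (K := modesOn N M {n}) rfl rfl) (siteUnit_self_mem n A)) (signC c)
  exact Set.mem_of_eq_of_mem h h'

theorem parity_symmDiff (A B : Finset (Fin M)) : parity (symmDiff A B) = parity A * parity B := by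
  have h : ∀ A : Finset (Fin M), parity A = ∏ i, if i ∈ A then -1 else 1 := fun A => by
    rw [parity]; simp
  rw [h, h, h, ← Finset.prod_mul_distrib]
  refine Finset.prod_congr rfl fun i _ => ?_
  by_cases h1 : i ∈ A <;> by_cases h2 : i ∈ B <;> simp [Finset.mem_symmDiff, h1, h2]

/-- Sets of equal parity differ in an even number of modes, so one is reached from the other by
flipping two modes at a time. -/
theorem siteUnit_mem_carEven (n : Site N) {A B : Finset (Fin M)} (h : parity A = parity B) :
    siteUnit n A B ∈ carEven _ (modesOn N M {n}) := by
  induction hk : (symmDiff A B).card using Nat.strong_induction_on generalizing A with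
  | _ k ih =>
    subst hk
    by_cases hAB : A = B
    · subst hAB; exact siteUnit_self_mem n A
    have hp : parity (symmDiff A B) = 1 := by rw [parity_symmDiff, h, Int.units_mul_self]
    have hne : (symmDiff A B).Nonempty := by
      rw [Finset.nonempty_iff_ne_empty, ← Finset.bot_eq_empty, Ne, symmDiff_eq_bot]; exact hAB
    have hcard : 1 < (symmDiff A B).card := by
      by_contra hle
      have h1 : (symmDiff A B).card = 1 := le_antisymm (not_lt.1 hle) hne.card_pos
      rw [parity, Finset.prod_const, h1] at hp
      exact absurd hp (by decide)
    obtain ⟨i, hi, j, hj, hij⟩ := Finset.one_lt_card.1 hcard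
    have hpair : parity ({i, j} : Finset (Fin M)) = 1 := by
      rw [parity, Finset.prod_pair hij]; decide
    have h1 : siteUnit n (symmDiff A {i, j}) B ∈ carEven _ (modesOn N M {n}) := by
      refine ih _ ?_ (by rw [parity_symmDiff, hpair, mul_one, h]) rfl
      refine Finset.card_lt_card ⟨?_, ?_⟩
      · intro l hl
        simp only [Finset.mem_symmDiff, Finset.mem_insert, Finset.mem_singleton] at *
        grind
      · intro hsub
        have := hsub hi
        simp only [Finset.mem_symmDiff, Finset.mem_insert, Finset.mem_singleton] at *
        grind
    have h2 := star_mem (siteUnit_flip_mem n hij A)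
    rw [star_siteUnit] at h2
    rw [← siteUnit_mul n A (symmDiff A {i, j}) B]
    exact mul_mem h2 h1

theorem toQ_symm_mem_carEven {V : Set (Site N)} {A : QOp N (2 ^ M)}
    (hA : A ∈ qEven N (codeParity M) V) :
    (toQ N M).symm A ∈ carEven _ (modesOn N M V) := by
  refine map_mem_of_mem_adjoin ((toQ N M).symm : QOp N (2 ^ M) →⋆ₐ[ℂ] FOp (Mode N M)) ?_ hA
  rintro _ ⟨n, hn, a, b, hab, rfl⟩
  change (toQ N M).symm _ ∈ _
  rw [toQ_symm_qUnit]
  refine carEven_mono ?_ (siteUnit_mem_carEven n hab)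
  intro x hx
  rw [mem_modesOn, Set.mem_singleton_iff] at hx
  rw [mem_modesOn, hx]
  exact hn

/-! ### Translations -/

theorem shiftModes_mode (v n : Site N) (i : Fin M) :
    shiftModes N M v (mode n i) = mode (n + v) i := rfl

theorem shiftModes_symm_mode (v n : Site N) (i : Fin M) :
    (shiftModes N M v).symm (mode n i) = mode (n - v) i := by
  rw [Equiv.symm_apply_eq, shiftModes_mode, sub_add_cancel]

/-- A translation keeps the order of modes within a site, and whether it reverses a pair of modes at
different sites depends only on these sites. So only the parity of the occupation at `n` enters. -/
theorem permSign_setSlice (v n : Site N) {S : Finset (Mode N M)} {B : Finset (Fin M)}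
    (h : parity (sliceAt n S) = parity B) :
    permSign (shiftModes N M v) (setSlice n B S) = permSign (shiftModes N M v) S := by
  rw [permSign_eq, permSign_eq]
  congr 1
  let σ := shiftModes N M v
  change ∏ i ∈ _, ∏ j ∈ _, invSign σ i j = ∏ i ∈ _, ∏ j ∈ _, invSign σ i j
  have e0 : ∀ i j : Fin M, invSign σ (mode n i) (mode n j) = 1 := fun i j => by
    refine if_neg fun h' => ?_
    have h2 : mode (n + v) j < mode (n + v) i := h'.2
    rw [mode_lt_same] at h2
    exact absurd ((mode_lt_same i j).1 h'.1) h2.not_gt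
  have e1 : ∀ x : Mode N M, siteOf x ≠ n → ∃ c, ∀ i, invSign σ (mode n i) x = c := fun x hx => by
    obtain ⟨l, hl⟩ := exists_mode x
    generalize siteOf x = p at hl hx
    subst hl
    have hx' : p + v ≠ n + v := fun e => hx (add_right_cancel e)
    refine ⟨if n < p ∧ p + v < n + v then -1 else 1, fun i => ?_⟩
    change (if mode n i < mode p l ∧ mode (p + v) l < mode (n + v) i then _ else _) = _
    simp only [mode_lt_of_ne hx', mode_lt_of_ne hx.symm]
  have e2 : ∀ x : Mode N M, siteOf x ≠ n → ∃ c, ∀ i, invSign σ x (mode n i) = c := fun x hx => by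
    obtain ⟨l, hl⟩ := exists_mode x
    generalize siteOf x = p at hl hx
    subst hl
    have hx' : p + v ≠ n + v := fun e => hx (add_right_cancel e)
    refine ⟨if p < n ∧ n + v < p + v then -1 else 1, fun i => ?_⟩
    change (if mode p l < mode n i ∧ mode (n + v) i < mode (p + v) l then _ else _) = _
    simp only [mode_lt_of_ne hx'.symm, mode_lt_of_ne hx]
  have e3 : ∀ c : ℤˣ, ∏ _i ∈ B, c = ∏ _i ∈ sliceAt n S, c := fun c => by
    rcases Int.units_eq_one_or c with rfl | rfl
    · simp
    · exact h.symm
  have e4 : ∀ f : Mode N M → ℤˣ, (∃ c, ∀ i, f (mode n i) = c) →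
      ∏ x ∈ setSlice n B S, f x = ∏ x ∈ S, f x := fun f ⟨c, hc⟩ => by
    rw [prod_modes n, prod_modes n S, filter_setSlice, sliceAt_setSlice]
    simp only [hc, e3]
  have e5 : ∀ x : Mode N M, ∏ j ∈ setSlice n B S, invSign σ x j = ∏ j ∈ S, invSign σ x j :=
    fun x => by
      by_cases hx : siteOf x = n
      · obtain ⟨l, hl⟩ := exists_mode x
        rw [hl, hx]
        exact e4 _ ⟨1, fun i => e0 l i⟩
      · exact e4 _ (e2 x hx)
  simp only [e5]
  rw [Finset.prod_comm]
  refine Eq.trans ?_ Finset.prod_comm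
  refine Finset.prod_congr rfl fun x _ => ?_
  by_cases hx : siteOf x = n
  · obtain ⟨l, hl⟩ := exists_mode x
    rw [hl, hx]
    exact e4 _ ⟨1, fun i => e0 i l⟩
  · exact e4 _ (e1 x hx)

/-- With different parities, reordering the modes of the site past those of other sites could leave
a sign that depends on the state there. -/
theorem permConj_siteUnit (v n : Site N) {A B : Finset (Fin M)} (h : parity A = parity B) :
    permConj (shiftModes N M v) (siteUnit n A B) = siteUnit (n + v) A B := by
  have : fockPerm (shiftModes N M v) * siteUnit n A B
      = siteUnit (n + v) A B * fockPerm (shiftModes N M v) :=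
    l2op_ext fun ψ S => by
      rw [mul_apply_eq_comp, mul_apply_eq_comp, fockPerm_apply, siteUnit_apply, siteUnit_apply,
        fockPerm_apply]
      have hmem : ∀ (S : Finset (Mode N M)) p i,
          mode p i ∈ S.map (shiftModes N M v).symm.toEmbedding ↔ mode (p + v) i ∈ S := by
        intro S p i
        rw [Finset.mem_map_equiv]
        rfl
      have e1 : sliceAt n (S.map (shiftModes N M v).symm.toEmbedding) = sliceAt (n + v) S := by
        ext i; rw [mem_sliceAt, mem_sliceAt, hmem]
      have e2 : (setSlice (n + v) B S).map (shiftModes N M v).symm.toEmbedding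
          = setSlice n B (S.map (shiftModes N M v).symm.toEmbedding) := by
        refine modes_ext fun p i => ?_
        rw [hmem]
        by_cases hp : p = n
        · subst hp; rw [mem_setSlice_same, mem_setSlice_same]
        · rw [mem_setSlice_of_ne hp, mem_setSlice_of_ne fun e => hp (add_right_cancel e), hmem]
      rw [e2, e1]
      split_ifs with hS
      · rw [permSign_setSlice v n (by rw [e1, hS, h])]
      · rw [mul_zero]
  rw [permConj_apply, this, mul_assoc, fockPerm_mul_star, mul_one]

/-- On parity-preserving local operators, the translations of fermions and of systems agree. -/
theorem permConj_toQ_symm (v : Site N) {V : Set (Site N)} {A : QOp N (2 ^ M)}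
    (hA : A ∈ qEven N (codeParity M) V) :
    permConj (shiftModes N M v) ((toQ N M).symm A) = (toQ N M).symm (qShift N _ v A) := by
  refine eq_of_mem_adjoin
    (((permConj (shiftModes N M v) : FOp (Mode N M) ≃⋆ₐ[ℂ] FOp (Mode N M)) :
      FOp (Mode N M) →⋆ₐ[ℂ] FOp (Mode N M)).comp
      ((toQ N M).symm : QOp N (2 ^ M) →⋆ₐ[ℂ] FOp (Mode N M)))
    (((toQ N M).symm : QOp N (2 ^ M) →⋆ₐ[ℂ] FOp (Mode N M)).comp
      (qShift N (2 ^ M) v : QOp N (2 ^ M) →⋆ₐ[ℂ] QOp N (2 ^ M))) ?_ hA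
  rintro _ ⟨n, hn, a, b, hab, rfl⟩
  change permConj (shiftModes N M v) ((toQ N M).symm _) = (toQ N M).symm (qShift N _ v _)
  rw [qShift_qUnit, toQ_symm_qUnit, toQ_symm_qUnit, permConj_siteUnit v n hab]

end Modes

end

noncomputable section

/-! ## Balls of sites -/

section Balls

variable {d : ℕ} {N : Fin d → ℕ}

theorem site_add_apply (n v : Site N) (i : Fin d) : (n + v) i = n i + v i := rfl

theorem siteBall_finite (n : Site N) (r : ℕ) : (siteBall n r).Finite := by
  have h : (Set.univ.pi fun _ : Fin d => Set.Icc (-(r : ℤ)) r).Finite :=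
    Set.Finite.pi fun _ => Set.finite_Icc _ _
  refine (h.image fun z : Fin d → ℤ => (fun i => n i + (z i : ZMod (N i)) : Site N)).subset ?_
  rintro m ⟨z, hz, hm⟩
  exact ⟨z, fun i _ => abs_le.1 (hz i), funext fun i => (hm i).symm⟩

theorem mem_siteBall_self (n : Site N) (r : ℕ) : n ∈ siteBall n r :=
  ⟨0, fun i => by simp, fun i => by simp⟩

theorem mem_siteBall_comm {n m : Site N} {r : ℕ} : m ∈ siteBall n r ↔ n ∈ siteBall m r := by
  suffices h : ∀ n m : Site N, m ∈ siteBall n r → n ∈ siteBall m r from ⟨h n m, h m n⟩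
  rintro n m ⟨z, hz, hm⟩
  exact ⟨-z, fun i => by simpa using hz i, fun i => by simp [hm]⟩

theorem siteBall_subset {n m : Site N} {r s t : ℕ} (h : m ∈ siteBall n s) (ht : r + s ≤ t) :
    siteBall m r ⊆ siteBall n t := by
  obtain ⟨z, hz, hm⟩ := h
  rintro p ⟨y, hy, hp⟩
  refine ⟨z + y, fun i => ?_, fun i => ?_⟩
  · refine (abs_add_le _ _).trans ?_
    have := hz i
    have := hy i
    omega
  · simp [hp, hm, add_assoc]

theorem siteBall_mono {n : Site N} {r s : ℕ} (h : r ≤ s) : siteBall n r ⊆ siteBall n s :=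
  siteBall_subset (mem_siteBall_self n 0) h

theorem add_mem_siteBall_add {n m : Site N} {r : ℕ} (v : Site N) :
    m + v ∈ siteBall (n + v) r ↔ m ∈ siteBall n r := by
  refine exists_congr fun z => and_congr_right fun _ => forall_congr' fun i => ?_
  rw [site_add_apply, site_add_apply, add_right_comm, add_left_inj]

theorem mem_siteBall_sub {n m : Site N} {r : ℕ} (v : Site N) :
    m - v ∈ siteBall n r ↔ m ∈ siteBall (n + v) r := by
  rw [← add_mem_siteBall_add v, sub_add_cancel]

/-- The unit step in direction `j`. -/
def unitStep (N : Fin d → ℕ) (j : Fin d) : Site N := fun i => if i = j then 1 else 0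

/-- A function that is constant along all edges inside a ball is constant on the ball. -/
theorem eq_center_of_edges {α : Type*} {n : Site N} {r : ℕ} {g : Site N → α}
    (h : ∀ p j, p ∈ siteBall n r → p + unitStep N j ∈ siteBall n r → g (p + unitStep N j) = g p)
    {m : Site N} (hm : m ∈ siteBall n r) : g m = g n := by
  -- Induction on the ℓ¹-length of an integer displacement: a step of a nonzero coordinate towards 0
  -- stays in the ball. Working with displacements in ℤ^d avoids any discussion of balls that wrap
  -- around a periodic lattice.
  suffices key : ∀ (k : ℕ) (z : Fin d → ℤ), ∑ i, (z i).natAbs = k → (∀ i, |z i| ≤ r) →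
      g (fun i => n i + (z i : ZMod (N i))) = g n by
    obtain ⟨z, hz, hm⟩ := hm
    rw [← key _ z rfl hz]
    exact congrArg g (funext hm)
  intro k
  induction k with
  | zero =>
    intro z hz _
    have hz0 : ∀ i, z i = 0 := fun i => by
      simpa using (Finset.sum_eq_zero_iff.1 hz) i (Finset.mem_univ i)
    exact congrArg g (funext fun i => by simp [hz0])
  | succ k ih =>
    intro z hz hr
    obtain ⟨j, hj⟩ : ∃ j, z j ≠ 0 := by
      by_contra! hall
      simp [hall] at hz
    have hstep : ∀ (z' : Fin d → ℤ), (z' j).natAbs + 1 = (z j).natAbs →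
        (∀ i, i ≠ j → z' i = z i) → (∑ i, (z' i).natAbs = k) ∧ (∀ i, |z' i| ≤ r) := by
      intro z' h1 h2
      constructor
      · rw [← Finset.add_sum_erase _ _ (Finset.mem_univ j)] at hz ⊢
        rw [Finset.sum_congr rfl fun i hi => by rw [h2 i (Finset.ne_of_mem_erase hi)]]
        omega
      · intro i
        by_cases hi : i = j
        · subst hi
          have := abs_le.1 (hr i)
          rw [abs_le]
          omega
        · rw [h2 i hi]; exact hr i
    have hmem : ∀ z : Fin d → ℤ, (∀ i, |z i| ≤ r) →
        (fun i => n i + (z i : ZMod (N i)) : Site N) ∈ siteBall n r := fun z hz =>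
      ⟨z, hz, fun i => rfl⟩
    have hadd : ∀ z z' : Fin d → ℤ, z = (fun i => z' i + if i = j then 1 else 0) →
        (fun i => n i + (z i : ZMod (N i)) : Site N)
          = (show Site N from fun i => n i + (z' i : ZMod (N i))) + unitStep N j := by
      rintro _ z' rfl
      funext i
      rw [site_add_apply, unitStep]
      push_cast
      split_ifs <;> ring
    rcases lt_or_gt_of_ne hj with hneg | hpos
    · obtain ⟨h1, h2⟩ := hstep (fun i => z i + if i = j then 1 else 0)
        (by simp only [if_true]; omega) (fun i hi => by simp [hi])
      rw [← ih _ h1 h2]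
      have e := hadd (fun i => z i + if i = j then 1 else 0) z rfl
      have := h _ j (hmem z hr) (e ▸ hmem _ h2)
      rw [← this, ← e]
    · obtain ⟨h1, h2⟩ := hstep (fun i => z i - if i = j then 1 else 0)
        (by simp only [if_true]; omega) (fun i hi => by simp [hi])
      rw [← ih _ h1 h2]
      have e := hadd z (fun i => z i - if i = j then 1 else 0) (by funext i; simp)
      have := h _ j (hmem _ h2) (e ▸ hmem _ hr)
      rw [← this, ← e]

end Balls

/-! ## Homomorphisms on subalgebras generated by a set -/

section AdjoinSub

variable {A B : Type*} [Ring A] [Algebra ℂ A] [StarRing A] [StarModule ℂ A]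
  [Ring B] [Algebra ℂ B] [StarRing B] [StarModule ℂ B] {S : StarSubalgebra ℂ A} {s : Set A}

theorem map_mem_of_mem_adjoin' (f : S →⋆ₐ[ℂ] B) {T : StarSubalgebra ℂ B} (hs : s ⊆ S)
    (h : ∀ a (ha : a ∈ s), f ⟨a, hs ha⟩ ∈ T) {x : S} (hx : (x : A) ∈ StarAlgebra.adjoin ℂ s) :
    f x ∈ T := by
  have : StarAlgebra.adjoin ℂ s ≤ (T.comap f).map S.subtype :=
    StarAlgebra.adjoin_le fun a ha => ⟨⟨a, hs ha⟩, h a ha, rfl⟩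
  obtain ⟨y, hy, hyx⟩ := this hx
  rwa [← Subtype.ext hyx]

theorem eq_of_mem_adjoin' (f g : S →⋆ₐ[ℂ] B) (hs : s ⊆ S)
    (h : ∀ a (ha : a ∈ s), f ⟨a, hs ha⟩ = g ⟨a, hs ha⟩) {x : S}
    (hx : (x : A) ∈ StarAlgebra.adjoin ℂ s) : f x = g x := by
  have : StarAlgebra.adjoin ℂ s ≤ (StarAlgHom.equalizer f g).map S.subtype :=
    StarAlgebra.adjoin_le fun a ha => ⟨⟨a, hs ha⟩, h a ha, rfl⟩
  obtain ⟨y, hy, hyx⟩ := this hx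
  have hyx' : y = x := Subtype.ext hyx
  rw [← hyx']
  exact hy

/-- An isomorphism of *-algebras as a homomorphism. -/
def equivHom (e : A ≃⋆ₐ[ℂ] B) : A →⋆ₐ[ℂ] B where
  toFun := e
  map_one' := map_one e
  map_mul' := map_mul e
  map_zero' := map_zero e
  map_add' := map_add e
  commutes' := fun c => by
    rw [Algebra.algebraMap_eq_smul_one, Algebra.algebraMap_eq_smul_one, map_smul, map_one]
  map_star' := map_star e

theorem equivHom_apply (e : A ≃⋆ₐ[ℂ] B) (x : A) : equivHom e x = e x := rfl

theorem equiv_mem_of_mem_adjoin {T : StarSubalgebra ℂ A} (u : S ≃⋆ₐ[ℂ] S) (hs : s ⊆ S)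
    (h : ∀ a (ha : a ∈ s), (u ⟨a, hs ha⟩ : A) ∈ T) {x : S}
    (hx : (x : A) ∈ StarAlgebra.adjoin ℂ s) : (u x : A) ∈ T :=
  map_mem_of_mem_adjoin' (S.subtype.comp (equivHom u)) hs h hx

/-- The evolutions are defined on subalgebras only, while `f` is defined on all operators. The
element `y` with value `f x` records that the image belongs to the domain of `w`. -/
theorem equiv_intertwine_of_mem_adjoin {T : StarSubalgebra ℂ B} (u : S ≃⋆ₐ[ℂ] S)
    (w : T ≃⋆ₐ[ℂ] T) (f : A →⋆ₐ[ℂ] B) (hS : S = StarAlgebra.adjoin ℂ s)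
    (h : ∀ x : S, (x : A) ∈ s → ∃ y : T, (y : B) = f x ∧ (w y : B) = f (u x))
    {x : S} {y : T} (hxy : (y : B) = f x) : (w y : B) = f (u x) := by
  subst hS
  have hf : ∀ x : StarAlgebra.adjoin ℂ s, f x ∈ T := fun x =>
    map_mem_of_mem_adjoin f (fun a ha => by
      obtain ⟨y, hy, -⟩ := h ⟨a, StarAlgebra.subset_adjoin ℂ s ha⟩ ha
      exact hy ▸ y.2) x.2
  let f' : StarAlgebra.adjoin ℂ s →⋆ₐ[ℂ] T :=
    StarAlgHom.codRestrict (f.comp (StarAlgebra.adjoin ℂ s).subtype) T hf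
  have key := eq_of_mem_adjoin' ((equivHom w).comp f') (f'.comp (equivHom u))
    (StarAlgebra.subset_adjoin ℂ s) (fun a ha => by
      obtain ⟨y, hy, hw⟩ := h ⟨a, StarAlgebra.subset_adjoin ℂ s ha⟩ ha
      have e : f' ⟨a, StarAlgebra.subset_adjoin ℂ s ha⟩ = y := Subtype.ext hy.symm
      refine Subtype.ext ?_
      change (w (f' _) : B) = f (u _)
      rw [e, hw]) x.2
  have e : y = f' x := Subtype.ext hxy
  rw [e]
  exact congrArg Subtype.val key

end AdjoinSub

/-! ## Gates on a net of local algebras -/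

section Net

variable {d : ℕ} {N : Fin d → ℕ} {O : Type*} [Ring O] [Algebra ℂ O] [StarRing O] [StarModule ℂ O]

/-- Algebras `loc V` of local operators and `obs V` of local observables, where observables commute
with operators that are localized elsewhere. -/
structure IsLocalNet (tot : StarSubalgebra ℂ O) (loc obs : Set (Site N) → StarSubalgebra ℂ O) : Prop where
  le_tot : ∀ V, loc V ≤ tot
  mono : ∀ {V W}, V ⊆ W → loc V ≤ loc W
  obs_mono : ∀ {V W}, V ⊆ W → obs V ≤ obs W
  obs_le : ∀ V, obs V ≤ loc V
  comm : ∀ {V W}, Disjoint V W → ∀ {A B}, A ∈ obs V → B ∈ loc W → Commute A B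
  exhaust : ∀ {A}, A ∈ tot → ∃ V : Set (Site N), V.Finite ∧ A ∈ loc V

/-- Gates for a layer of a circuit: commuting self-adjoint unitary observables around all sites. -/
structure IsGateLayer {κ : Type} (obs : Set (Site N) → StarSubalgebra ℂ O) (r : ℕ)
    (G : Site N × κ → O) : Prop where
  comm : ∀ i j, Commute (G i) (G j)
  self : ∀ i, star (G i) = G i
  sq : ∀ i, G i * G i = 1
  mem : ∀ n i, G (n, i) ∈ obs (siteBall n r)

variable {tot : StarSubalgebra ℂ O} {loc obs : Set (Site N) → StarSubalgebra ℂ O} {κ : Type} [Finite κ] {r : ℕ}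
  {G : Site N × κ → O}

namespace IsGateLayer

theorem mem_univ (net : IsLocalNet tot loc obs) (h : IsGateLayer obs r G) (i : Site N × κ) :
    G i ∈ obs Set.univ := net.obs_mono (Set.subset_univ _) (h.mem i.1 i.2)

theorem near_finite {V : Set (Site N)} (hV : V.Finite) :
    {i : Site N × κ | ¬ Disjoint (siteBall i.1 r) V}.Finite := by
  refine ((hV.biUnion fun n _ => siteBall_finite n r).prod (Set.finite_univ (α := κ))).subset ?_
  rintro ⟨p, i⟩ hp
  obtain ⟨n, hn, hnV⟩ := Set.not_disjoint_iff.1 hp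
  exact ⟨Set.mem_biUnion hnV (mem_siteBall_comm.1 hn), Set.mem_univ _⟩

/-- The gates as elements of the algebra of local operators. -/
def gate (net : IsLocalNet tot loc obs) (h : IsGateLayer obs r G) (i : Site N × κ) : tot :=
  ⟨G i, net.le_tot _ (net.obs_le _ (h.mem_univ net i))⟩

theorem family (net : IsLocalNet tot loc obs) (h : IsGateLayer obs r G) :
    IsGateFamily (h.gate net) where
  comm i j := Subtype.ext (h.comm i j)
  self i := Subtype.ext (h.self i)
  sq i := Subtype.ext (h.sq i)
  fin a := by
    obtain ⟨V, hV, ha⟩ := net.exhaust a.2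
    refine (near_finite (r := r) hV).subset fun i hi hd => hi (Subtype.ext ?_)
    exact net.comm hd (h.mem i.1 i.2) ha

/-- The automorphism given by conjugation with all gates. -/
def aut (net : IsLocalNet tot loc obs) (h : IsGateLayer obs r G) : tot ≃⋆ₐ[ℂ] tot :=
  (h.family net).aut

theorem coe_gateProd (net : IsLocalNet tot loc obs) (h : IsGateLayer obs r G)
    (F : Finset (Site N × κ)) :
    ((gateProd (h.gate net) (h.family net).comm F : tot) : O) = gateProd G h.comm F :=
  map_gateProd tot.subtype _ F

theorem eventually_aut_eq (net : IsLocalNet tot loc obs) (h : IsGateLayer obs r G)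
    (a : tot) : ∀ᶠ F in Filter.atTop,
      (h.aut net a : O) = gateProd G h.comm F * a * gateProd G h.comm F := by
  filter_upwards [(h.family net).eventually_aut_eq a] with F hF
  rw [aut, hF]
  simp only [MulMemClass.coe_mul, coe_gateProd]

/-- Only gates whose ball of radius `r` meets `V` contribute, and such a ball stays within distance
`2 * r` of a point of `V`. The family `T` covers local operators and observables at once. -/
theorem aut_mem_of_near {T : Set (Site N) → StarSubalgebra ℂ O} (net : IsLocalNet tot loc obs)
    (h : IsGateLayer obs r G) (hT : ∀ {V W}, V ⊆ W → T V ≤ T W) (hobs : ∀ V, obs V ≤ T V)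
    (hloc : ∀ V, T V ≤ loc V) {V W : Set (Site N)}
    (hVW : ∀ n ∈ V, siteBall n (2 * r) ⊆ W) {a : tot} (ha : (a : O) ∈ T V) :
    (h.aut net a : O) ∈ T W := by
  rw [aut, IsGateFamily.aut_eq (h.family net) a subset_rfl]
  simp only [MulMemClass.coe_mul, coe_gateProd]
  have hG : gateProd G h.comm ((h.family net).fin a).toFinset ∈ T W := by
    refine gateProd_mem _ _ fun i hi => ?_
    rw [Set.Finite.mem_toFinset] at hi
    have hd : ¬ Disjoint (siteBall i.1 r) V := fun hd =>
      hi (Subtype.ext (net.comm hd (h.mem i.1 i.2) (hloc V ha)))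
    obtain ⟨n, hn, hnV⟩ := Set.not_disjoint_iff.1 hd
    refine hT ?_ (hobs _ (h.mem i.1 i.2))
    exact (siteBall_subset (mem_siteBall_comm.1 hn) (by omega)).trans (hVW n hnV)
  refine mul_mem (mul_mem hG (hT ?_ ha)) hG
  exact fun n hn => hVW n hn (mem_siteBall_self n _)

theorem aut_mem (net : IsLocalNet tot loc obs) (h : IsGateLayer obs r G) {V W : Set (Site N)}
    (hVW : ∀ n ∈ V, siteBall n (2 * r) ⊆ W) {a : tot} (ha : (a : O) ∈ loc V) :
    (h.aut net a : O) ∈ loc W :=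
  h.aut_mem_of_near net net.mono net.obs_le (fun _ => le_rfl) hVW ha

theorem aut_mem_obs (net : IsLocalNet tot loc obs) (h : IsGateLayer obs r G) {V W : Set (Site N)}
    (hVW : ∀ n ∈ V, siteBall n (2 * r) ⊆ W) {a : tot} (ha : (a : O) ∈ obs V) :
    (h.aut net a : O) ∈ obs W :=
  h.aut_mem_of_near net net.obs_mono (fun _ => le_rfl) net.obs_le hVW ha

theorem aut_aut (net : IsLocalNet tot loc obs) (h : IsGateLayer obs r G) (a : tot) :
    h.aut net (h.aut net a) = a := (h.family net).aut_aut a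

/-- Translation of the labels of the gates. -/
def shiftLabel (N : Fin d → ℕ) (κ : Type) (v : Site N) : Site N × κ ≃ Site N × κ :=
  (Equiv.addRight v).prodCongr (Equiv.refl κ)

theorem map_gateProd_shift (h : IsGateLayer obs r G) (σ : O ≃⋆ₐ[ℂ] O) (v : Site N)
    (hσ : ∀ n i, σ (G (n, i)) = G (n + v, i)) (F : Finset (Site N × κ)) :
    σ (gateProd G h.comm F) = gateProd G h.comm (F.map (shiftLabel N κ v).toEmbedding) := by
  rw [map_gateProd, gateProd_map]
  congr 1
  funext i
  exact hσ i.1 i.2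

/-- The gate family is invariant under simultaneous translation of operators and labels, so the
translate of a finite product of gates is again one. -/
theorem aut_shift (net : IsLocalNet tot loc obs) (h : IsGateLayer obs r G) (σ : O ≃⋆ₐ[ℂ] O)
    (v : Site N) (hσ : ∀ n i, σ (G (n, i)) = G (n + v, i)) {x y : tot}
    (hxy : (y : O) = σ x) : (h.aut net y : O) = σ (h.aut net x) := by
  classical
  obtain ⟨F1, h1⟩ := Filter.eventually_atTop.1 (h.eventually_aut_eq net x)
  obtain ⟨F2, h2⟩ := Filter.eventually_atTop.1 (h.eventually_aut_eq net y)
  -- Chosen such that `F` is large enough for `x` and its translate is large enough for `y`.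
  let F := F1 ∪ F2.map (shiftLabel N κ v).symm.toEmbedding
  have hF : F2 ⊆ F.map (shiftLabel N κ v).toEmbedding := by
    intro i hi
    rw [Finset.mem_map_equiv]
    refine Finset.mem_union_right _ ?_
    rw [Finset.mem_map_equiv]
    simpa using hi
  rw [h1 F Finset.subset_union_left, h2 _ hF, map_mul, map_mul, map_gateProd_shift h σ v hσ, hxy]

/-- On a finite lattice the formal product of all gates is an element of the algebra. A translation
only permutes its commuting factors. -/
theorem exists_unitary (net : IsLocalNet tot loc obs) (h : IsGateLayer obs r G) [Finite (Site N)] :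
    ∃ U : tot, (U : O) ∈ obs Set.univ ∧ (star U * U = 1 ∧ U * star U = 1) ∧
      (∀ a, h.aut net a = star U * a * U) ∧ ∀ (σ : O ≃⋆ₐ[ℂ] O) (v : Site N),
        (∀ n i, σ (G (n, i)) = G (n + v, i)) → σ U = U := by
  have := Fintype.ofFinite (Site N × κ)
  have hs := star_gateProd (h.family net).comm (h.family net).self Finset.univ
  have hq := gateProd_sq (h.family net).comm (h.family net).sq Finset.univ
  refine ⟨gateProd (h.gate net) (h.family net).comm Finset.univ, ?_, ?_, ?_, ?_⟩
  · rw [coe_gateProd]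
    exact gateProd_mem _ _ fun i _ => h.mem_univ net i
  · rw [hs]
    exact ⟨hq, hq⟩
  · rw [hs]
    exact fun a => (h.family net).aut_eq a (Finset.subset_univ _)
  · intro σ v hσ
    rw [coe_gateProd, map_gateProd_shift h σ v hσ, Finset.map_univ_equiv]

end IsGateLayer

end Net

end

noncomputable section

/-! ## Quantum cellular automata from gates -/

section QCA

variable {d : ℕ} {N : Fin d → ℕ} {D : ℕ} [NeZero D]

theorem unitary_mul {O : Type*} [Ring O] [StarRing O] {U V : O}
    (hU : star U * U = 1 ∧ U * star U = 1) (hV : star V * V = 1 ∧ V * star V = 1) :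
    star (U * V) * (U * V) = 1 ∧ U * V * star (U * V) = 1 := by
  rw [star_mul]
  constructor
  · rw [mul_assoc, ← mul_assoc (star U), hU.1, one_mul, hV.1]
  · rw [mul_assoc, ← mul_assoc V, hV.2, one_mul, hU.2]

theorem conj_comp {O : Type*} [Ring O] [StarRing O] {u u' : O → O} {U V : O}
    (hu : ∀ A, u A = star U * A * U) (hu' : ∀ A, u' A = star V * A * V) (A : O) :
    u' (u A) = star (U * V) * A * (U * V) := by
  rw [hu, hu', star_mul]
  noncomm_ring

theorem exists_finite_of_mem_adjoin {O γ : Type*} [Ring O] [Algebra ℂ O] [StarRing O]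
    [StarModule ℂ O] (loc : Set γ → StarSubalgebra ℂ O)
    (mono : ∀ {V W}, V ⊆ W → loc V ≤ loc W) {s : Set O}
    (hs : ∀ a ∈ s, ∃ V : Set γ, V.Finite ∧ a ∈ loc V) {a : O}
    (ha : a ∈ StarAlgebra.adjoin ℂ s) : ∃ V : Set γ, V.Finite ∧ a ∈ loc V := by
  induction ha using StarAlgebra.adjoin_induction with
  | mem a ha => exact hs a ha
  | algebraMap c => exact ⟨∅, Set.finite_empty, algebraMap_mem _ _⟩
  | add a b _ _ ha hb =>
    obtain ⟨V, hV, ha⟩ := ha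
    obtain ⟨W, hW, hb⟩ := hb
    exact ⟨V ∪ W, hV.union hW, add_mem (mono Set.subset_union_left ha)
      (mono Set.subset_union_right hb)⟩
  | mul a b _ _ ha hb =>
    obtain ⟨V, hV, ha⟩ := ha
    obtain ⟨W, hW, hb⟩ := hb
    exact ⟨V ∪ W, hV.union hW, mul_mem (mono Set.subset_union_left ha)
      (mono Set.subset_union_right hb)⟩
  | star a _ ha =>
    obtain ⟨V, hV, ha⟩ := ha
    exact ⟨V, hV, star_mem ha⟩

theorem isLocalNet_qLocal (N : Fin d → ℕ) (D : ℕ) [NeZero D] :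
    IsLocalNet (QAlg N D) (qLocal N D) (qLocal N D) where
  le_tot _ := qLocal_mono (Set.subset_univ _)
  mono := qLocal_mono
  obs_mono := qLocal_mono
  obs_le _ := le_rfl
  comm hd _ _ hA hB := qLocal_commute hd hA hB
  exhaust hA := exists_finite_of_mem_adjoin (qLocal N D) qLocal_mono (by
    rintro _ ⟨n, -, a, b, rfl⟩
    exact ⟨{n}, Set.finite_singleton n, qUnit_mem (Set.mem_singleton n) a b⟩) hA

theorem IsGateLayer.qca_unitary {κ : Type} [Finite κ] {r : ℕ} {G : Site N × κ → QOp N D}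
    (h : IsGateLayer (qLocal N D) r G)
    (hG : ∀ v n i, qShift N D v (G (n, i)) = G (n + v, i)) [Finite (Site N)] :
    ∃ U : QAlg N D, (star U * U = 1 ∧ U * star U = 1) ∧
      (∀ A : QAlg N D, h.aut (isLocalNet_qLocal N D) A = star U * A * U) ∧
      ∀ v : Site N, (U : QOp N D) * qTrans N D v = qTrans N D v * (U : QOp N D) := by
  obtain ⟨U, h0, h1, h3, h4⟩ := h.exists_unitary (isLocalNet_qLocal N D)
  refine ⟨U, h1, h3, fun v => ?_⟩
  have := h4 (qShift N D v) v (hG v)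
  rw [qShift_apply] at this
  have h5 : (U : QOp N D) * qTrans N D v
      = qTrans N D v * U * star (qTrans N D v) * qTrans N D v := by rw [this]
  refine h5.trans ?_
  rw [mul_assoc, star_mul_qTrans, mul_one]

theorem IsGateLayer.isQCA {κ : Type} [Finite κ] {r : ℕ} {G : Site N × κ → QOp N D}
    (h : IsGateLayer (qLocal N D) r G)
    (hG : ∀ v n i, qShift N D v (G (n, i)) = G (n + v, i)) :
    IsQCA N D (2 * r) (h.aut (isLocalNet_qLocal N D)) where
  causal n A hA := h.aut_mem _ (by rintro _ rfl; exact subset_rfl) hA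
  translation v n a b := by
    rw [h.aut_shift (isLocalNet_qLocal N D) (qShift N D v) v (hG v) (x := qGen N D n a b)
      (qShift_qUnit v n a b).symm, qShift_apply]
  unitary _ := h.qca_unitary hG

theorem IsQCA.map_mem {L : ℕ} {u : QAlg N D ≃⋆ₐ[ℂ] QAlg N D} (hu : IsQCA N D L u)
    {V W : Set (Site N)} (hVW : ∀ n ∈ V, siteBall n L ⊆ W) {A : QAlg N D}
    (hA : (A : QOp N D) ∈ qLocal N D V) : (u A : QOp N D) ∈ qLocal N D W := by
  refine equiv_mem_of_mem_adjoin u ?_ ?_ hA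
  · rintro _ ⟨n, -, a, b, rfl⟩
    exact qUnit_mem (Set.mem_univ n) a b
  · rintro _ ⟨n, hn, a, b, rfl⟩
    exact qLocal_mono (hVW n hn) (hu.causal n (qGen N D n a b) (qUnit_mem (Set.mem_singleton n) a b))

theorem IsQCA.map_shift {L : ℕ} {u : QAlg N D ≃⋆ₐ[ℂ] QAlg N D} (hu : IsQCA N D L u)
    (v : Site N) {x y : QAlg N D} (hxy : (y : QOp N D) = qShift N D v x) :
    (u y : QOp N D) = qShift N D v (u x) := by
  refine equiv_intertwine_of_mem_adjoin u u (equivHom (qShift N D v)) rfl ?_ hxy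
  intro x hx
  obtain ⟨n, _, a, b, h⟩ := hx
  have h' : x = qGen N D n a b := Subtype.ext h
  rw [h']
  exact ⟨qGen N D (n + v) a b, (qShift_qUnit v n a b).symm,
    (hu.translation v n a b).trans (qShift_apply _ _).symm⟩

theorem IsQCA.trans_unitary {L L' : ℕ} {u u' : QAlg N D ≃⋆ₐ[ℂ] QAlg N D} (hu : IsQCA N D L u)
    (hu' : IsQCA N D L' u') (hfin : Finite (Site N)) :
    ∃ U : QAlg N D, (star U * U = 1 ∧ U * star U = 1) ∧
      (∀ A : QAlg N D, u' (u A) = star U * A * U) ∧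
      ∀ v : Site N, (U : QOp N D) * qTrans N D v = qTrans N D v * (U : QOp N D) := by
  have h := hu.unitary hfin
  have h' := hu'.unitary hfin
  obtain ⟨U, hU, h3, h4⟩ := h
  obtain ⟨U', hU', h3', h4'⟩ := h'
  exact ⟨U * U', unitary_mul hU hU', fun A => conj_comp (u := u) (u' := u') h3 h3' A,
    fun v => Commute.mul_left (h4 v) (h4' v)⟩

theorem IsQCA.trans {L L' : ℕ} {u u' : QAlg N D ≃⋆ₐ[ℂ] QAlg N D} (hu : IsQCA N D L u)
    (hu' : IsQCA N D L' u') : IsQCA N D (L + L') (u.trans u') where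
  causal n A hA := hu'.map_mem (fun m hm => siteBall_subset hm (by omega)) (hu.causal n A hA)
  translation v n a b :=
    (hu'.map_shift v ((hu.translation v n a b).trans (qShift_apply _ _).symm)).trans
      (qShift_apply _ _)
  unitary hfin := hu.trans_unitary hu' hfin

end QCA

/-! ## Fermionic quantum cellular automata from gates -/

section FQCA

variable {d : ℕ} {N : Fin d → ℕ} {m : ℕ}

theorem modesOn_mono {V W : Set (Site N)} (h : V ⊆ W) : modesOn N m V ⊆ modesOn N m W :=
  fun _ hx => h hx

theorem modesOn_disjoint {V W : Set (Site N)} (h : Disjoint V W) :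
    Disjoint (modesOn N m V) (modesOn N m W) :=
  Set.disjoint_left.2 fun _ hx hy => Set.disjoint_left.1 h hx hy

theorem isLocalNet_fObs (N : Fin d → ℕ) (m : ℕ) :
    IsLocalNet (CAR (Mode N m)) (fun V => carLocal (Mode N m) (modesOn N m V)) (fObs N m) where
  le_tot _ := carLocal_mono (Set.subset_univ _)
  mono h := carLocal_mono (modesOn_mono h)
  obs_mono h := carEven_mono (modesOn_mono h)
  obs_le _ := carEven_le_carLocal _
  comm hd _ _ hA hB := carEven_commute_carLocal (modesOn_disjoint hd) hA hB
  exhaust hA := exists_finite_of_mem_adjoin (fun V => carLocal (Mode N m) (modesOn N m V))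
    (fun h => carLocal_mono (modesOn_mono h)) (by
    rintro _ ⟨x, -, rfl⟩
    exact ⟨{siteOf x}, Set.finite_singleton _, annih_mem_carLocal rfl⟩) hA

/-- Local finiteness of a gate family needs to be checked on generators only. It serves for systems
with additional modes, which belong to no site of the lattice. -/
theorem not_commute_finite_of_mem_adjoin {O J : Type*} [Ring O] [Algebra ℂ O] [StarRing O]
    [StarModule ℂ O] {G : J → O} (hself : ∀ i, star (G i) = G i) {s : Set O}
    (hs : ∀ a ∈ s, {i | ¬ Commute (G i) a}.Finite) {a : O}
    (ha : a ∈ StarAlgebra.adjoin ℂ s) : {i | ¬ Commute (G i) a}.Finite := by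
  induction ha using StarAlgebra.adjoin_induction with
  | mem a ha => exact hs a ha
  | algebraMap c =>
    refine Set.finite_empty.subset fun i hi => hi ?_
    exact (Algebra.commutes c (G i)).symm
  | add a b _ _ ha hb =>
    refine (ha.union hb).subset fun i hi => ?_
    by_contra h
    rw [Set.mem_union, not_or] at h
    exact hi ((not_not.1 h.1).add_right (not_not.1 h.2))
  | mul a b _ _ ha hb =>
    refine (ha.union hb).subset fun i hi => ?_
    by_contra h
    rw [Set.mem_union, not_or] at h
    exact hi ((not_not.1 h.1).mul_right (not_not.1 h.2))
  | star a _ ha =>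
    refine ha.subset fun i hi h => hi ?_
    have := h.star_star
    rwa [hself] at this

theorem signConj_carEven_neg_one {ι : Type} [LinearOrder ι] {M : Set ι} {A : FOp ι}
    (hA : A ∈ carEven ι M) : signConj (-1) A = A :=
  signConj_eq_self_of_carEven (u := -1) (fun _ _ => rfl) hA

theorem commute_extendModes_newMode {ι : Type} [LinearOrder ι] {M : Set ι} {A : FOp ι}
    (hA : A ∈ carEven ι M) {k : ℕ} (j : Fin k) :
    Commute (extendModes ι k A) (annih _ (newMode j)) := by
  refine ((annih_newMode_mul (k := k) A j).trans ?_).symm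
  congr 2
  exact signConj_carEven_neg_one hA

theorem IsGateLayer.fqca_unitary {κ : Type} [Finite κ] {r : ℕ} {G : Site N × κ → FOp (Mode N m)}
    (h : IsGateLayer (fObs N m) r G)
    (hG : ∀ v n i, permConj (shiftModes N m v) (G (n, i)) = G (n + v, i)) [Finite (Site N)] :
    ∃ U : CAR (Mode N m), (star U * U = 1 ∧ U * star U = 1) ∧
      (∀ A : CAR (Mode N m), h.aut (isLocalNet_fObs N m) A = star U * A * U) ∧
      (∀ v : Site N, (U : FOp (Mode N m)) * fTrans N m v = fTrans N m v * (U : FOp (Mode N m))) ∧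
      ∀ (k : ℕ) (j : Fin k),
        extendModes (Mode N m) k (U : FOp (Mode N m)) * annih _ (newMode j)
          = annih _ (newMode j) * extendModes (Mode N m) k (U : FOp (Mode N m)) := by
  obtain ⟨U, h0, h1, h3, h4⟩ := h.exists_unitary (isLocalNet_fObs N m)
  refine ⟨U, h1, h3, fun v => ?_, fun k j => ?_⟩
  · have := h4 (permConj (shiftModes N m v)) v (hG v)
    rw [permConj_apply] at this
    have h5 : (U : FOp (Mode N m)) * fockPerm (shiftModes N m v)
        = fockPerm (shiftModes N m v) * U * star (fockPerm (shiftModes N m v))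
          * fockPerm (shiftModes N m v) := by rw [this]
    refine h5.trans ?_
    rw [mul_assoc, star_mul_fockPerm, mul_one]
    rfl
  · exact commute_extendModes_newMode h0 j

theorem IsGateLayer.isFQCA {κ : Type} [Finite κ] {r : ℕ} {G : Site N × κ → FOp (Mode N m)}
    (h : IsGateLayer (fObs N m) r G)
    (hG : ∀ v n i, permConj (shiftModes N m v) (G (n, i)) = G (n + v, i)) :
    IsFQCA N m (2 * r) (h.aut (isLocalNet_fObs N m)) where
  causal n i := h.aut_mem (isLocalNet_fObs N m) (V := {n}) (by rintro _ rfl; exact subset_rfl)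
    (annih_mem_carLocal rfl)
  translation v n i := by
    refine (h.aut_shift (isLocalNet_fObs N m) (permConj (shiftModes N m v)) v (hG v)
      (x := carGen _ (mode n i)) ?_).trans (permConj_apply _ _)
    exact (permConj_annih (shiftModes N m v) (mode n i)).symm
  -- The extended gates form a gate family of the larger system. They are even, so they commute with
  -- the additional modes, which the resulting automorphism therefore fixes.
  ancilla k := by
    let net := isLocalNet_fObs N m
    have hmem : ∀ i, extendHom (Mode N m) k (G i) ∈ CAR (AddModes (Mode N m) k) := fun i =>
      carLocal_mono (Set.subset_univ _)
        (extendModes_mem k (carEven_le_carLocal _ (h.mem_univ net i)))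
    let G' : Site N × κ → CAR (AddModes (Mode N m) k) := fun i => ⟨_, hmem i⟩
    have hself : ∀ i, star (extendHom (Mode N m) k (G i)) = extendHom (Mode N m) k (G i) :=
      fun i => by rw [← map_star, h.self]
    have fam : IsGateFamily G' :=
      { comm := fun i j => Subtype.ext ((h.comm i j).map (extendHom (Mode N m) k))
        self := fun i => Subtype.ext (hself i)
        sq := fun i => Subtype.ext (by
          change extendHom (Mode N m) k (G i) * extendHom (Mode N m) k (G i) = 1
          rw [← map_mul, h.sq, map_one])
        fin := fun a => by
          have := not_commute_finite_of_mem_adjoin hself (s := {A | ∃ i ∈ Set.univ,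
            A = annih (AddModes (Mode N m) k) i}) (by
              rintro _ ⟨i, -, rfl⟩
              rcases i with i | j
              · refine ((h.family net).fin (carGen _ i)).subset fun x hx hc => hx ?_
                have := (congrArg Subtype.val hc : G x * annih _ i = annih _ i * G x)
                change Commute _ (annih _ (oldMode i))
                rw [← extendModes_annih]
                exact Commute.map this (extendHom (Mode N m) k)
              · refine Set.finite_empty.subset fun x hx => hx ?_
                exact commute_extendModes_newMode (h.mem_univ net x) j) a.2
          refine this.subset fun i hi hc => hi (Subtype.ext hc) }
    refine ⟨fam.aut, fun i => ?_, fun j => ?_⟩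
    · obtain ⟨F, h1, h2⟩ := (((fam.eventually_aut_eq (carGen _ (oldMode i)))).and
        (h.eventually_aut_eq net (carGen _ i))).exists
      rw [h1]
      simp only [MulMemClass.coe_mul]
      have h3 : ((gateProd G' fam.comm F : CAR (AddModes (Mode N m) k)) : FOp _)
          = extendHom (Mode N m) k (gateProd G h.comm F) := by
        rw [map_gateProd]
        exact map_gateProd (CAR (AddModes (Mode N m) k)).subtype _ F
      rw [h3]
      change _ = extendHom (Mode N m) k _
      rw [show ((IsGateLayer.aut _ h (carGen _ i) : CAR (Mode N m)) : FOp (Mode N m)) = _ from h2,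
        map_mul, map_mul]
      congr 2
      exact (extendModes_annih i).symm
    · rw [fam.aut_eq _ subset_rfl]
      have hc : Commute (carGen _ (newMode j)) (gateProd G' fam.comm
          (fam.fin (carGen _ (newMode j))).toFinset) :=
        gateProd_commute _ _ fun x _ => Subtype.ext
          (commute_extendModes_newMode (h.mem_univ net x) j).symm
      rw [← hc.eq, mul_assoc, gateProd_sq _ fam.sq, mul_one]
  unitary _ := h.fqca_unitary hG

theorem IsFQCA.map_mem {L : ℕ} {u : CAR (Mode N m) ≃⋆ₐ[ℂ] CAR (Mode N m)} (hu : IsFQCA N m L u)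
    {V W : Set (Site N)} (hVW : ∀ n ∈ V, siteBall n L ⊆ W) {A : CAR (Mode N m)}
    (hA : (A : FOp (Mode N m)) ∈ carLocal _ (modesOn N m V)) :
    (u A : FOp (Mode N m)) ∈ carLocal _ (modesOn N m W) := by
  refine equiv_mem_of_mem_adjoin u ?_ ?_ hA
  · rintro _ ⟨i, -, rfl⟩
    exact annih_mem_carLocal (Set.mem_univ i)
  · rintro _ ⟨x, hx, rfl⟩
    obtain ⟨i, hi⟩ := exists_mode x
    generalize hp : siteOf x = p at hi
    subst hi
    exact carLocal_mono (modesOn_mono (hVW _ hx)) (hu.causal p i)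

theorem IsFQCA.map_shift {L : ℕ} {u : CAR (Mode N m) ≃⋆ₐ[ℂ] CAR (Mode N m)}
    (hu : IsFQCA N m L u) (v : Site N) {x y : CAR (Mode N m)}
    (hxy : (y : FOp (Mode N m)) = permConj (shiftModes N m v) x) :
    (u y : FOp (Mode N m)) = permConj (shiftModes N m v) (u x) := by
  refine equiv_intertwine_of_mem_adjoin u u (equivHom (permConj (shiftModes N m v))) rfl ?_ hxy
  intro x hx
  obtain ⟨a, _, h⟩ := hx
  obtain ⟨i, hi⟩ := exists_mode a
  generalize siteOf a = n at hi
  subst hi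
  have h' : x = carGen _ (mode n i) := Subtype.ext h
  rw [h']
  exact ⟨carGen _ (mode (n + v) i), (permConj_annih (shiftModes N m v) (mode n i)).symm,
    (hu.translation v n i).trans (permConj_apply _ _).symm⟩

/-- The extension to additional modes intertwines with the evolution on all operators. -/
theorem extend_intertwine {ι : Type} [LinearOrder ι] {k : ℕ} {u : CAR ι ≃⋆ₐ[ℂ] CAR ι}
    {w : CAR (AddModes ι k) ≃⋆ₐ[ℂ] CAR (AddModes ι k)}
    (hw : ∀ i, (w (carGen _ (oldMode i)) : FOp (AddModes ι k)) = extendModes ι k (u (carGen _ i)))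
    {x : CAR ι} {y : CAR (AddModes ι k)} (hxy : (y : FOp (AddModes ι k)) = extendModes ι k x) :
    (w y : FOp (AddModes ι k)) = extendModes ι k (u x) := by
  refine equiv_intertwine_of_mem_adjoin u w (extendHom ι k) rfl ?_ hxy
  intro x hx
  obtain ⟨i, _, h⟩ := hx
  have h' : x = carGen _ i := Subtype.ext h
  rw [h']
  exact ⟨carGen _ (oldMode i), (extendModes_annih i).symm, hw i⟩

theorem IsFQCA.trans_unitary {L L' : ℕ} {u u' : CAR (Mode N m) ≃⋆ₐ[ℂ] CAR (Mode N m)}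
    (hu : IsFQCA N m L u) (hu' : IsFQCA N m L' u') (hfin : Finite (Site N)) :
    ∃ U : CAR (Mode N m), (star U * U = 1 ∧ U * star U = 1) ∧
      (∀ A : CAR (Mode N m), u' (u A) = star U * A * U) ∧
      (∀ v : Site N, (U : FOp (Mode N m)) * fTrans N m v = fTrans N m v * (U : FOp (Mode N m))) ∧
      ∀ (k : ℕ) (j : Fin k),
        extendModes (Mode N m) k (U : FOp (Mode N m)) * annih _ (newMode j)
          = annih _ (newMode j) * extendModes (Mode N m) k (U : FOp (Mode N m)) := by
  have h := hu.unitary hfin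
  have h' := hu'.unitary hfin
  obtain ⟨U, hU, h3, h4, h5⟩ := h
  obtain ⟨U', hU', h3', h4', h5'⟩ := h'
  refine ⟨U * U', unitary_mul hU hU', fun A => conj_comp (u := u) (u' := u') h3 h3' A, fun v => Commute.mul_left (h4 v) (h4' v),
    fun k j => ?_⟩
  have e : extendModes (Mode N m) k ((U * U' : CAR (Mode N m)) : FOp (Mode N m))
      = extendModes (Mode N m) k U * extendModes (Mode N m) k U' :=
    map_mul (extendHom (Mode N m) k) _ _
  rw [e]
  exact Commute.mul_left (h5 k j) (h5' k j)

theorem IsFQCA.trans_ancilla {L L' : ℕ} {u u' : CAR (Mode N m) ≃⋆ₐ[ℂ] CAR (Mode N m)}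
    (hu : IsFQCA N m L u) (hu' : IsFQCA N m L' u') (k : ℕ) :
    ∃ w : CAR (AddModes (Mode N m) k) ≃⋆ₐ[ℂ] CAR (AddModes (Mode N m) k),
      (∀ i : Mode N m, (w (carGen _ (oldMode i)) : FOp (AddModes (Mode N m) k))
        = extendModes (Mode N m) k (u' (u (carGen _ i)) : FOp (Mode N m))) ∧
      ∀ j : Fin k, w (carGen _ (newMode j)) = carGen _ (newMode j) := by
  have h := hu.ancilla k
  have h' := hu'.ancilla k
  obtain ⟨w, h1, h2⟩ := h
  obtain ⟨w', h1', h2'⟩ := h'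
  refine ⟨w.trans w', fun i => extend_intertwine h1' (h1 i), fun j => ?_⟩
  exact (congrArg w' (h2 j)).trans (h2' j)

theorem IsFQCA.trans {L L' : ℕ} {u u' : CAR (Mode N m) ≃⋆ₐ[ℂ] CAR (Mode N m)}
    (hu : IsFQCA N m L u) (hu' : IsFQCA N m L' u') : IsFQCA N m (L + L') (u.trans u') where
  causal n i := hu'.map_mem (A := u (carGen _ (mode n i)))
    (fun _ hm => siteBall_subset hm (Nat.add_comm L' L).le) (hu.causal n i)
  translation v n i :=
    (hu'.map_shift v (x := u (carGen _ (mode n i))) (y := u (carGen _ (mode (n + v) i)))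
      ((hu.translation v n i).trans (permConj_apply _ _).symm)).trans (permConj_apply _ _)
  ancilla k := hu.trans_ancilla hu' k
  unitary hfin := hu.trans_unitary hu' hfin

end FQCA

end

noncomputable section

/-! ## Simulation by operators that agree on a subspace -/

section Rel

variable {E F I : Type*} [NormedAddCommGroup E] [InnerProductSpace ℂ E] [CompleteSpace E]
  [NormedAddCommGroup F] [InnerProductSpace ℂ F] [CompleteSpace F]

/-- The operator `y` acts as `z` on the ranges of almost all `V i`, and so do their adjoints. -/
def ActsAs (l : Filter I) (V : I → F →L[ℂ] E) (y : E →L[ℂ] E) (z : F →L[ℂ] F) : Prop :=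
  ∀ᶠ i in l, y ∘L V i = V i ∘L z ∧ star y ∘L V i = V i ∘L star z

variable {l : Filter I} {V : I → F →L[ℂ] E} {y y' : E →L[ℂ] E} {z z' : F →L[ℂ] F}

namespace ActsAs

theorem algebraMap (c : ℂ) : ActsAs l V (algebraMap ℂ _ c) (algebraMap ℂ _ c) :=
  Filter.Eventually.of_forall fun i => by
    rw [← algebraMap_star_comm, ← algebraMap_star_comm]
    simp only [Algebra.algebraMap_eq_smul_one]
    constructor <;> ext ψ <;> simp

theorem one : ActsAs l V 1 1 := by simpa using algebraMap (l := l) (V := V) 1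

theorem zero : ActsAs l V 0 0 := by simpa using algebraMap (l := l) (V := V) 0

theorem add (h : ActsAs l V y z) (h' : ActsAs l V y' z') : ActsAs l V (y + y') (z + z') := by
  filter_upwards [h, h'] with i h h'
  rw [star_add, star_add, ContinuousLinearMap.add_comp, ContinuousLinearMap.add_comp,
    ContinuousLinearMap.comp_add, ContinuousLinearMap.comp_add, h.1, h.2, h'.1, h'.2]
  exact ⟨rfl, rfl⟩

theorem neg (h : ActsAs l V y z) : ActsAs l V (-y) (-z) := by
  filter_upwards [h] with i h
  rw [star_neg, star_neg, ContinuousLinearMap.neg_comp, ContinuousLinearMap.neg_comp,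
    ContinuousLinearMap.comp_neg, ContinuousLinearMap.comp_neg, h.1, h.2]
  exact ⟨rfl, rfl⟩

theorem sub (h : ActsAs l V y z) (h' : ActsAs l V y' z') : ActsAs l V (y - y') (z - z') := by
  rw [sub_eq_add_neg, sub_eq_add_neg]
  exact h.add h'.neg

theorem star_star (h : ActsAs l V y z) : ActsAs l V (star y) (star z) := by
  filter_upwards [h] with i h
  rw [_root_.star_star, _root_.star_star]
  exact h.symm

theorem mul (h : ActsAs l V y z) (h' : ActsAs l V y' z') : ActsAs l V (y * y') (z * z') := by
  filter_upwards [h, h'] with i h h'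
  rw [star_mul, star_mul]
  have key : ∀ {a b : E →L[ℂ] E} {c e : F →L[ℂ] F}, a ∘L V i = V i ∘L c → b ∘L V i = V i ∘L e →
      (a * b) ∘L V i = V i ∘L (c * e) := fun {a b c e} h1 h2 => by
    change (a ∘L b) ∘L V i = V i ∘L (c ∘L e)
    rw [ContinuousLinearMap.comp_assoc, h2, ← ContinuousLinearMap.comp_assoc, h1,
      ContinuousLinearMap.comp_assoc]
  exact ⟨key h.1 h'.1, key h'.2 h.2⟩

theorem gateProd {J : Type*} {G : J → E →L[ℂ] E} {T : J → F →L[ℂ] F} (hG hT)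
    (h : ∀ j, ActsAs l V (G j) (T j)) (s : Finset J) :
    ActsAs l V (gateProd G hG s) (gateProd T hT s) := by
  classical
  induction s using Finset.induction with
  | empty => exact one
  | insert j s hj ih =>
    rw [gateProd_insert _ hj, gateProd_insert _ hj]
    exact (h j).mul ih

end ActsAs

variable {d : ℕ} {N : Fin d → ℕ} {X : Type} [Ring X] [Algebra ℂ X] [StarRing X] [StarModule ℂ X]

/-- The algebra of the simulation is the set of observables `y` that act as `ι x` for an observable
`x`, and its homomorphism is `y ↦ x`; this is well defined by `faithful`. Invariance forwards and
backwards in time is the equivalence in `step`. -/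
theorem simulates_of_actsAs {E : Type} [NormedAddCommGroup E] [InnerProductSpace ℂ E]
    [CompleteSpace E] {V : I → F →L[ℂ] E}
    {𝒴 : StarSubalgebra ℂ (E →L[ℂ] E)} {obsY : Set (Site N) → StarSubalgebra ℂ (E →L[ℂ] E)}
    (hmonoY : ∀ S, obsY S ≤ obsY Set.univ) {w : 𝒴 ≃⋆ₐ[ℂ] 𝒴}
    (hw : ∀ y, (w y : E →L[ℂ] E) ∈ obsY Set.univ ↔ (y : E →L[ℂ] E) ∈ obsY Set.univ)
    {𝒳 : StarSubalgebra ℂ X} {obsX : Set (Site N) → StarSubalgebra ℂ X}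
    (hmonoX : ∀ S, obsX S ≤ obsX Set.univ) {u : 𝒳 ≃⋆ₐ[ℂ] 𝒳}
    (hu : ∀ x, (u x : X) ∈ obsX Set.univ ↔ (x : X) ∈ obsX Set.univ) (ι : X →⋆ₐ[ℂ] (F →L[ℂ] F))
    (faithful : ∀ x ∈ 𝒳, ActsAs l V 0 (ι x) → x = 0)
    (step : ∀ (y : 𝒴) (x : 𝒳), ActsAs l V y (ι x) ↔ ActsAs l V (w y) (ι (u x)))
    (lift : ∀ (n : Site N) (r : ℕ) (x : 𝒳), (x : X) ∈ obsX (siteBall n r) →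
      ∃ y : 𝒴, (y : E →L[ℂ] E) ∈ obsY (siteBall n r) ∧ ActsAs l V y (ι x)) :
    Simulates 𝒴 obsY w 𝒳 obsX u := by
  have uniq : ∀ (y : E →L[ℂ] E) (x x' : 𝒳), ActsAs l V y (ι x) → ActsAs l V y (ι x') → x = x' := by
    intro y x x' h h'
    have := h.sub h'
    rw [sub_self, ← map_sub] at this
    exact Subtype.ext (sub_eq_zero.1 (faithful _ (sub_mem x.2 x'.2) this))
  let B : StarSubalgebra ℂ 𝒴 :=
    { carrier := {y | (y : E →L[ℂ] E) ∈ obsY Set.univ ∧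
        ∃ x : 𝒳, (x : X) ∈ obsX Set.univ ∧ ActsAs l V (y : E →L[ℂ] E) (ι x)}
      mul_mem' := fun ⟨h, x, hx, hr⟩ ⟨h', x', hx', hr'⟩ => ⟨mul_mem h h', x * x', mul_mem hx hx', by
        have := hr.mul hr'
        rwa [← map_mul] at this⟩
      add_mem' := fun ⟨h, x, hx, hr⟩ ⟨h', x', hx', hr'⟩ => ⟨add_mem h h', x + x', add_mem hx hx', by
        have := hr.add hr'
        rwa [← map_add] at this⟩
      algebraMap_mem' := fun c => ⟨algebraMap_mem (obsY Set.univ) c, algebraMap ℂ _ c,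
        algebraMap_mem (obsX Set.univ) c, by
        have := ActsAs.algebraMap (l := l) (V := V) c
        rw [← AlgHomClass.commutes ι] at this
        exact this⟩
      star_mem' := fun ⟨h, x, hx, hr⟩ => ⟨star_mem h, star x, star_mem hx, by
        have := hr.star_star
        rwa [← map_star] at this⟩ }
  have hB : ∀ b : B, ∃ x : 𝒳, (x : X) ∈ obsX Set.univ ∧ ActsAs l V ((b : 𝒴) : E →L[ℂ] E) (ι x) :=
    fun b => b.2.2
  choose q hq hqr using hB
  have hqu : ∀ (b : B) (x : 𝒳), ActsAs l V ((b : 𝒴) : E →L[ℂ] E) (ι x) → q b = x := fun b x h =>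
    uniq _ _ _ (hqr b) h
  let qh : B →⋆ₐ[ℂ] 𝒳 :=
    { toFun := q
      map_one' := hqu _ _ (by
        have := ActsAs.one (l := l) (V := V)
        rwa [← map_one ι] at this)
      map_zero' := hqu _ _ (by
        have := ActsAs.zero (l := l) (V := V)
        rwa [← map_zero ι] at this)
      map_mul' := fun a b => hqu _ _ (by
        have := (hqr a).mul (hqr b)
        rwa [← map_mul] at this)
      map_add' := fun a b => hqu _ _ (by
        have := (hqr a).add (hqr b)
        rwa [← map_add] at this)
      commutes' := fun c => hqu _ _ (by
        have := ActsAs.algebraMap (l := l) (V := V) c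
        rw [← AlgHomClass.commutes ι] at this
        exact this)
      map_star' := fun a => hqu _ _ (by
        have := (hqr a).star_star
        rwa [← map_star] at this) }
  refine ⟨B, qh, fun b => ⟨b.2.1, hq b⟩, fun y => ⟨?_, ?_⟩, fun b b' hbb' => ?_, fun n r x hx => ?_⟩
  · rintro ⟨h, x, hx, hr⟩
    refine ⟨(hw y).1 h, u.symm x, ?_, ?_⟩
    · rw [← hu, StarAlgEquiv.apply_symm_apply]
      exact hx
    · rw [step, StarAlgEquiv.apply_symm_apply]
      exact hr
  · rintro ⟨h, x, hx, hr⟩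
    exact ⟨(hw y).2 h, u x, (hu x).2 hx, (step y x).1 hr⟩
  · refine hqu b' _ ?_
    rw [hbb']
    exact (step _ _).1 (hqr b)
  · obtain ⟨y, hy, hr⟩ := lift n r x hx
    have hyB : y ∈ B := ⟨hmonoY _ hy, x, hmonoX _ hx, hr⟩
    exact ⟨⟨y, hyB⟩, hy, hqu ⟨y, hyB⟩ x hr⟩

/-- Gates that act as operators `T` with product `T_s`, where conjugation with `T_s` exchanges `z`
and `z'` for large finite sets `s`. -/
theorem IsGateLayer.actsAs_aut {tot : StarSubalgebra ℂ (E →L[ℂ] E)}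
    {loc obs : Set (Site N) → StarSubalgebra ℂ (E →L[ℂ] E)} (net : IsLocalNet tot loc obs)
    {κ : Type} [Finite κ] {r : ℕ} {G : Site N × κ → E →L[ℂ] E} (h : IsGateLayer obs r G)
    {T : Site N × κ → F →L[ℂ] F} (hT) (hGT : ∀ j, ActsAs l V (G j) (T j))
    (hz : ∀ᶠ s in Filter.atTop, gateProd T hT s * z * gateProd T hT s = z') {y : tot}
    (hy : ActsAs l V y z) : ActsAs l V (h.aut net y) z' := by
  obtain ⟨s, h1, h2⟩ := (hz.and (h.eventually_aut_eq net y)).exists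
  rw [h2, ← h1]
  have hs := ActsAs.gateProd h.comm hT hGT s
  exact (hs.mul hy).mul hs

/-- Two layers of gates that exchange two copies `ι₁` and `ι₂` of a system, up to the evolution `u`,
simulate `u`. -/
theorem simulates_of_swaps {E : Type} [NormedAddCommGroup E] [InnerProductSpace ℂ E]
    [CompleteSpace E] {V : I → F →L[ℂ] E} {tot : StarSubalgebra ℂ (E →L[ℂ] E)}
    {loc obsY : Set (Site N) → StarSubalgebra ℂ (E →L[ℂ] E)} (net : IsLocalNet tot loc obsY)
    {κ : Type} [Finite κ] {r r' : ℕ} {G G' : Site N × κ → E →L[ℂ] E} (h : IsGateLayer obsY r G)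
    (h' : IsGateLayer obsY r' G') {T T' : Site N × κ → F →L[ℂ] F} (hT hT')
    (hsq : ∀ j, T j * T j = 1) (hsq' : ∀ j, T' j * T' j = 1)
    (hGT : ∀ j, ActsAs l V (G j) (T j)) (hGT' : ∀ j, ActsAs l V (G' j) (T' j))
    {𝒳 : StarSubalgebra ℂ X} {obsX : Set (Site N) → StarSubalgebra ℂ X}
    (hmonoX : ∀ S, obsX S ≤ obsX Set.univ) {u : 𝒳 ≃⋆ₐ[ℂ] 𝒳}
    (hu : ∀ x, (u x : X) ∈ obsX Set.univ ↔ (x : X) ∈ obsX Set.univ)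
    (ι₁ ι₂ : X →⋆ₐ[ℂ] (F →L[ℂ] F))
    (hswap : ∀ x : 𝒳, ∀ᶠ s in Filter.atTop, gateProd T hT s * ι₁ x * gateProd T hT s = ι₂ x)
    (hswap' : ∀ x : 𝒳, ∀ᶠ s in Filter.atTop,
      gateProd T' hT' s * ι₁ (u x) * gateProd T' hT' s = ι₂ x)
    (faithful : ∀ x ∈ 𝒳, ActsAs l V 0 (ι₁ x) → x = 0)
    (lift : ∀ (n : Site N) (r : ℕ) (x : 𝒳), (x : X) ∈ obsX (siteBall n r) →
      ∃ y : tot, (y : E →L[ℂ] E) ∈ obsY (siteBall n r) ∧ ActsAs l V y (ι₁ x)) :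
    Simulates tot obsY ((h.aut net).trans (h'.aut net)) 𝒳 obsX u := by
  have conj_symm : ∀ {T : Site N × κ → F →L[ℂ] F} (hT), (∀ j, T j * T j = 1) → ∀ {z z'},
      (∀ᶠ s in Filter.atTop, gateProd T hT s * z * gateProd T hT s = z') →
      ∀ᶠ s in Filter.atTop, gateProd T hT s * z' * gateProd T hT s = z := by
    intro T hT hsq z z' hz
    filter_upwards [hz] with s hs
    have := gateProd_sq hT hsq s
    rw [← hs]
    calc _ = (gateProd T hT s * gateProd T hT s) * z * (gateProd T hT s * gateProd T hT s) := by
          noncomm_ring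
      _ = z := by rw [this, one_mul, mul_one]
  have obs_aut : ∀ {r : ℕ} {G : Site N × κ → E →L[ℂ] E} (h : IsGateLayer obsY r G) (y : tot),
      (h.aut net y : E →L[ℂ] E) ∈ obsY Set.univ ↔ (y : E →L[ℂ] E) ∈ obsY Set.univ := by
    intro r G h y
    have key : ∀ y : tot, (y : E →L[ℂ] E) ∈ obsY Set.univ →
        (h.aut net y : E →L[ℂ] E) ∈ obsY Set.univ := fun y hy =>
      h.aut_mem_obs net (V := Set.univ) (fun n _ => Set.subset_univ _) hy
    refine ⟨fun hy => ?_, key y⟩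
    rw [← h.aut_aut net y]
    exact key _ hy
  have hw : ∀ y : tot, (h'.aut net (h.aut net y) : E →L[ℂ] E) ∈ obsY Set.univ
      ↔ (y : E →L[ℂ] E) ∈ obsY Set.univ := fun y =>
    (obs_aut h' (h.aut net y)).trans (obs_aut h y)
  -- On the subspace the first layer takes `ι₁ x` to `ι₂ x`, and the second takes this to `ι₁ (u
  -- x)`. Both layers are involutions, which gives the converse.
  have step : ∀ (y : tot) (x : 𝒳), ActsAs l V y (ι₁ x)
      ↔ ActsAs l V (h'.aut net (h.aut net y)) (ι₁ (u x)) := fun y x => by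
    refine ⟨fun hr => ?_, fun hr => ?_⟩
    · exact h'.actsAs_aut net hT' hGT' (conj_symm hT' hsq' (hswap' x))
        (h.actsAs_aut net hT hGT (hswap x) hr)
    · have h1 := h'.actsAs_aut net hT' hGT' (hswap' x) hr
      rw [h'.aut_aut net] at h1
      have h3 := h.actsAs_aut net hT hGT (conj_symm hT hsq (hswap x)) h1
      rwa [h.aut_aut net] at h3
  exact simulates_of_actsAs (w := (h.aut net).trans (h'.aut net))
    (fun S => net.obs_mono (Set.subset_univ S)) hw hmonoX hu ι₁ faithful step lift

end Rel

end

noncomputable section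

/-! ## Exchanging two copies of fermionic modes -/

section Swap

variable {R J : Type*} [Ring R] [StarRing R]

/-- Two commuting copies `A` and `b` of fermionic annihilation operators. -/
structure IsCARPair (A b : J → R) : Prop where
  aa : ∀ x y, A x * A y = -(A y * A x)
  bb : ∀ x y, b x * b y = -(b y * b x)
  ab : ∀ x y, A x * b y = -(b y * A x)
  aas : ∀ x y, x ≠ y → A x * star (A y) = -(star (A y) * A x)
  bbs : ∀ x y, x ≠ y → b x * star (b y) = -(star (b y) * b x)
  abs : ∀ x y, A x * star (b y) = -(star (b y) * A x)
  aa_self : ∀ x, A x * star (A x) = 1 - star (A x) * A x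
  bb_self : ∀ x, b x * star (b x) = 1 - star (b x) * b x

namespace IsCARPair

/-- The even operator that exchanges `A x` and `b x` is `1 - swapGen A b x`. -/
def _root_.swapGen (A b : J → R) (x : J) : R := star (A x - b x) * (A x - b x)

variable {A b : J → R} (h : IsCARPair A b)
include h

theorem bas (x y : J) : b x * star (A y) = -(star (A y) * b x) := by
  have := congrArg star (h.abs y x)
  simpa [star_mul] using this

/-- The differences f = A - b satisfy the anticommutation relations up to normalisation: f f† + f† f
= 2, since the two copies contribute equally. So f/√2 is a fermionic mode. -/
theorem ff (x y : J) : (A x - b x) * (A y - b y) = -((A y - b y) * (A x - b x)) := by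
  have e : b x * A y = -(A y * b x) := by rw [h.ab, neg_neg]
  rw [sub_mul, mul_sub, mul_sub, h.aa x y, h.ab x y, e, h.bb x y]
  noncomm_ring

theorem ffs {x y : J} (hxy : x ≠ y) :
    (A x - b x) * star (A y - b y) = -(star (A y - b y) * (A x - b x)) := by
  rw [star_sub, sub_mul, mul_sub, mul_sub, h.aas x y hxy, h.abs x y, h.bas x y, h.bbs x y hxy]
  noncomm_ring

theorem ffs_self (x : J) :
    (A x - b x) * star (A x - b x) = 2 - star (A x - b x) * (A x - b x) := by
  rw [star_sub, sub_mul, mul_sub, mul_sub, h.aa_self x, h.abs x x, h.bas x x, h.bb_self x,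
    ← one_add_one_eq_two]
  noncomm_ring

theorem fA (x y : J) : (A x - b x) * A y = -(A y * (A x - b x)) := by
  have e : b x * A y = -(A y * b x) := by rw [h.ab, neg_neg]
  rw [sub_mul, h.aa x y, e]
  noncomm_ring

theorem fsA {x y : J} (hxy : x ≠ y) : star (A x - b x) * A y = -(A y * star (A x - b x)) := by
  rw [star_sub, mul_sub, h.aas y x hxy.symm, h.abs y x]
  noncomm_ring

theorem fsA_self (x : J) : star (A x - b x) * A x = 1 - A x * star (A x - b x) := by
  rw [star_sub, mul_sub, h.aa_self x, h.abs x x]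
  noncomm_ring

theorem ff_zero [IsAddTorsionFree R] (x : J) : (A x - b x) * (A x - b x) = 0 := by
  have := h.ff x x
  rwa [self_eq_neg] at this

omit h in
theorem star_swapGen (x : J) : star (swapGen A b x) = swapGen A b x := by
  rw [swapGen, star_mul, star_star]

theorem swapGen_sq [IsAddTorsionFree R] (x : J) :
    swapGen A b x * swapGen A b x = 2 * swapGen A b x := by
  have h0 := h.ff_zero x
  have h1 := h.ffs_self x
  rw [swapGen]
  generalize A x - b x = f at h0 h1
  calc star f * f * (star f * f) = star f * (f * star f) * f := by noncomm_ring
    _ = 2 * (star f * f) - star f * star f * (f * f) := by rw [h1]; noncomm_ring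
    _ = 2 * (star f * f) := by rw [h0]; noncomm_ring

theorem swap_sq [IsAddTorsionFree R] (x : J) :
    (1 - swapGen A b x) * (1 - swapGen A b x) = 1 := by
  have := h.swapGen_sq x
  generalize swapGen A b x = t at this
  calc (1 - t) * (1 - t) = 1 - 2 * t + t * t := by noncomm_ring
    _ = 1 := by rw [this]; noncomm_ring

theorem swapGen_commute_A {x y : J} (hxy : x ≠ y) : Commute (swapGen A b x) (A y) := by
  have h0 := h.fA x y
  have h1 := h.fsA hxy
  rw [swapGen]
  generalize A x - b x = f at h0 h1
  change star f * f * A y = A y * (star f * f)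
  calc star f * f * A y = star f * (f * A y) := by noncomm_ring
    _ = -(star f * A y) * f := by rw [h0]; noncomm_ring
    _ = A y * (star f * f) := by rw [h1]; noncomm_ring

theorem swapGen_commute (x y : J) : Commute (swapGen A b x) (swapGen A b y) := by
  by_cases hxy : x = y
  · subst hxy; exact Commute.refl _
  have h0 := h.ff x y
  have h1 := h.ffs hxy
  have h2 := h.ffs (Ne.symm hxy)
  have h3 := congrArg star h0
  simp only [star_neg, star_mul] at h3
  rw [swapGen, swapGen]
  generalize A x - b x = f at *
  generalize A y - b y = g at *
  have e1 : f * (star g * g) = star g * g * f := by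
    calc f * (star g * g) = f * star g * g := by noncomm_ring
      _ = -(star g * (f * g)) := by rw [h1]; noncomm_ring
      _ = _ := by rw [h0]; noncomm_ring
  have e2 : star f * (star g * g) = star g * g * star f := by
    calc star f * (star g * g) = star f * star g * g := by noncomm_ring
      _ = -(star g * (star f * g)) := by
          rw [show star f * star g = -(star g * star f) by rw [h3, neg_neg]]; noncomm_ring
      _ = _ := by
          rw [show star f * g = -(g * star f) by rw [h2, neg_neg]]; noncomm_ring
  change star f * f * (star g * g) = star g * g * (star f * f)
  rw [mul_assoc, e1, ← mul_assoc, e2, mul_assoc]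

/-- Since `swapGen` is twice the number operator of the mode f/√2, `1 - swapGen` is its parity.
Conjugation with it reverses f = A - b and fixes A + b, so it exchanges A and b. In the computation
this appears as the commutator of `swapGen` with A, which is -f. -/
theorem swap_conj [IsAddTorsionFree R] (x : J) :
    (1 - swapGen A b x) * A x * (1 - swapGen A b x) = b x := by
  have h0 := h.ff_zero x
  have h1 := h.ffs_self x
  have h2 := h.fA x x
  have h3 := h.fsA_self x
  have h4 := h.swap_sq x
  have hb : b x = A x - (A x - b x) := by abel
  rw [hb]
  rw [swapGen] at h4 ⊢
  generalize A x - b x = f at *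
  have e1 : star f * f * A x = A x * (star f * f) - f := by
    calc star f * f * A x = star f * (f * A x) := by noncomm_ring
      _ = -(star f * A x) * f := by rw [h2]; noncomm_ring
      _ = _ := by rw [h3]; noncomm_ring
  have e2 : f * (star f * f) = 2 * f := by
    calc f * (star f * f) = f * star f * f := by noncomm_ring
      _ = 2 * f - star f * (f * f) := by rw [h1]; noncomm_ring
      _ = 2 * f := by rw [h0]; noncomm_ring
  calc (1 - star f * f) * A x * (1 - star f * f)
      = (A x - star f * f * A x) * (1 - star f * f) := by noncomm_ring
    _ = A x * ((1 - star f * f) * (1 - star f * f)) + f - f * (star f * f) := by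
        rw [e1]; noncomm_ring
    _ = A x - f := by rw [h4, e2]; noncomm_ring

end IsCARPair

end Swap

/-! ### Conjugation by large finite products of gates. -/

section EventuallyConj

variable {A B J : Type*} [Ring A] [Algebra ℂ A] [StarRing A] [StarModule ℂ A]
  [Ring B] [Algebra ℂ B] [StarRing B] [StarModule ℂ B] {S : StarSubalgebra ℂ A} {s : Set A}

/-- If conjugation with large products of gates maps `f₁ a` to `f₂ a` for generators `a`, then for
all elements. -/
theorem eventually_conj_of_mem_adjoin (hS : S = StarAlgebra.adjoin ℂ s) (f₁ f₂ : S →⋆ₐ[ℂ] B)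
    {T : J → B} (hT) (hself : ∀ i, star (T i) = T i) (hsq : ∀ i, T i * T i = 1)
    (h : ∀ x : S, (x : A) ∈ s → ∀ᶠ F in Filter.atTop,
      gateProd T hT F * f₁ x * gateProd T hT F = f₂ x) (x : S) :
    ∀ᶠ F in Filter.atTop, gateProd T hT F * f₁ x * gateProd T hT F = f₂ x := by
  subst hS
  let E : StarSubalgebra ℂ (StarAlgebra.adjoin ℂ s) :=
    { carrier := {x | ∀ᶠ F in Filter.atTop, gateProd T hT F * f₁ x * gateProd T hT F = f₂ x}
      mul_mem' := fun {a b} ha hb => by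
        filter_upwards [ha, hb] with F ha hb
        rw [map_mul, map_mul, ← ha, ← hb]
        have := gateProd_sq hT hsq F
        generalize gateProd T hT F = g at this
        calc g * (f₁ a * f₁ b) * g = g * f₁ a * 1 * f₁ b * g := by noncomm_ring
          _ = _ := by rw [← this]; noncomm_ring
      add_mem' := fun {a b} ha hb => by
        filter_upwards [ha, hb] with F ha hb
        rw [map_add, map_add, ← ha, ← hb]
        noncomm_ring
      algebraMap_mem' := fun c => Filter.Eventually.of_forall fun F => by
        rw [AlgHomClass.commutes, AlgHomClass.commutes, ← Algebra.commutes, mul_assoc,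
          gateProd_sq hT hsq, mul_one]
      star_mem' := fun {a} ha => by
        filter_upwards [ha] with F ha
        rw [map_star, map_star, ← ha, star_mul, star_mul, star_gateProd hT hself, mul_assoc] }
  have : StarAlgebra.adjoin ℂ s ≤ E.map (StarAlgebra.adjoin ℂ s).subtype :=
    StarAlgebra.adjoin_le fun a ha => ⟨⟨a, StarAlgebra.subset_adjoin ℂ s ha⟩, h _ ha, rfl⟩
  obtain ⟨y, hy, hyx⟩ := this x.2
  rw [← Subtype.ext hyx]
  exact hy

/-- Conjugation with a product of gates of which only `T i` does not commute with `a`. -/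
theorem gateProd_conj_eq {T : J → B} (hT) (hsq : ∀ i, T i * T i = 1) {i : J} {a : B}
    (ha : ∀ j, j ≠ i → Commute (T j) a) {F : Finset J} (hi : i ∈ F) :
    gateProd T hT F * a * gateProd T hT F = T i * a * T i := by
  classical
  rw [← Finset.insert_erase hi, gateProd_insert _ (Finset.notMem_erase i F)]
  have h1 : Commute a (gateProd T hT (F.erase i)) :=
    gateProd_commute _ _ fun j hj => (ha j (Finset.ne_of_mem_erase hj)).symm
  have h2 : Commute (T i) (gateProd T hT (F.erase i)) := gateProd_commute _ _ fun j _ => hT i j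
  have h3 := gateProd_sq hT hsq (F.erase i)
  generalize gateProd T hT (F.erase i) = g at *
  rw [h2.eq]
  calc g * T i * a * (g * T i) = g * T i * (a * g) * T i := by noncomm_ring
    _ = g * (T i * g) * a * T i := by rw [h1.eq]; noncomm_ring
    _ = g * g * (T i * a * T i) := by rw [h2.eq]; noncomm_ring
    _ = T i * a * T i := by rw [h3, one_mul]

end EventuallyConj

/-! ## Even operators and fermionic evolutions -/

section Parity

variable {ι : Type} [LinearOrder ι]

theorem majorana_sq (i : ι) :
    (annih ι i + star (annih ι i)) * (annih ι i + star (annih ι i)) = 1 := by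
  have h1 := annih_mul_self i
  have h2 := congrArg star h1
  have h3 := annih_anticomm_self i
  rw [star_mul, star_zero] at h2
  rw [add_mul, mul_add, mul_add, h1, h2, zero_add, add_zero, h3]

theorem signConj_majorana (ε : ι → ℤˣ) (i : ι) : signConj ε (annih ι i + star (annih ι i))
    = signC (ε i) • (annih ι i + star (annih ι i)) := by
  rw [map_add, map_star, signConj_annih, star_smul, star_signC, smul_add]

theorem majorana_mul_annih_mem {K : Set ι} {i j : ι} (hi : i ∈ K) (hj : j ∈ K) :
    (annih ι i + star (annih ι i)) * annih ι j ∈ carEven ι K := by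
  rw [add_mul]
  exact add_mem (StarAlgebra.subset_adjoin ℂ _ ⟨i, hi, j, hj, Or.inl rfl⟩)
    (StarAlgebra.subset_adjoin ℂ _ ⟨i, hi, j, hj, Or.inr (Or.inr rfl)⟩)

theorem annih_mul_majorana_mem {K : Set ι} {i j : ι} (hi : i ∈ K) (hj : j ∈ K) :
    annih ι j * (annih ι i + star (annih ι i)) ∈ carEven ι K := by
  rw [mul_add]
  exact add_mem (StarAlgebra.subset_adjoin ℂ _ ⟨j, hj, i, hi, Or.inl rfl⟩)
    (StarAlgebra.subset_adjoin ℂ _ ⟨j, hj, i, hi, Or.inr (Or.inl rfl)⟩)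

/-- Every operator is the sum of an even one and an even one times a fixed odd one. -/
theorem exists_even_add_even_mul {K : Set ι} {i : ι} (hi : i ∈ K) {A : FOp ι}
    (hA : A ∈ carLocal ι K) : ∃ E ∈ carEven ι K, ∃ E' ∈ carEven ι K,
      A = E + E' * (annih ι i + star (annih ι i)) := by
  have hcc := majorana_sq i
  have hc : star (annih ι i + star (annih ι i)) = annih ι i + star (annih ι i) := by
    rw [star_add, star_star, add_comm]
  have hconj : ∀ E ∈ carEven ι K, (annih ι i + star (annih ι i)) * E
      * (annih ι i + star (annih ι i)) ∈ carEven ι K := by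
    intro E hE
    have hu1 : (annih ι i + star (annih ι i)) * star (annih ι i + star (annih ι i)) = 1 := by
      rw [hc, hcc]
    have hu2 : star (annih ι i + star (annih ι i)) * (annih ι i + star (annih ι i)) = 1 := by
      rw [hc, hcc]
    have e : ∀ E, equivHom (conjHom _ hu1 hu2) E = (annih ι i + star (annih ι i)) * E
        * (annih ι i + star (annih ι i)) := fun E => by
      rw [equivHom_apply, conjHom_apply, hc]
    rw [← e]
    refine map_mem_of_mem_adjoin (equivHom (conjHom _ hu1 hu2)) ?_ hE
    intro a ha
    rw [e]
    -- For a generator x y, the bracketing c x y c = (c x)(y c), with c the Majorana operator of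
    -- `i`, shows two even factors.
    obtain ⟨j, hj, k, hk, ha⟩ := ha
    have h1 := majorana_mul_annih_mem hi hj
    have h2 := annih_mul_majorana_mem hi hk
    have h3 := star_mem (annih_mul_majorana_mem hi hj)
    have h4 := star_mem (majorana_mul_annih_mem hi hk)
    rw [star_mul, hc] at h3 h4
    rcases ha with rfl | rfl | rfl
    · have := mul_mem h1 h2
      simpa only [mul_assoc] using this
    · have := mul_mem h1 h4
      simpa only [mul_assoc] using this
    · have := mul_mem h3 h2
      simpa only [mul_assoc] using this
  have hcE : ∀ E ∈ carEven ι K, ∃ E' ∈ carEven ι K, (annih ι i + star (annih ι i)) * E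
      = E' * (annih ι i + star (annih ι i)) := fun E hE =>
    ⟨_, hconj E hE, by rw [mul_assoc _ _ (annih ι i + star (annih ι i)), hcc, mul_one]⟩
  generalize hcdef : annih ι i + star (annih ι i) = c at *
  induction hA using StarAlgebra.adjoin_induction with
  | mem a ha =>
    obtain ⟨j, hj, rfl⟩ := ha
    refine ⟨0, zero_mem _, annih ι j * c, ?_, by rw [mul_assoc, hcc, mul_one, zero_add]⟩
    rw [← hcdef]
    exact annih_mul_majorana_mem hi hj
  | algebraMap z => exact ⟨_, algebraMap_mem _ z, 0, zero_mem _, by rw [zero_mul, add_zero]⟩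
  | add a b _ _ ha hb =>
    obtain ⟨E, hE, E', hE', rfl⟩ := ha
    obtain ⟨F, hF, F', hF', rfl⟩ := hb
    exact ⟨_, add_mem hE hF, _, add_mem hE' hF', by noncomm_ring⟩
  | mul a b _ _ ha hb =>
    obtain ⟨E, hE, E', hE', rfl⟩ := ha
    obtain ⟨F, hF, F', hF', rfl⟩ := hb
    obtain ⟨F2, hF2, e2⟩ := hcE F hF
    obtain ⟨F3, hF3, e3⟩ := hcE F' hF'
    refine ⟨_, add_mem (mul_mem hE hF) (mul_mem hE' hF3), _,
      add_mem (mul_mem hE hF') (mul_mem hE' hF2), ?_⟩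
    calc (E + E' * c) * (F + F' * c)
        = E * F + E' * (c * F' * c) + (E * F' * c + E' * (c * F)) := by noncomm_ring
      _ = E * F + E' * (F3 * (c * c)) + (E * F' * c + E' * (F2 * c)) := by
          rw [e2, e3]; noncomm_ring
      _ = _ := by rw [hcc]; noncomm_ring
  | star a _ ha =>
    obtain ⟨E, hE, E', hE', rfl⟩ := ha
    obtain ⟨F, hF, e⟩ := hcE _ (star_mem hE')
    exact ⟨_, star_mem hE, F, hF, by rw [star_add, star_mul, hc, e]⟩

/-- In the decomposition E + E'c with c a Majorana operator, conjugation with the parity changes the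
sign of the second summand. If `K` is empty, there are only scalars. -/
theorem mem_carEven_iff {K : Set ι} {A : FOp ι} (hA : A ∈ carLocal ι K) :
    A ∈ carEven ι K ↔ signConj (-1) A = A := by
  refine ⟨signConj_carEven_neg_one, fun h => ?_⟩
  rcases K.eq_empty_or_nonempty with rfl | ⟨i, hi⟩
  · refine StarAlgebra.adjoin_mono ?_ hA
    rintro _ ⟨i, hi, -⟩
    exact hi.elim
  obtain ⟨E, hE, E', hE', e⟩ := exists_even_add_even_mul hi hA
  have h1 : signConj (-1) A = E - E' * (annih ι i + star (annih ι i)) := by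
    rw [e, map_add, map_mul, signConj_carEven_neg_one hE, signConj_carEven_neg_one hE',
      signConj_majorana, Pi.neg_apply, Pi.one_apply, signC_neg, signC_one, neg_one_smul, mul_neg,
      ← sub_eq_add_neg]
  have h2 : E' * (annih ι i + star (annih ι i)) = 0 := by
    rw [h, e] at h1
    have h3 : (2 : ℂ) • (E' * (annih ι i + star (annih ι i))) = 0 := by
      rw [two_smul]
      generalize E' * (annih ι i + star (annih ι i)) = t at h1
      calc t + t = (E + t) - E + t := by abel
        _ = (E - t) - E + t := by rw [h1]
        _ = 0 := by abel
    exact (smul_eq_zero.1 h3).resolve_left two_ne_zero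
  rw [e, h2, add_zero]
  exact hE

variable {d : ℕ} {N : Fin d → ℕ} {m : ℕ}

/-- With a the new annihilation operator, the even part Z of `A` (twice it, to be precise) satisfies
Z a = 0 by the hypothesis and commutes with a† by evenness. Inserting a a† + a† a = 1 gives Z = 0.
-/
theorem odd_of_anticommute_newMode {A : FOp ι}
    (h4 : extendModes ι 1 A * annih _ (newMode 0) = -(annih _ (newMode 0) * extendModes ι 1 A)) :
    signConj (-1) A = -A := by
  have h5 : annih _ (newMode 0) * extendModes ι 1 A
      = extendModes ι 1 (signConj (-1) A) * annih _ (newMode 0) := annih_newMode_mul A 0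
  let Z := A + signConj (-1) A
  have hZ : extendHom ι 1 Z * annih _ (newMode 0) = 0 := by
    rw [map_add, add_mul, extendHom_apply, extendHom_apply, ← h5, h4, neg_add_cancel]
  have hZs : extendHom ι 1 Z * star (annih _ (newMode 0))
      = star (annih _ (newMode 0)) * extendHom ι 1 Z := by
    have h6 : annih _ (newMode 0) * extendModes ι 1 (star Z)
      = extendModes ι 1 (signConj (-1) (star Z)) * annih _ (newMode 0) := annih_newMode_mul _ 0
    have h7 : signConj (-1) (star Z) = star Z := by
      rw [map_star, map_add, signConj_self, add_comm]
    rw [h7, ← extendHom_apply, map_star] at h6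
    have := congrArg star h6
    rwa [star_mul, star_mul, star_star] at this
  have h8 : extendHom ι 1 Z = 0 := by
    calc extendHom ι 1 Z
        = extendHom ι 1 Z * (annih _ (newMode 0) * star (annih _ (newMode 0))
          + star (annih _ (newMode 0)) * annih _ (newMode 0)) := by
          rw [annih_anticomm_self, mul_one]
      _ = extendHom ι 1 Z * annih _ (newMode 0) * star (annih _ (newMode 0))
          + star (annih _ (newMode 0)) * (extendHom ι 1 Z * annih _ (newMode 0)) := by
          rw [mul_add, ← mul_assoc, ← mul_assoc (extendHom ι 1 Z) (star _), hZs, mul_assoc (star _)]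
      _ = 0 := by rw [hZ, zero_mul, mul_zero, add_zero]
  have h9 : A + signConj (-1) A = 0 := extendModes_injective h8
  exact (neg_eq_of_add_eq_zero_right h9).symm

theorem map_anticommute {O : Type*} [Ring O] [Algebra ℂ O] [StarRing O] [StarModule ℂ O]
    {S : StarSubalgebra ℂ O} (w : S ≃⋆ₐ[ℂ] S) {x y : S} (h : (x : O) * y = -(y * x)) :
    (w x : O) * w y = -(w y * w x) := by
  have h1 : x * y = -(y * x) := Subtype.ext h
  have h2 := congrArg Subtype.val (congrArg w h1)
  rw [map_neg, map_mul, map_mul] at h2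
  exact h2

/-- A fermionic evolution maps annihilation operators to odd operators, since it extends to systems
with one more mode. -/
theorem IsFQCA.odd {L : ℕ} {u : CAR (Mode N m) ≃⋆ₐ[ℂ] CAR (Mode N m)} (hu : IsFQCA N m L u)
    (x : Mode N m) : signConj (-1) (u (carGen _ x) : FOp (Mode N m)) = -(u (carGen _ x)) := by
  have hw := hu.ancilla 1
  obtain ⟨w, h1, h2⟩ := hw
  have h3 := map_anticommute w (x := carGen _ (oldMode x)) (y := carGen _ (newMode 0))
    (annih_mul_annih _ _)
  rw [h2, h1] at h3
  exact odd_of_anticommute_newMode h3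

theorem IsFQCA.signConj_map {L : ℕ} {u : CAR (Mode N m) ≃⋆ₐ[ℂ] CAR (Mode N m)}
    (hu : IsFQCA N m L u) {x y : CAR (Mode N m)}
    (hxy : (y : FOp (Mode N m)) = signConj (-1) (x : FOp (Mode N m))) :
    (u y : FOp (Mode N m)) = signConj (-1) (u x : FOp (Mode N m)) := by
  refine equiv_intertwine_of_mem_adjoin u u (equivHom (signConj (-1))) rfl ?_ hxy
  intro x hx
  obtain ⟨i, _, h⟩ := hx
  have h' : x = carGen _ i := Subtype.ext h
  rw [h']
  refine ⟨-carGen _ i, ?_, ?_⟩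
  · rw [equivHom_apply]
    refine Eq.trans ?_ (signConj_annih _ _).symm
    rw [Pi.neg_apply, Pi.one_apply, signC_neg, signC_one, neg_one_smul]
    rfl
  · rw [map_neg, equivHom_apply, hu.odd]
    rfl

/-- The evolution commutes with conjugation by the parity, because it maps annihilation operators to
odd operators; fixed points correspond to fixed points. -/
theorem IsFQCA.map_mem_carEven_iff {L : ℕ} {u : CAR (Mode N m) ≃⋆ₐ[ℂ] CAR (Mode N m)}
    (hu : IsFQCA N m L u) (x : CAR (Mode N m)) :
    (u x : FOp (Mode N m)) ∈ carEven _ Set.univ ↔ (x : FOp (Mode N m)) ∈ carEven _ Set.univ := by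
  rw [mem_carEven_iff (u x).2, mem_carEven_iff x.2]
  constructor
  · intro h
    have hmem : signConj (-1) (x : FOp (Mode N m)) ∈ CAR (Mode N m) := signConj_mem _ x.2
    have h1 := hu.signConj_map (x := x) (y := ⟨_, hmem⟩) rfl
    rw [h] at h1
    exact congrArg Subtype.val (u.injective (Subtype.ext h1))
  · intro h
    exact (hu.signConj_map h.symm).symm

/-- With the identity in place of the evolution, the gates are the plain exchanges of the two
copies; this is the first layer of the circuit. -/
theorem IsFQCA.refl (N : Fin d → ℕ) (m : ℕ) : IsFQCA N m 0 (StarAlgEquiv.refl ℂ (CAR (Mode N m))) where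
  causal n i := annih_mem_carLocal (mem_siteBall_self n 0)
  translation v n i := ((permConj_annih (shiftModes N m v) (mode n i)).symm.trans
    (permConj_apply _ _))
  ancilla k := ⟨StarAlgEquiv.refl ℂ _, fun i => (extendModes_annih i).symm, fun _ => rfl⟩
  unitary _ := ⟨1, by simp, fun A => by simp, fun v => by simp, fun k j => by
    have : extendModes (Mode N m) k ((1 : CAR (Mode N m)) : FOp (Mode N m)) = 1 :=
      map_one (extendHom (Mode N m) k)
    rw [this, one_mul, mul_one]⟩

end Parity

end

noncomputable section

/-! ## Links between neighbouring sites -/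

/-- The Majorana operator of a mode. -/
def majorana {ι : Type} [LinearOrder ι] (i : ι) : FOp ι := annih ι i + star (annih ι i)

section Majorana

variable {ι : Type} [LinearOrder ι]

theorem star_majorana (i : ι) : star (majorana i) = majorana i := by
  rw [majorana, star_add, star_star, add_comm]

theorem majorana_mul_majorana {i j : ι} (h : i ≠ j) :
    majorana i * majorana j = -(majorana j * majorana i) := by
  have h1 := annih_mul_annih i j
  have h2 := annih_mul_star_annih h
  have h3 := annih_mul_star_annih h.symm
  have h4 := congrArg star h1
  rw [star_neg, star_mul, star_mul] at h4
  rw [majorana, majorana, add_mul, mul_add, mul_add, h1, h2,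
    show star (annih ι i) * annih ι j = -(annih ι j * star (annih ι i)) by rw [h3, neg_neg],
    show star (annih ι i) * star (annih ι j) = -(star (annih ι j) * star (annih ι i)) by
      rw [h4, neg_neg]]
  noncomm_ring

theorem permConj_majorana (σ : Equiv.Perm ι) (i : ι) :
    permConj σ (majorana i) = majorana (σ i) := by
  rw [majorana, map_add, map_star, permConj_annih, majorana]

theorem permConj_signConj (σ : Equiv.Perm ι) (ε : ι → ℤˣ) {A : FOp ι} (hA : A ∈ CAR ι) :
    permConj σ (signConj ε A) = signConj (fun i => ε (σ.symm i)) (permConj σ A) := by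
  refine eq_of_mem_adjoin ((equivHom (permConj σ)).comp (equivHom (signConj ε)))
    ((equivHom (signConj fun i => ε (σ.symm i))).comp (equivHom (permConj σ))) ?_ hA
  rintro _ ⟨i, -, rfl⟩
  change permConj σ (signConj ε (annih ι i))
    = signConj (fun i => ε (σ.symm i)) (permConj σ (annih ι i))
  rw [signConj_annih, permConj_annih, signConj_annih, map_smul, permConj_annih,
    Equiv.symm_apply_apply]

end Majorana

/-- Modes at a site that are reserved for the links in the positive and negative directions. -/
structure LinkModes (d M : ℕ) where
  pos : Fin d → Fin M
  neg : Fin d → Fin M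
  pos_inj : Function.Injective pos
  neg_inj : Function.Injective neg
  pos_ne_neg : ∀ i j, pos i ≠ neg j

section Links

variable {d M : ℕ} {N : Fin d → ℕ} (K : LinkModes d M)

namespace LinkModes

/-- The modes that are not used for links. -/
def matter (N : Fin d → ℕ) : Set (Mode N M) :=
  {x | ∀ j, (ofLex x).2 ≠ K.pos j ∧ (ofLex x).2 ≠ K.neg j}

/-- The mode of a link at its starting point. -/
def source (e : Site N × Fin d) : Mode N M := mode e.1 (K.pos e.2)

/-- The mode of a link at its end point. -/
def target (e : Site N × Fin d) : Mode N M := mode (e.1 + unitStep N e.2) (K.neg e.2)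

theorem source_ne_target (e f : Site N × Fin d) : K.source e ≠ K.target f := fun h =>
  K.pos_ne_neg _ _ (mode_inj.1 h).2

theorem source_inj {e f : Site N × Fin d} (h : K.source e = K.source f) : e = f :=
  Prod.ext (mode_inj.1 h).1 (K.pos_inj (mode_inj.1 h).2)

theorem target_inj {e f : Site N × Fin d} (h : K.target e = K.target f) : e = f := by
  obtain ⟨h1, h2⟩ := mode_inj.1 h
  have h3 := K.neg_inj h2
  rw [h3] at h1
  exact Prod.ext (add_right_cancel h1) h3

/-- The self-adjoint unitary of a link. -/
def link (e : Site N × Fin d) : FOp (Mode N M) :=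
  Complex.I • (majorana (K.source e) * majorana (K.target e))

theorem star_link (e : Site N × Fin d) : star (K.link e) = K.link e := by
  rw [link, star_smul, star_mul, star_majorana, star_majorana,
    majorana_mul_majorana (K.source_ne_target e e), smul_neg, Complex.star_def, Complex.conj_I,
    neg_smul]

theorem link_sq (e : Site N × Fin d) : K.link e * K.link e = 1 := by
  have h1 := majorana_mul_majorana (K.source_ne_target e e)
  have h2 : majorana (K.source e) * majorana (K.source e) = 1 := majorana_sq _
  have h3 : majorana (K.target e) * majorana (K.target e) = 1 := majorana_sq _
  rw [link, smul_mul_smul_comm, Complex.I_mul_I]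
  generalize majorana (K.source e) = a at *
  generalize majorana (K.target e) = b at *
  have : a * b * (a * b) = -1 := by
    calc a * b * (a * b) = a * b * -(b * a) := by rw [h1]
      _ = -(a * (b * b) * a) := by noncomm_ring
      _ = -1 := by rw [h3, mul_one, h2]
  rw [this, neg_smul, one_smul, neg_neg]

theorem link_mem (e : Site N × Fin d) : K.link e ∈ carEven _ {K.source e, K.target e} :=
  StarSubalgebra.smul_mem _ (majorana_mul_mem_carEven (Set.mem_insert _ _)
    (Set.mem_insert_of_mem _ (Set.mem_singleton _))) _

theorem link_commute (e f : Site N × Fin d) : Commute (K.link e) (K.link f) := by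
  by_cases h : e = f
  · rw [h]
  refine carEven_commute_carLocal ?_ (K.link_mem e) (carEven_le_carLocal _ (K.link_mem f))
  rw [Set.disjoint_left]
  rintro x (rfl | rfl) (hx | hx)
  · exact h (K.source_inj hx)
  · exact K.source_ne_target _ _ hx
  · exact K.source_ne_target _ _ hx.symm
  · exact h (K.target_inj hx)

theorem link_commute_matter (e : Site N × Fin d) {X : FOp (Mode N M)}
    (hX : X ∈ carLocal _ (K.matter N)) : Commute (K.link e) X := by
  refine carEven_commute_carLocal ?_ (K.link_mem e) hX
  rw [Set.disjoint_left]
  rintro x (rfl | rfl) hx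
  · exact (hx e.2).1 rfl
  · exact (hx e.2).2 rfl

/-- The sign that a link operator picks up from signs of the modes. -/
def linkSign (ε : Mode N M → ℤˣ) (e : Site N × Fin d) : ℤˣ := ε (K.source e) * ε (K.target e)

theorem signConj_link (ε : Mode N M → ℤˣ) (e : Site N × Fin d) :
    signConj ε (K.link e) = signC (K.linkSign ε e) • K.link e := by
  rw [link, map_smul, map_mul, majorana, majorana, signConj_majorana, signConj_majorana,
    smul_mul_smul_comm, smul_comm, linkSign, signC_mul]

/-- The projection onto the eigenspace of a link operator. -/
def linkFactor (χ : Site N × Fin d → ℤˣ) (e : Site N × Fin d) : FOp (Mode N M) :=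
  (2⁻¹ : ℂ) • (1 + signC (χ e) • K.link e)

theorem linkFactor_commute (χ ψ : Site N × Fin d → ℤˣ) (e f : Site N × Fin d) :
    Commute (K.linkFactor χ e) (K.linkFactor ψ f) :=
  ((((Commute.one_right _).add_right (((Commute.one_left _).add_left
    ((K.link_commute e f).smul_left _)).smul_right _))).smul_left _).smul_right _

/-- The projection onto the joint eigenspace of the link operators of `E` with eigenvalues `χ`. -/
def linkProj (χ : Site N × Fin d → ℤˣ) (E : Finset (Site N × Fin d)) : FOp (Mode N M) :=
  gateProd (K.linkFactor χ) (K.linkFactor_commute χ χ) E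

theorem linkFactor_mul_link (χ : Site N × Fin d → ℤˣ) (e : Site N × Fin d) :
    K.linkFactor χ e * K.link e = signC (χ e) • K.linkFactor χ e := by
  rw [linkFactor, smul_mul_assoc, add_mul, one_mul, smul_mul_assoc, link_sq, smul_comm (signC _),
    smul_add (signC _), smul_smul (signC _), signC_mul_self, one_smul, add_comm]

theorem linkFactor_mul_self (χ : Site N × Fin d → ℤˣ) (e : Site N × Fin d) :
    K.linkFactor χ e * K.linkFactor χ e = K.linkFactor χ e := by
  have h := K.linkFactor_mul_link χ e
  nth_rw 2 [linkFactor]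
  rw [mul_smul_comm, mul_add, mul_one, mul_smul_comm, h, smul_smul, signC_mul_self, one_smul,
    ← two_smul ℂ, smul_smul, inv_mul_cancel₀ two_ne_zero, one_smul]

theorem star_linkFactor (χ : Site N × Fin d → ℤˣ) (e : Site N × Fin d) :
    star (K.linkFactor χ e) = K.linkFactor χ e := by
  rw [linkFactor, star_smul, star_add, star_one, star_smul, star_link, star_signC]
  simp

theorem star_linkProj (χ : Site N × Fin d → ℤˣ) (E : Finset (Site N × Fin d)) :
    star (K.linkProj χ E) = K.linkProj χ E := star_gateProd _ (K.star_linkFactor χ) E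

theorem linkProj_commute (χ ψ : Site N × Fin d → ℤˣ) (E E' : Finset (Site N × Fin d)) :
    Commute (K.linkProj χ E) (K.linkProj ψ E') :=
  gateProd_commute _ _ fun f _ => (gateProd_commute _ _ fun e _ =>
    K.linkFactor_commute ψ χ f e).symm

theorem linkProj_commute_matter (χ : Site N × Fin d → ℤˣ) (E : Finset (Site N × Fin d))
    {X : FOp (Mode N M)} (hX : X ∈ carLocal _ (K.matter N)) : Commute (K.linkProj χ E) X :=
  (gateProd_commute _ _ fun e _ => ((((Commute.one_left _).add_left
    ((K.link_commute_matter e hX).smul_left _)).smul_left _)).symm).symm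

theorem linkProj_empty (χ : Site N × Fin d → ℤˣ) : K.linkProj χ ∅ = 1 := gateProd_empty _

theorem linkProj_insert [DecidableEq (Site N × Fin d)] (χ : Site N × Fin d → ℤˣ)
    {E : Finset (Site N × Fin d)} {e : Site N × Fin d} (he : e ∉ E) :
    K.linkProj χ (insert e E) = K.linkFactor χ e * K.linkProj χ E := gateProd_insert _ he

theorem linkFactor_mul_linkProj (χ : Site N × Fin d → ℤˣ) {E : Finset (Site N × Fin d)}
    {e : Site N × Fin d} (he : e ∈ E) :
    K.linkFactor χ e * K.linkProj χ E = K.linkProj χ E := by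
  classical
  rw [← Finset.insert_erase he, linkProj_insert _ _ (Finset.notMem_erase e E), ← mul_assoc,
    linkFactor_mul_self]

theorem linkProj_mul_of_subset (χ : Site N × Fin d → ℤˣ) {E E' : Finset (Site N × Fin d)}
    (h : E ⊆ E') : K.linkProj χ E * K.linkProj χ E' = K.linkProj χ E' := by
  classical
  induction E using Finset.induction with
  | empty => rw [linkProj_empty, one_mul]
  | insert e E he ih =>
    rw [linkProj_insert _ _ he, mul_assoc, ih ((Finset.subset_insert e E).trans h),
      linkFactor_mul_linkProj _ _ (h (Finset.mem_insert_self e E))]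

theorem linkProj_mul_link (χ : Site N × Fin d → ℤˣ) {E : Finset (Site N × Fin d)}
    {e : Site N × Fin d} (he : e ∈ E) :
    K.linkProj χ E * K.link e = signC (χ e) • K.linkProj χ E := by
  have h1 := K.linkFactor_mul_linkProj χ he
  have h2 : Commute (K.linkFactor χ e) (K.linkProj χ E) :=
    gateProd_commute _ _ fun f _ => K.linkFactor_commute χ χ e f
  rw [h2.eq] at h1
  rw [← h1, mul_assoc, linkFactor_mul_link, mul_smul_comm]

/-- The projections belong to different eigenvalues of the self-adjoint link operator at `e`. -/
theorem linkProj_mul_eq_zero {χ ψ : Site N × Fin d → ℤˣ} {E E' : Finset (Site N × Fin d)}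
    {e : Site N × Fin d} (he : e ∈ E) (he' : e ∈ E') (h : χ e ≠ ψ e) :
    K.linkProj χ E * K.linkProj ψ E' = 0 := by
  have h1 := K.linkProj_mul_link χ he
  have h2 := congrArg star (K.linkProj_mul_link ψ he')
  rw [star_mul, star_smul, star_link, star_linkProj, star_signC] at h2
  have h3 : signC (χ e) • (K.linkProj χ E * K.linkProj ψ E')
      = signC (ψ e) • (K.linkProj χ E * K.linkProj ψ E') := by
    rw [← smul_mul_assoc, ← h1, mul_assoc, h2, mul_smul_comm]
  rw [← sub_eq_zero, ← sub_smul] at h3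
  refine (smul_eq_zero.1 h3).resolve_left fun h4 => h ?_
  rcases Int.units_eq_one_or (χ e) with h5 | h5 <;> rcases Int.units_eq_one_or (ψ e) with h6 | h6 <;>
    rw [h5, h6] at h4 ⊢ <;> norm_num [signC] at h4

theorem linkProj_congr {χ ψ : Site N × Fin d → ℤˣ} {E : Finset (Site N × Fin d)}
    (h : ∀ e ∈ E, χ e = ψ e) : K.linkProj χ E = K.linkProj ψ E := by
  classical
  induction E using Finset.induction with
  | empty => rw [linkProj_empty, linkProj_empty]
  | insert e E he ih =>
    rw [linkProj_insert _ _ he, linkProj_insert _ _ he, linkFactor, linkFactor,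
      h e (Finset.mem_insert_self e E), ih fun f hf => h f (Finset.mem_insert_of_mem hf)]

theorem signConj_linkFactor (ε : Mode N M → ℤˣ) (χ : Site N × Fin d → ℤˣ) (e : Site N × Fin d) :
    signConj ε (K.linkFactor χ e) = K.linkFactor (χ * K.linkSign ε) e := by
  rw [linkFactor, linkFactor, map_smul, map_add, map_one, map_smul, signConj_link, smul_smul,
    Pi.mul_apply, signC_mul]

theorem signConj_linkProj (ε : Mode N M → ℤˣ) (χ : Site N × Fin d → ℤˣ)
    (E : Finset (Site N × Fin d)) :
    signConj ε (K.linkProj χ E) = K.linkProj (χ * K.linkSign ε) E := by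
  rw [linkProj, map_gateProd, linkProj]
  congr 1
  funext e
  exact K.signConj_linkFactor ε χ e

theorem linkProj_mem {V : Set (Mode N M)} (χ : Site N × Fin d → ℤˣ)
    {E : Finset (Site N × Fin d)} (h : ∀ e ∈ E, K.source e ∈ V ∧ K.target e ∈ V) :
    K.linkProj χ E ∈ carLocal _ V := by
  refine gateProd_mem _ _ fun e he => StarSubalgebra.smul_mem _ (add_mem (one_mem _)
    (StarSubalgebra.smul_mem _ ?_ _)) _
  refine carEven_le_carLocal _ (carEven_mono ?_ (K.link_mem e))
  rintro x (rfl | rfl)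
  · exact (h e he).1
  · exact (h e he).2

/-- Link conditions do not restrict the matter modes. Conjugation with the parity of the source mode
of one link flips this link only and fixes `X`, so `X` also vanishes on the opposite eigenspace, and
the two eigenprojections add up to one. -/
theorem eq_zero_of_linkProj_mul {χ : Site N × Fin d → ℤˣ} {E : Finset (Site N × Fin d)}
    {X : FOp (Mode N M)} (hX : X ∈ carLocal _ (K.matter N)) (h : K.linkProj χ E * X = 0) :
    X = 0 := by
  classical
  induction E using Finset.induction with
  | empty => rwa [linkProj_empty, one_mul] at h
  | insert e E he ih =>
    refine ih ?_
    rw [linkProj_insert _ _ he] at h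
    have h2 := congrArg (signConj fun x => if x = K.source e then -1 else 1) h
    have hX' : signConj (fun x => if x = K.source e then -1 else 1) X = X := by
      rw [signConj_congr (δ := 1) (M := K.matter N) ?_ hX, signConj_one]
      intro x hx
      refine if_neg ?_
      rintro rfl
      exact (hx e.2).1 rfl
    rw [map_zero, map_mul, map_mul, hX', signConj_linkProj, signConj_linkFactor,
      K.linkProj_congr (χ := χ * _) (ψ := χ) ?_] at h2
    · rw [linkFactor, Pi.mul_apply, linkSign, if_pos rfl,
        if_neg (K.source_ne_target e e).symm, mul_one, mul_neg_one, signC_neg] at h2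
      rw [linkFactor] at h
      rw [mul_assoc] at h h2
      generalize K.linkProj χ E * X = Z at *
      generalize K.link e = s at *
      rw [smul_mul_assoc] at h h2
      have h3 := (smul_eq_zero.1 h).resolve_left (by norm_num)
      have h4 := (smul_eq_zero.1 h2).resolve_left (by norm_num)
      rw [neg_smul, ← sub_eq_add_neg] at h4
      have h5 : (2 : ℂ) • Z = 0 := by
        rw [two_smul]
        calc Z + Z = (1 + signC (χ e) • s) * Z + (1 - signC (χ e) • s) * Z := by noncomm_ring
          _ = 0 := by rw [h3, h4, add_zero]
      exact (smul_eq_zero.1 h5).resolve_left two_ne_zero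
    · intro f hf
      rw [Pi.mul_apply, linkSign, if_neg, if_neg (K.source_ne_target e f).symm, mul_one, mul_one]
      exact fun hfe => he (K.source_inj hfe ▸ hf)

/-- Translation of links. -/
theorem permConj_linkProj (v : Site N) (E : Finset (Site N × Fin d)) :
    permConj (shiftModes N M v) (K.linkProj 1 E)
      = K.linkProj 1 (E.map (IsGateLayer.shiftLabel N (Fin d) v).toEmbedding) := by
  rw [linkProj, map_gateProd, linkProj, gateProd_map]
  congr 1
  funext e
  have h : shiftModes N M v (K.target e)
      = K.target (IsGateLayer.shiftLabel N (Fin d) v e) := by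
    change mode (e.1 + unitStep N e.2 + v) (K.neg e.2) = mode (e.1 + v + unitStep N e.2) (K.neg e.2)
    rw [add_right_comm]
  rw [linkFactor, map_smul, map_add, map_one, map_smul, link, map_smul, map_mul,
    permConj_majorana, permConj_majorana, h]
  rfl

end LinkModes

/-! ## Averages over site parities -/

/-- Conjugation with the parities of the sites with `g n = -1`. -/
def siteConj (g : Site N → ℤˣ) : FOp (Mode N M) ≃⋆ₐ[ℂ] FOp (Mode N M) :=
  signConj fun x => g (siteOf x)

theorem siteConj_siteConj (g h : Site N → ℤˣ) (A : FOp (Mode N M)) :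
    siteConj g (siteConj h A) = siteConj (g * h) A := signConj_signConj _ _ A

theorem siteConj_congr {W : Set (Site N)} {g h : Site N → ℤˣ} (hgh : ∀ p ∈ W, g p = h p)
    {A : FOp (Mode N M)} (hA : A ∈ carLocal _ (modesOn N M W)) : siteConj g A = siteConj h A :=
  signConj_congr (ε := fun x => g (siteOf x)) (δ := fun x => h (siteOf x))
    (fun _ hx => hgh _ hx) hA

/-- The links inside `W`. -/
def linksIn (W : Finset (Site N)) : Finset (Site N × Fin d) :=
  (W ×ˢ Finset.univ).filter fun e => e.1 + unitStep N e.2 ∈ W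

theorem mem_linksIn {W : Finset (Site N)} {e : Site N × Fin d} :
    e ∈ linksIn W ↔ e.1 ∈ W ∧ e.1 + unitStep N e.2 ∈ W := by
  simp [linksIn]

/-- The difference of signs along a link. -/
def diffSign (g : Site N → ℤˣ) (e : Site N × Fin d) : ℤˣ := g e.1 * g (e.1 + unitStep N e.2)

theorem signSupport_finite (W : Finset (Site N)) :
    {g : Site N → ℤˣ | ∀ p, p ∉ W → g p = 1}.Finite := by
  classical
  refine (Set.finite_range fun (g : W → ℤˣ) (p : Site N) =>
    if h : p ∈ W then g ⟨p, h⟩ else 1).subset ?_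
  intro g hg
  refine ⟨fun p => g p, funext fun p => ?_⟩
  by_cases h : p ∈ W
  · exact dif_pos h
  · exact (dif_neg h).trans (hg p h).symm

/-- The signs that are trivial outside `W`. -/
def signsOn (W : Finset (Site N)) : Finset (Site N → ℤˣ) := (signSupport_finite W).toFinset

theorem mem_signsOn {W : Finset (Site N)} {g : Site N → ℤˣ} :
    g ∈ signsOn W ↔ ∀ p, p ∉ W → g p = 1 := by simp [signsOn]

/-- The number of signs on `W` that are constant along links. -/
def numConst (W : Finset (Site N)) : ℂ :=
  ∑ g ∈ signsOn W, open Classical in if ∀ e ∈ linksIn W, diffSign g e = 1 then 1 else 0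

theorem numConst_ne_zero (W : Finset (Site N)) : numConst W ≠ 0 := by
  classical
  rw [numConst, ← Finset.natCast_card_filter, Nat.cast_ne_zero, Finset.card_ne_zero]
  exact ⟨1, Finset.mem_filter.2 ⟨mem_signsOn.2 fun _ _ => rfl, fun e _ => by simp [diffSign]⟩⟩

/-! ### Dressed operators: invariance, products, commutation and translation. -/

namespace LinkModes

/-- The operator that is invariant under site parities and acts like `X` where all links in `W` are
`1`. -/
def dress (W : Finset (Site N)) (X : FOp (Mode N M)) : FOp (Mode N M) :=
  (numConst W)⁻¹ • ∑ g ∈ signsOn W, siteConj g (X * K.linkProj 1 (linksIn W))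

/-- Matter operators on `W` that commute with the parity of `W`. -/
structure Dressable (W : Finset (Site N)) (X : FOp (Mode N M)) : Prop where
  mem : X ∈ carLocal _ (K.matter N ∩ modesOn N M W)
  inv : ∀ g : Site N → ℤˣ, (∀ e ∈ linksIn W, diffSign g e = 1) → siteConj g X = X

/-- The two Majorana operators of a link pick up the signs at its two ends, so the required
eigenvalue changes by their product. -/
theorem siteConj_linkProj (g : Site N → ℤˣ) (χ : Site N × Fin d → ℤˣ)
    (E : Finset (Site N × Fin d)) :
    siteConj g (K.linkProj χ E) = K.linkProj (χ * diffSign g) E := K.signConj_linkProj _ _ _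

theorem linkProj_linksIn_mem (W : Finset (Site N)) (χ : Site N × Fin d → ℤˣ) :
    K.linkProj χ (linksIn W) ∈ carLocal _ (modesOn N M W) :=
  K.linkProj_mem χ fun _ he => mem_linksIn.1 he

variable {K} {W : Finset (Site N)} {X Y : FOp (Mode N M)}

namespace Dressable

theorem matter (h : K.Dressable W X) : X ∈ carLocal _ (K.matter N) :=
  carLocal_mono Set.inter_subset_left h.mem

theorem local_mem (h : K.Dressable W X) : X ∈ carLocal _ (modesOn N M W) :=
  carLocal_mono Set.inter_subset_right h.mem

theorem mul_linkProj_mem (h : K.Dressable W X) :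
    X * K.linkProj 1 (linksIn W) ∈ carLocal _ (modesOn N M W) :=
  mul_mem h.local_mem (K.linkProj_linksIn_mem W 1)

theorem star (h : K.Dressable W X) : K.Dressable W (star X) :=
  ⟨star_mem h.mem, fun g hg => by rw [map_star, h.inv g hg]⟩

end Dressable

theorem dress_mem (h : K.Dressable W X) : K.dress W X ∈ carLocal _ (modesOn N M W) :=
  StarSubalgebra.smul_mem _ (sum_mem fun _ _ => signConj_mem _ h.mul_linkProj_mem) _

/-- The definition averages over the group of sign functions, so conjugation with one of them merely
reindexes the sum. -/
theorem siteConj_dress (h : K.Dressable W X) (k : Site N → ℤˣ) :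
    siteConj k (K.dress W X) = K.dress W X := by
  classical
  rw [dress, map_smul, map_sum]
  congr 1
  -- Signs outside `W` do not affect operators on `W`; the truncated signs act by multiplication on
  -- the index set `signsOn W`.
  let k' : Site N → ℤˣ := fun p => if p ∈ W then k p else 1
  refine Finset.sum_equiv (Equiv.mulLeft k') (fun g => ?_) fun g _ => ?_
  · rw [mem_signsOn, mem_signsOn]
    refine forall₂_congr fun p hp => ?_
    change _ ↔ k' p * g p = 1
    rw [show k' p = 1 from if_neg hp, one_mul]
  · rw [siteConj_siteConj]
    have e : ∀ p ∈ (W : Set (Site N)), (k * g) p = (k' * g) p := fun p hp => by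
      rw [Pi.mul_apply, Pi.mul_apply, show k' p = k p from if_pos (Finset.mem_coe.1 hp)]
    exact siteConj_congr e h.mul_linkProj_mem

/-- A summand whose signs change along some link projects onto the wrong eigenvalue there and drops
out. The others equal `X` times the projection by `Dressable.inv`, and `numConst W` counts them. -/
theorem dress_mul_linkProj (h : K.Dressable W X) {E : Finset (Site N × Fin d)}
    (hE : linksIn W ⊆ E) : K.dress W X * K.linkProj 1 E = X * K.linkProj 1 E := by
  classical
  have key : ∀ g : Site N → ℤˣ, siteConj g (X * K.linkProj 1 (linksIn W)) * K.linkProj 1 E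
      = (if ∀ e ∈ linksIn W, diffSign g e = 1 then (1 : ℂ) else 0) • (X * K.linkProj 1 E) := by
    intro g
    rw [map_mul, siteConj_linkProj, one_mul, mul_assoc]
    split_ifs with hg
    · rw [h.inv g hg, K.linkProj_congr (ψ := 1) hg, K.linkProj_mul_of_subset 1 hE, one_smul]
    · push Not at hg
      obtain ⟨e, he, hne⟩ := hg
      rw [K.linkProj_mul_eq_zero he (hE he) hne, mul_zero, zero_smul]
  rw [dress, smul_mul_assoc, Finset.sum_mul, Finset.sum_congr rfl fun g _ => key g,
    ← Finset.sum_smul, smul_smul]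
  change ((numConst W)⁻¹ * numConst W) • _ = _
  rw [inv_mul_cancel₀ (numConst_ne_zero W), one_smul]

theorem star_dress (h : K.Dressable W X) : star (K.dress W X) = K.dress W (star X) := by
  have hn : star (numConst W) = numConst W := by
    rw [numConst, star_sum]
    refine Finset.sum_congr rfl fun g _ => ?_
    split_ifs <;> simp
  rw [dress, star_smul, star_sum, star_inv₀, hn, dress]
  congr 1
  refine Finset.sum_congr rfl fun g _ => ?_
  rw [← map_star, star_mul, star_linkProj, (K.linkProj_commute_matter _ _ h.star.matter).eq]

/-- As `dress W X` is invariant under site parities, it moves inside every summand of `dress W Y`,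
where it meets the projection and becomes `X`. -/
theorem dress_mul_dress (h : K.Dressable W X) (h' : K.Dressable W Y) :
    K.dress W X * K.dress W Y = K.dress W (X * Y) := by
  rw [dress.eq_def K W Y, dress.eq_def K W (X * Y), mul_smul_comm, Finset.mul_sum]
  congr 1
  refine Finset.sum_congr rfl fun g _ => ?_
  have hc := K.linkProj_commute_matter 1 (linksIn W) h'.matter
  rw [← siteConj_dress h g, ← map_mul, ← hc.eq, ← mul_assoc, dress_mul_linkProj h subset_rfl,
    mul_assoc, hc.eq, mul_assoc]

/-- Two summands whose signs disagree on a common link contain orthogonal projections, so both of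
their products vanish. Hence commutation is needed only for signs that agree on all common links. -/
theorem dress_commute {W' : Finset (Site N)} (h : K.Dressable W X) (h' : K.Dressable W' Y)
    (hc : ∀ g k : Site N → ℤˣ, (∀ e ∈ linksIn W, e ∈ linksIn W' → diffSign g e = diffSign k e) →
      Commute (siteConj g X) (siteConj k Y)) : Commute (K.dress W X) (K.dress W' Y) := by
  refine Commute.smul_left (Commute.smul_right ?_ _) _
  refine Commute.sum_left _ _ _ fun g _ => Commute.sum_right _ _ _ fun k _ => ?_
  have e1 : ∀ (g : Site N → ℤˣ) {Z : FOp (Mode N M)}, Z ∈ carLocal _ (K.matter N) →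
      ∀ χ E, Commute (K.linkProj χ E) (siteConj g Z) := fun g Z hZ χ E =>
    K.linkProj_commute_matter χ E (signConj_mem _ hZ)
  have hP := K.linkProj_commute (1 * diffSign g) (1 * diffSign k) (linksIn W) (linksIn W')
  rw [map_mul, map_mul, siteConj_linkProj, siteConj_linkProj]
  have e2 := e1 g h.matter (1 * diffSign k) (linksIn W')
  have e3 := e1 k h'.matter (1 * diffSign g) (linksIn W)
  by_cases hgk : ∀ e ∈ linksIn W, e ∈ linksIn W' → diffSign g e = diffSign k e
  · exact ((hc g k hgk).mul_right e2.symm).mul_left (e3.mul_right hP)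
  · push Not at hgk
    obtain ⟨e, he, he', hne⟩ := hgk
    have h0 := K.linkProj_mul_eq_zero (χ := 1 * diffSign g) (ψ := 1 * diffSign k) he he'
      (by rwa [one_mul, one_mul])
    have e4 := e1 g h.matter (1 * diffSign g) (linksIn W)
    have e5 := e1 k h'.matter (1 * diffSign k) (linksIn W')
    have h0' := h0
    rw [hP.eq] at h0'
    rw [← e4.eq, ← e5.eq]
    generalize K.linkProj (1 * diffSign g) (linksIn W) = P at *
    generalize K.linkProj (1 * diffSign k) (linksIn W') = Q at *
    generalize siteConj g X = x at *
    generalize siteConj k Y = y at *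
    change P * x * (Q * y) = Q * y * (P * x)
    calc P * x * (Q * y) = P * (x * Q) * y := by noncomm_ring
      _ = P * Q * (x * y) := by rw [← e2.eq]; noncomm_ring
      _ = Q * P * (y * x) := by rw [h0, h0', zero_mul, zero_mul]
      _ = Q * (P * y) * x := by noncomm_ring
      _ = Q * y * (P * x) := by rw [e3.eq]; noncomm_ring

theorem permConj_siteConj (v : Site N) (g : Site N → ℤˣ) {A : FOp (Mode N M)}
    (hA : A ∈ CAR (Mode N M)) : permConj (shiftModes N M v) (siteConj g A)
      = siteConj (fun p => g (p - v)) (permConj (shiftModes N M v) A) := by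
  rw [siteConj, permConj_signConj _ _ hA, siteConj]
  congr 2
  funext x
  obtain ⟨i, hi⟩ := exists_mode x
  generalize siteOf x = p at hi
  subst hi
  rw [shiftModes_symm_mode]
  rfl

theorem linksIn_map (v : Site N) (W : Finset (Site N)) :
    linksIn (W.map (Equiv.addRight v).toEmbedding)
      = (linksIn W).map (IsGateLayer.shiftLabel N (Fin d) v).toEmbedding := by
  ext e
  rw [mem_linksIn, Finset.mem_map_equiv, Finset.mem_map_equiv, Finset.mem_map_equiv, mem_linksIn]
  have h : (Equiv.addRight v).symm (e.1 + unitStep N e.2)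
      = (Equiv.addRight v).symm e.1 + unitStep N e.2 := by
    simp only [Equiv.addRight_symm, Equiv.coe_addRight, add_right_comm]
  rw [h]
  rfl

theorem permConj_dress (v : Site N) (h : K.Dressable W X) :
    permConj (shiftModes N M v) (K.dress W X)
      = K.dress (W.map (Equiv.addRight v).toEmbedding) (permConj (shiftModes N M v) X) := by
  classical
  let θ : (Site N → ℤˣ) ≃ (Site N → ℤˣ) := (Equiv.addRight v).arrowCongr (Equiv.refl _)
  have hθ : ∀ g p, θ g p = g (p - v) := fun g p => by
    simp [θ, sub_eq_add_neg]
  have hmem : ∀ g, g ∈ signsOn W ↔ θ g ∈ signsOn (W.map (Equiv.addRight v).toEmbedding) := by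
    intro g
    rw [mem_signsOn, mem_signsOn]
    refine ⟨fun hg p hp => ?_, fun hg p hp => ?_⟩
    · rw [hθ]
      refine hg _ fun hp' => hp ?_
      rw [Finset.mem_map_equiv]
      simpa [sub_eq_add_neg] using hp'
    · have := hg (p + v) (by rw [Finset.mem_map_equiv]; simpa using hp)
      rwa [hθ, add_sub_cancel_right] at this
  have hdiff : ∀ g e, diffSign (θ g) (IsGateLayer.shiftLabel N (Fin d) v e) = diffSign g e := by
    intro g e
    change θ g (e.1 + v) * θ g (e.1 + v + unitStep N e.2) = _
    rw [hθ, hθ, add_sub_cancel_right, add_right_comm, add_sub_cancel_right, diffSign]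
  have hnum : numConst (W.map (Equiv.addRight v).toEmbedding) = numConst W := by
    refine (Finset.sum_equiv θ hmem fun g _ => ?_).symm
    congr 1
    rw [linksIn_map, eq_iff_iff]
    refine ⟨fun hg e he => ?_, fun hg e he => ?_⟩
    · obtain ⟨f, hf, rfl⟩ := Finset.mem_map.1 he
      exact (hdiff g f).trans (hg f hf)
    · rw [← hdiff]
      exact hg _ (Finset.mem_map_of_mem _ he)
  rw [dress, map_smul, map_sum, dress, hnum]
  congr 1
  refine Finset.sum_equiv θ hmem fun g _ => ?_
  rw [permConj_siteConj v g (carLocal_mono (Set.subset_univ _) h.mul_linkProj_mem), map_mul,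
    permConj_linkProj, linksIn_map]
  congr 2
  funext p
  exact (hθ g p).symm

end LinkModes

end Links

end

noncomputable section

/-! ## Qubits simulate fermions -/

section Copies

variable {d : ℕ} {N : Fin d → ℕ} {m M : ℕ}

/-- The embedding of the modes at each site into a larger set of modes at each site. -/
def modeEmb (N : Fin d → ℕ) (f : Fin m ↪o Fin M) : Mode N m ↪o Mode N M :=
  OrderEmbedding.ofStrictMono (fun x => mode (siteOf x) (f (ofLex x).2)) (by
    intro x y hxy
    obtain ⟨i, hi⟩ := exists_mode x
    obtain ⟨j, hj⟩ := exists_mode y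
    generalize siteOf x = n at hi
    generalize siteOf y = p at hj
    subst hi hj
    change mode n (f i) < mode p (f j)
    by_cases h : n = p
    · subst h
      rw [mode_lt_same] at hxy ⊢
      exact f.lt_iff_lt.2 hxy
    · rw [mode_lt_of_ne h] at hxy ⊢
      exact hxy)

/-- The copy of a fermionic system on some of the modes at each site. -/
def copyHom (N : Fin d → ℕ) (f : Fin m ↪o Fin M) : FOp (Mode N m) →⋆ₐ[ℂ] FOp (Mode N M) :=
  embHom (modeEmb N f)

theorem permConj_copyHom (f : Fin m ↪o Fin M) (v : Site N) {A : FOp (Mode N m)}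
    (hA : A ∈ CAR (Mode N m)) : permConj (shiftModes N M v) (copyHom N f A)
      = copyHom N f (permConj (shiftModes N m v) A) :=
  permConj_embHom (modeEmb N f) (shiftModes N M v) (shiftModes N m v) (fun _ => rfl) hA

theorem signConj_copyHom (f : Fin m ↪o Fin M) {A : FOp (Mode N m)} (hA : A ∈ CAR (Mode N m)) :
    signConj (-1) (copyHom N f A) = copyHom N f (signConj (-1) A) :=
  signConj_embHom (modeEmb N f) (-1) hA

variable {K : LinkModes d M} {f : Fin m ↪o Fin M}

theorem image_modeEmb (hf : ∀ i j, f i ≠ K.pos j ∧ f i ≠ K.neg j) (V : Set (Site N)) :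
    modeEmb N f '' modesOn N m V ⊆ K.matter N ∩ modesOn N M V := by
  rintro _ ⟨x, hx, rfl⟩
  exact ⟨fun j => hf _ j, hx⟩

theorem copyHom_mem (hf : ∀ i j, f i ≠ K.pos j ∧ f i ≠ K.neg j) {V : Set (Site N)}
    {A : FOp (Mode N m)} (hA : A ∈ carLocal _ (modesOn N m V)) :
    copyHom N f A ∈ carLocal _ (K.matter N ∩ modesOn N M V) :=
  carLocal_mono (image_modeEmb hf V) (embHom_mem (modeEmb N f) hA)

theorem copyHom_mem_carEven (hf : ∀ i j, f i ≠ K.pos j ∧ f i ≠ K.neg j) {V : Set (Site N)}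
    {A : FOp (Mode N m)} (hA : A ∈ fObs N m V) :
    copyHom N f A ∈ carEven _ (K.matter N ∩ modesOn N M V) :=
  carEven_mono (image_modeEmb hf V) (embHom_mem_carEven (modeEmb N f) hA)

end Copies

/-! ### The exchange of an evolved copy with a plain copy, and its localization in balls. -/

section Pair

variable {d : ℕ} {N : Fin d → ℕ} {m M L : ℕ}

/-- The annihilation operators after one timestep, in a copy of the system. -/
def evolvedAnnih (f : Fin m ↪o Fin M) (u : CAR (Mode N m) ≃⋆ₐ[ℂ] CAR (Mode N m))
    (x : Mode N m) : FOp (Mode N M) := copyHom N f (u (carGen _ x) : FOp (Mode N m))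

/-- The annihilation operators of a copy of the system. -/
def copyAnnih (f : Fin m ↪o Fin M) (x : Mode N m) : FOp (Mode N M) :=
  annih _ (modeEmb N f x)

theorem copyHom_annih (f : Fin m ↪o Fin M) (x : Mode N m) :
    copyHom N f (annih _ x) = copyAnnih f x := embHom_annih _ _

variable {f₁ f₂ : Fin m ↪o Fin M} {u : CAR (Mode N m) ≃⋆ₐ[ℂ] CAR (Mode N m)}

theorem signConj_evolvedAnnih (hu : IsFQCA N m L u) (f : Fin m ↪o Fin M) (x : Mode N m) :
    signConj (-1) (evolvedAnnih f u x) = -evolvedAnnih f u x := by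
  rw [evolvedAnnih, signConj_copyHom f (u (carGen _ x)).2, hu.odd, map_neg]

theorem signConj_copyAnnih (f : Fin m ↪o Fin M) (x : Mode N m) :
    signConj (-1) (copyAnnih f x) = -copyAnnih f x := by
  rw [copyAnnih, signConj_annih, Pi.neg_apply, Pi.one_apply, signC_neg, signC_one, neg_one_smul]

theorem copyAnnih_mul (h12 : ∀ i j, f₁ i ≠ f₂ j) {A : FOp (Mode N m)} (hA : A ∈ CAR (Mode N m))
    (x : Mode N m) : copyAnnih f₂ x * copyHom N f₁ A
      = copyHom N f₁ (signConj (-1) A) * copyAnnih f₂ x := by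
  have h := annih_mul_of_mem (M := modeEmb N f₁ '' Set.univ) (i := modeEmb N f₂ x) ?_
    (embHom_mem (modeEmb N f₁) hA)
  · exact h.trans (congrArg (· * _) (signConj_copyHom f₁ hA))
  · rintro ⟨y, -, hy⟩
    exact h12 _ _ (mode_inj.1 hy).2

theorem map_anticommute_star {O : Type*} [Ring O] [Algebra ℂ O] [StarRing O] [StarModule ℂ O]
    {S : StarSubalgebra ℂ O} (w : S ≃⋆ₐ[ℂ] S) {x y : S} (h : (x : O) * star (y : O) = -(star y * x)) :
    (w x : O) * star (w y : O) = -(star (w y : O) * w x) := by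
  have := map_anticommute w (x := x) (y := star y) h
  rwa [map_star] at this

theorem map_anticomm_self {O : Type*} [Ring O] [Algebra ℂ O] [StarRing O] [StarModule ℂ O]
    {S : StarSubalgebra ℂ O} (w : S ≃⋆ₐ[ℂ] S) {x : S}
    (h : (x : O) * star (x : O) = 1 - star (x : O) * x) :
    (w x : O) * star (w x : O) = 1 - star (w x : O) * w x := by
  have h1 : x * star x = 1 - star x * x := Subtype.ext h
  have h2 := congrArg Subtype.val (congrArg w h1)
  rw [map_sub, map_one, map_mul, map_mul, map_star] at h2
  exact h2

section Hom

variable {A B : Type*} [Ring A] [Algebra ℂ A] [StarRing A] [Ring B] [Algebra ℂ B] [StarRing B]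
  (φ : A →⋆ₐ[ℂ] B) {a b : A}

theorem hom_anticommute (h : a * b = -(b * a)) : φ a * φ b = -(φ b * φ a) := by
  rw [← map_mul, h, map_neg, map_mul]

theorem hom_anticommute_star (h : a * star b = -(star b * a)) :
    φ a * star (φ b) = -(star (φ b) * φ a) := by
  rw [← map_star, hom_anticommute φ h]

theorem hom_anticomm_self (h : a * star a = 1 - star a * a) :
    φ a * star (φ a) = 1 - star (φ a) * φ a := by
  rw [← map_star, ← map_mul, h, map_sub, map_one, map_mul]

theorem hom_star_anticommute (σ : A →⋆ₐ[ℂ] A) (ha : σ a = -a) {c : B}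
    (h : c * φ (star a) = φ (σ (star a)) * c) : φ a * star c = -(star c * φ a) := by
  rw [map_star, map_star, ha, star_neg, map_neg, neg_mul, map_star] at h
  have h2 := congrArg star h
  rwa [star_mul, star_neg, star_mul, star_star] at h2

end Hom

/-- Relations within the first copy hold because `u` and `copyHom` are homomorphisms. The mixed
relations combine disjointness of the modes of both copies with oddness of the evolved operators. -/
theorem isCARPair_copies (hu : IsFQCA N m L u) (h12 : ∀ i j, f₁ i ≠ f₂ j) :
    IsCARPair (evolvedAnnih f₁ u) (copyAnnih (N := N) f₂) where
  aa x y := by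
    have h := map_anticommute u (x := carGen _ x) (y := carGen _ y) (annih_mul_annih x y)
    exact hom_anticommute (copyHom N f₁) h
  bb x y := annih_mul_annih _ _
  ab x y := by
    have h := copyAnnih_mul h12 (u (carGen _ x)).2 y
    rw [hu.odd, map_neg, neg_mul] at h
    exact (neg_eq_iff_eq_neg.2 h).symm
  aas x y hxy := by
    have h := map_anticommute_star u (x := carGen _ x) (y := carGen _ y) (annih_mul_star_annih hxy)
    exact hom_anticommute_star (copyHom N f₁) h
  bbs x y hxy := annih_mul_star_annih ((modeEmb N f₂).injective.ne hxy)
  abs x y := by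
    have h := copyAnnih_mul h12 (star_mem (u (carGen _ x)).2) y
    exact hom_star_anticommute (copyHom N f₁) (equivHom (signConj (-1))) (hu.odd x) h
  aa_self x := by
    have h := map_anticomm_self u (x := carGen _ x) (eq_sub_of_add_eq (annih_anticomm_self x))
    exact hom_anticomm_self (copyHom N f₁) h
  bb_self x := eq_sub_of_add_eq (annih_anticomm_self _)

variable {K : LinkModes d M} (hf₁ : ∀ i j, f₁ i ≠ K.pos j ∧ f₁ i ≠ K.neg j)
  (hf₂ : ∀ i j, f₂ i ≠ K.pos j ∧ f₂ i ≠ K.neg j)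

include hf₁ hf₂ in
-- The generator is a product of two odd operators, each made of matter modes within distance `L`.
theorem swapGen_mem_carEven (hu : IsFQCA N m L u) (x : Mode N m) :
    swapGen (evolvedAnnih f₁ u) (copyAnnih f₂) x
      ∈ carEven _ (K.matter N ∩ modesOn N M (siteBall (siteOf x) L)) := by
  obtain ⟨i, hi⟩ := exists_mode x
  have h1 : evolvedAnnih f₁ u x ∈ carLocal _ (K.matter N ∩ modesOn N M (siteBall (siteOf x) L)) := by
    refine copyHom_mem hf₁ ?_
    have := hu.causal (siteOf x) i
    rwa [← hi] at this
  have h2 : copyAnnih f₂ x ∈ carLocal _ (K.matter N ∩ modesOn N M (siteBall (siteOf x) L)) :=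
    annih_mem_carLocal ⟨fun j => hf₂ _ j, mem_siteBall_self _ _⟩
  have h3 := sub_mem h1 h2
  rw [swapGen, mem_carEven_iff (mul_mem (star_mem h3) h3), map_mul, map_star, map_sub,
    signConj_evolvedAnnih hu, signConj_copyAnnih, ← neg_sub', star_neg, neg_mul_neg]

theorem permConj_swapGen (hu : IsFQCA N m L u) (v : Site N) (x : Mode N m) :
    permConj (shiftModes N M v) (swapGen (evolvedAnnih f₁ u) (copyAnnih f₂) x)
      = swapGen (evolvedAnnih f₁ u) (copyAnnih f₂) (shiftModes N m v x) := by
  obtain ⟨i, hi⟩ := exists_mode x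
  have h1 : permConj (shiftModes N M v) (evolvedAnnih f₁ u x)
      = evolvedAnnih f₁ u (shiftModes N m v x) := by
    have h := hu.translation v (siteOf x) i
    rw [← hi] at h
    refine (permConj_copyHom f₁ v (u (carGen _ x)).2).trans (congrArg (copyHom N f₁) ?_)
    rw [permConj_apply]
    refine Eq.trans h.symm ?_
    rw [← shiftModes_mode, ← hi]
  have h2 : permConj (shiftModes N M v) (copyAnnih f₂ x) = copyAnnih f₂ (shiftModes N m v x) :=
    permConj_annih _ _
  rw [swapGen, map_mul, map_star, map_sub, h1, h2, swapGen]

/-- The ball as a finite set. -/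
def ball (n : Site N) (r : ℕ) : Finset (Site N) := (siteBall_finite n r).toFinset

theorem mem_ball {n p : Site N} {r : ℕ} : p ∈ ball n r ↔ p ∈ siteBall n r := by simp [ball]

theorem coe_ball (n : Site N) (r : ℕ) : (ball n r : Set (Site N)) = siteBall n r := by
  simp [ball]

theorem ball_map (n v : Site N) (r : ℕ) :
    (ball n r).map (Equiv.addRight v).toEmbedding = ball (n + v) r := by
  ext p
  rw [Finset.mem_map_equiv, mem_ball, mem_ball, ← mem_siteBall_sub]
  simp [sub_eq_add_neg]

/-- Signs are constant on a ball if they are constant along the links. -/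
theorem eq_center_of_diffSign {g : Site N → ℤˣ} {n p : Site N} {r : ℕ}
    (h : ∀ e ∈ linksIn (ball n r), diffSign g e = 1) (hp : p ∈ siteBall n r) : g p = g n := by
  refine eq_center_of_edges (fun q j hq hq' => ?_) hp
  have := h (q, j) (mem_linksIn.2 ⟨mem_ball.2 hq, mem_ball.2 hq'⟩)
  exact (mul_eq_one_iff_eq_inv.1 this).symm ▸ (Int.units_inv_eq_self _).symm

theorem linksIn_mono {V W : Finset (Site N)} (h : V ⊆ W) : linksIn V ⊆ linksIn W := fun _ he =>
  mem_linksIn.2 ⟨h (mem_linksIn.1 he).1, h (mem_linksIn.1 he).2⟩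

theorem ball_subset {n p : Site N} {r s t : ℕ} (h : p ∈ siteBall n s) (ht : r + s ≤ t) :
    ball p r ⊆ ball n t := fun _ hq => mem_ball.2 (siteBall_subset h ht (mem_ball.1 hq))

theorem siteConj_eq_self {g : Site N → ℤˣ} {n : Site N} {r : ℕ}
    (h : ∀ e ∈ linksIn (ball n r), diffSign g e = 1) {X : FOp (Mode N M)}
    (hX : X ∈ carEven _ (K.matter N ∩ modesOn N M (siteBall n r))) : siteConj g X = X :=
  signConj_eq_self_of_carEven (ε := fun x => g (siteOf x)) (u := g n)
    (fun _ hx => eq_center_of_diffSign h hx.2) hX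

/-- Signs that are constant along the links of a ball are constant on the ball, and an even operator
does not see a common sign. -/
theorem dressable_of_mem_carEven {X : FOp (Mode N M)} {n : Site N} {r t : ℕ} (hrt : r ≤ t)
    (hX : X ∈ carEven _ (K.matter N ∩ modesOn N M (siteBall n r))) :
    K.Dressable (ball n t) X where
  mem := by
    refine carLocal_mono (Set.inter_subset_inter_right _ (modesOn_mono ?_))
      (carEven_le_carLocal _ hX)
    rw [coe_ball]
    exact siteBall_mono hrt
  inv g hg := siteConj_eq_self (fun e he => hg e (linksIn_mono
    (ball_subset (mem_siteBall_self n 0) hrt) he)) hX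

theorem signConj_mem_carEven {ι : Type} [LinearOrder ι] {S : Set ι} (ε : ι → ℤˣ) {X : FOp ι}
    (hX : X ∈ carEven ι S) : signConj ε X ∈ carEven ι S := by
  rw [mem_carEven_iff (signConj_mem ε (carEven_le_carLocal _ hX)), signConj_signConj, mul_comm,
    ← signConj_signConj, signConj_carEven_neg_one hX]

/-- On disjoint balls even operators commute whatever the signs. If the balls meet, the factor 3
ensures that both dressings check all links inside the ball around `p`. Signs that agree on these
links differ by a constant there, which `Y` does not see, so the claim reduces to `hXY`. -/
theorem dress_commute_of_mem_carEven {X Y : FOp (Mode N M)} {n p : Site N} {r : ℕ}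
    (hX : X ∈ carEven _ (K.matter N ∩ modesOn N M (siteBall n r)))
    (hY : Y ∈ carEven _ (K.matter N ∩ modesOn N M (siteBall p r))) (hXY : Commute X Y) :
    Commute (K.dress (ball n (3 * r)) X) (K.dress (ball p (3 * r)) Y) := by
  refine LinkModes.dress_commute (dressable_of_mem_carEven (by lia) hX)
    (dressable_of_mem_carEven (by lia) hY) fun g k hgk => ?_
  by_cases hd : Disjoint (siteBall n r) (siteBall p r)
  · refine carEven_commute_carLocal ?_ (signConj_mem_carEven _ hX)
      (carEven_le_carLocal _ (signConj_mem_carEven _ hY))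
    exact (modesOn_disjoint hd).mono Set.inter_subset_right Set.inter_subset_right
  · obtain ⟨q, hq, hq'⟩ := Set.not_disjoint_iff.1 hd
    -- So the ball of radius `r` around `p` lies inside the one of radius `3 * r` around `n`.
    have hp : p ∈ siteBall n (2 * r) :=
      siteBall_subset hq (by lia) (mem_siteBall_comm.1 hq')
    have h1 : siteConj (g * k) Y = Y := by
      refine siteConj_eq_self (n := p) (r := r) (fun e he => ?_) hY
      have h2 := hgk e (linksIn_mono (ball_subset hp (by lia)) he)
        (linksIn_mono (ball_subset (mem_siteBall_self p 0) (by lia)) he)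
      calc diffSign (g * k) e = diffSign g e * diffSign k e := mul_mul_mul_comm _ _ _ _
        _ = 1 := by rw [h2, Int.units_mul_self]
    have h2 : siteConj k Y = siteConj g Y := by
      conv_rhs => rw [← h1, siteConj_siteConj, ← mul_assoc]
      rw [show g * g = 1 from funext fun p => Int.units_mul_self _, one_mul]
    rw [h2]
    exact hXY.map (siteConj g)

theorem LinkModes.dress_add (W : Finset (Site N)) (X Y : FOp (Mode N M)) :
    K.dress W (X + Y) = K.dress W X + K.dress W Y := by
  rw [LinkModes.dress, LinkModes.dress, LinkModes.dress, ← smul_add, ← Finset.sum_add_distrib]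
  simp only [add_mul, map_add]

end Pair

end

noncomputable section

/-! ### The qubit circuit that simulates a fermionic evolution. -/

section FermionsToQubits

variable {d : ℕ} {N : Fin d → ℕ} {m M L : ℕ}

theorem qShift_toQ (v : Site N) {V : Set (Site N)} (hV : V.Finite) {X : FOp (Mode N M)}
    (hX : X ∈ carLocal _ (modesOn N M V)) (hinv : ∀ g : Site N → ℤˣ, siteConj g X = X) :
    qShift N _ v (toQ N M X) = toQ N M (permConj (shiftModes N M v) X) := by
  have h := permConj_toQ_symm v (toQ_mem_qEven hV hX hinv)
  rw [StarAlgEquiv.symm_apply_apply] at h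
  rw [h, StarAlgEquiv.apply_symm_apply]

variable (K : LinkModes d M)

/-- The embedding of the joint eigenspace of link operators into the space of qubit states. -/
def linkEmb (E : Finset (Site N × Fin d)) :
    ℓ²(Finset (Mode N M), ℂ) →L[ℂ] ℓ²(Site N →₀ Fin (2 ^ M), ℂ) :=
  relabel (modeConf N M) ∘L K.linkProj 1 E

variable {K}

theorem toQ_dress_comp_linkEmb {W : Finset (Site N)} {X : FOp (Mode N M)}
    (hX : K.Dressable W X) {E : Finset (Site N × Fin d)} (hE : linksIn W ⊆ E) :
    toQ N M (K.dress W X) ∘L linkEmb K E = linkEmb K E ∘L X := by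
  have h := LinkModes.dress_mul_linkProj hX hE
  rw [← (K.linkProj_commute_matter 1 E hX.matter).eq] at h
  rw [linkEmb, ← ContinuousLinearMap.comp_assoc]
  refine (congrArg (· ∘L K.linkProj 1 E) (relabelOp_comp_relabel (modeConf N M) _)).trans ?_
  exact congrArg (relabel (modeConf N M) ∘L ·) h

/-- Only the finitely many links in `W` have to equal one for the dressed operator to act as `X`. -/
theorem actsAs_toQ_dress {W : Finset (Site N)} {X : FOp (Mode N M)} (hX : K.Dressable W X) :
    ActsAs Filter.atTop (linkEmb K) (toQ N M (K.dress W X)) X := by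
  filter_upwards [Filter.eventually_ge_atTop (linksIn W)] with E hE
  refine ⟨toQ_dress_comp_linkEmb hX hE, ?_⟩
  rw [← map_star, LinkModes.star_dress hX]
  exact toQ_dress_comp_linkEmb hX.star hE

theorem eq_zero_of_actsAs {X : FOp (Mode N M)} (hX : X ∈ carLocal _ (K.matter N))
    (h : ActsAs Filter.atTop (linkEmb K) 0 X) : X = 0 := by
  obtain ⟨E, hE⟩ := h.exists
  refine K.eq_zero_of_linkProj_mul (χ := 1) (E := E) hX ?_
  have h1 := hE.1
  rw [ContinuousLinearMap.zero_comp] at h1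
  ext1 ψ
  have h2 := congrArg (fun A => relabel (modeConf N M).symm (A ψ)) h1
  simp only [zero_apply, map_zero] at h2
  refine Eq.trans ?_ h2.symm
  exact (relabel_symm_comp (modeConf N M) _).symm

/-- Dressing is multiplicative but need not map 1 to 1, so the generator is dressed instead of the
exchange. The identity `X * X = 2 * X` survives and suffices. -/
theorem dress_involution {W : Finset (Site N)} {X : FOp (Mode N M)} (hX : K.Dressable W X)
    (h : X * X = 2 * X) :
    (1 - K.dress W X) * (1 - K.dress W X) = 1 := by
  have h1 := LinkModes.dress_mul_dress hX hX
  rw [h, two_mul, LinkModes.dress_add] at h1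
  generalize K.dress W X = D at h1
  calc (1 - D) * (1 - D) = 1 - (D + D) + D * D := by noncomm_ring
    _ = 1 := by rw [h1, sub_add_cancel]

variable {f₁ f₂ : Fin m ↪o Fin M} {u : CAR (Mode N m) ≃⋆ₐ[ℂ] CAR (Mode N m)}

/-- The generator of the exchange of `evolvedAnnih f₁ u x` and `copyAnnih f₂ x`. -/
def evolvedGen (f₁ f₂ : Fin m ↪o Fin M) (u : CAR (Mode N m) ≃⋆ₐ[ℂ] CAR (Mode N m))
    (x : Site N × Fin m) : FOp (Mode N M) :=
  swapGen (evolvedAnnih f₁ u) (copyAnnih f₂) (toLex x)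

/-- The qubit gate that exchanges a mode in one copy of the system and an evolved mode in the
other. -/
def qubitGate (K : LinkModes d M) (L : ℕ) (f₁ f₂ : Fin m ↪o Fin M)
    (u : CAR (Mode N m) ≃⋆ₐ[ℂ] CAR (Mode N m)) (x : Site N × Fin m) : QOp N (2 ^ M) :=
  toQ N M (1 - K.dress (ball x.1 (3 * L)) (evolvedGen f₁ f₂ u x))

theorem evolvedGen_commute (hu : IsFQCA N m L u) (h12 : ∀ i j, f₁ i ≠ f₂ j)
    (x y : Site N × Fin m) : Commute (evolvedGen f₁ f₂ u x) (evolvedGen f₁ f₂ u y) := by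
  have := IsAddTorsionFree.of_isTorsionFree ℂ (FOp (Mode N M))
  exact (isCARPair_copies hu h12).swapGen_commute _ _

theorem evolvedGen_sq (hu : IsFQCA N m L u) (h12 : ∀ i j, f₁ i ≠ f₂ j) (x : Site N × Fin m) :
    evolvedGen f₁ f₂ u x * evolvedGen f₁ f₂ u x = 2 * evolvedGen f₁ f₂ u x := by
  have := IsAddTorsionFree.of_isTorsionFree ℂ (FOp (Mode N M))
  exact (isCARPair_copies hu h12).swapGen_sq _

theorem one_sub_evolvedGen_sq (hu : IsFQCA N m L u) (h12 : ∀ i j, f₁ i ≠ f₂ j)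
    (x : Site N × Fin m) :
    (1 - evolvedGen f₁ f₂ u x) * (1 - evolvedGen f₁ f₂ u x) = 1 := by
  have := IsAddTorsionFree.of_isTorsionFree ℂ (FOp (Mode N M))
  exact (isCARPair_copies hu h12).swap_sq _

theorem one_sub_evolvedGen_commute (hu : IsFQCA N m L u) (h12 : ∀ i j, f₁ i ≠ f₂ j)
    (x y : Site N × Fin m) :
    Commute (1 - evolvedGen f₁ f₂ u x) (1 - evolvedGen f₁ f₂ u y) :=
  ((Commute.one_left _).sub_left ((Commute.one_right _).sub_right (evolvedGen_commute hu h12 x y)))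

/-- The exchange maps the evolved operators of one copy to the operators of the other. -/
theorem eventually_exchange (hu : IsFQCA N m L u) (h12 : ∀ i j, f₁ i ≠ f₂ j)
    (x : CAR (Mode N m)) : ∀ᶠ s in Filter.atTop,
      gateProd _ (one_sub_evolvedGen_commute hu h12) s * copyHom N f₁ (u x)
        * gateProd _ (one_sub_evolvedGen_commute hu h12) s = copyHom N f₂ x := by
  have := IsAddTorsionFree.of_isTorsionFree ℂ (FOp (Mode N M))
  refine eventually_conj_of_mem_adjoin (S := CAR (Mode N m)) rfl
    (((copyHom N f₁).comp (CAR (Mode N m)).subtype).comp (equivHom u))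
    ((copyHom N f₂).comp (CAR (Mode N m)).subtype) (one_sub_evolvedGen_commute hu h12)
    (fun i => ?_) (one_sub_evolvedGen_sq hu h12) (fun x hx => ?_) x
  · rw [star_sub, star_one, evolvedGen, IsCARPair.star_swapGen]
  · obtain ⟨i, _, h⟩ := hx
    have h' : x = carGen _ i := Subtype.ext h
    subst h'
    filter_upwards [Filter.eventually_ge_atTop {ofLex i}] with s hs
    have hc := isCARPair_copies (f₁ := f₁) (f₂ := f₂) hu h12
    refine (gateProd_conj_eq (a := evolvedAnnih f₁ u i) (one_sub_evolvedGen_commute hu h12)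
      (one_sub_evolvedGen_sq hu h12) (i := ofLex i) (fun j hj => ?_)
      (Finset.singleton_subset_iff.1 hs)).trans ?_
    · exact (Commute.one_left _).sub_left (hc.swapGen_commute_A fun h => hj (congrArg ofLex h))
    · exact (hc.swap_conj i).trans (copyHom_annih f₂ i).symm

variable (hf₁ : ∀ i j, f₁ i ≠ K.pos j ∧ f₁ i ≠ K.neg j)
  (hf₂ : ∀ i j, f₂ i ≠ K.pos j ∧ f₂ i ≠ K.neg j)
include hf₁ hf₂

theorem evolvedGen_mem (hu : IsFQCA N m L u) (x : Site N × Fin m) : evolvedGen f₁ f₂ u x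
    ∈ carEven _ (K.matter N ∩ modesOn N M (siteBall x.1 L)) :=
  swapGen_mem_carEven hf₁ hf₂ hu (toLex x)

theorem evolvedGen_dressable (hu : IsFQCA N m L u) (x : Site N × Fin m) :
    K.Dressable (ball x.1 (3 * L)) (evolvedGen f₁ f₂ u x) :=
  dressable_of_mem_carEven (by lia) (evolvedGen_mem hf₁ hf₂ hu x)

theorem isGateLayer_qubitGate (hu : IsFQCA N m L u) (h12 : ∀ i j, f₁ i ≠ f₂ j) :
    IsGateLayer (qLocal N (2 ^ M)) (3 * L) (qubitGate K L f₁ f₂ u) where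
  comm x y := by
    refine Commute.map ?_ (toQ N M)
    exact (Commute.one_left _).sub_left ((Commute.one_right _).sub_right
      (dress_commute_of_mem_carEven (evolvedGen_mem hf₁ hf₂ hu x) (evolvedGen_mem hf₁ hf₂ hu y)
        (evolvedGen_commute hu h12 x y)))
  self x := by
    have h : star (evolvedGen f₁ f₂ u x) = evolvedGen f₁ f₂ u x := IsCARPair.star_swapGen _
    rw [qubitGate, ← map_star, star_sub, star_one,
      LinkModes.star_dress (evolvedGen_dressable hf₁ hf₂ hu x), h]
  sq x := by
    rw [qubitGate, ← map_mul, dress_involution (evolvedGen_dressable hf₁ hf₂ hu x)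
      (evolvedGen_sq hu h12 x), map_one]
  mem n i := by
    have h := evolvedGen_dressable hf₁ hf₂ hu (n, i)
    rw [qubitGate, map_sub, map_one]
    refine sub_mem (one_mem _) (qEven_le_qLocal (par := codeParity M) _ ?_)
    have h1 := LinkModes.dress_mem h
    rw [coe_ball] at h1
    exact toQ_mem_qEven (siteBall_finite n (3 * L)) h1 (LinkModes.siteConj_dress h)

theorem qShift_qubitGate (hu : IsFQCA N m L u) (v n : Site N) (i : Fin m) :
    qShift N _ v (qubitGate K L f₁ f₂ u (n, i)) = qubitGate K L f₁ f₂ u (n + v, i) := by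
  have h := evolvedGen_dressable hf₁ hf₂ hu (n, i)
  have h1 := LinkModes.dress_mem h
  have h2 := qShift_toQ v (Finset.finite_toSet _) h1 (LinkModes.siteConj_dress h)
  rw [qubitGate, map_sub, map_sub, map_one, map_one, h2, LinkModes.permConj_dress v h, ball_map,
    evolvedGen, permConj_swapGen hu]
  rw [qubitGate, map_sub, map_one]
  rfl

theorem actsAs_qubitGate (hu : IsFQCA N m L u) (x : Site N × Fin m) :
    ActsAs Filter.atTop (linkEmb K) (qubitGate K L f₁ f₂ u x) (1 - evolvedGen f₁ f₂ u x) := by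
  rw [qubitGate, map_sub, map_one]
  exact ActsAs.one.sub (actsAs_toQ_dress (evolvedGen_dressable hf₁ hf₂ hu x))

set_option maxHeartbeats 400000 in
-- The first layer exchanges the two copies, as for the identity evolution of range 0. The second
-- exchanges the evolved first copy with the second copy.
theorem exists_qca_simulates (h12 : ∀ i j, f₁ i ≠ f₂ j) (hu : IsFQCA N m L u) :
    ∃ w : QAlg N (2 ^ M) ≃⋆ₐ[ℂ] QAlg N (2 ^ M), IsQCA N (2 ^ M) (6 * L) w ∧
      Simulates (QAlg N (2 ^ M)) (qLocal N (2 ^ M)) w (CAR (Mode N m)) (fObs N m) u := by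
  have h0 := isGateLayer_qubitGate (K := K) hf₁ hf₂ (IsFQCA.refl N m) h12
  have h1 := isGateLayer_qubitGate (K := K) hf₁ hf₂ hu h12
  refine ⟨(h0.aut (isLocalNet_qLocal N _)).trans (h1.aut (isLocalNet_qLocal N _)), ?_, ?_⟩
  · have h := (h0.isQCA (qShift_qubitGate hf₁ hf₂ (IsFQCA.refl N m))).trans
      (h1.isQCA (qShift_qubitGate hf₁ hf₂ hu))
    -- A layer has twice the radius of its gates as range, and a gate needs a ball of radius three
    -- times the range of the evolution; the ranges of the layers add up.
    have e : 2 * (3 * 0) + 2 * (3 * L) = 6 * L := by lia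
    exact Eq.mp (congrArg (fun r => IsQCA N (2 ^ M) r _) e) h
  · refine simulates_of_swaps (l := Filter.atTop) (V := linkEmb K) (isLocalNet_qLocal N _) h0 h1
      (one_sub_evolvedGen_commute (IsFQCA.refl N m) h12) (one_sub_evolvedGen_commute hu h12)
      (one_sub_evolvedGen_sq (IsFQCA.refl N m) h12) (one_sub_evolvedGen_sq hu h12)
      (actsAs_qubitGate hf₁ hf₂ (IsFQCA.refl N m)) (actsAs_qubitGate hf₁ hf₂ hu)
      (fun S => carEven_mono (modesOn_mono (Set.subset_univ S))) (fun x => hu.map_mem_carEven_iff x)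
      (copyHom N f₁) (copyHom N f₂) (eventually_exchange (IsFQCA.refl N m) h12)
      (eventually_exchange hu h12) (fun x hx h => ?_) fun n r x hx => ?_
    · have hm : copyHom N f₁ x ∈ carLocal _ (K.matter N ∩ modesOn N M Set.univ) :=
        copyHom_mem hf₁ hx
      exact embHom_injective (modeEmb N f₁)
        (eq_zero_of_actsAs (carLocal_mono Set.inter_subset_left hm) h)
    · have hd : K.Dressable (ball n r) (copyHom N f₁ x) :=
        dressable_of_mem_carEven le_rfl (copyHom_mem_carEven hf₁ hx)
      have hm := LinkModes.dress_mem hd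
      rw [coe_ball] at hm
      have hq : toQ N M (K.dress (ball n r) (copyHom N f₁ x)) ∈ qLocal N (2 ^ M) (siteBall n r) :=
        qEven_le_qLocal _ (toQ_mem_qEven (siteBall_finite n r) hm (LinkModes.siteConj_dress hd))
      exact ⟨⟨_, qLocal_mono (Set.subset_univ _) hq⟩, hq, actsAs_toQ_dress hd⟩

end FermionsToQubits

/-- `m + 2 * d` additional qubits per site are enough to simulate `m` fermionic modes. -/
theorem qubits_simulate_fermions (d m L : ℕ) (N : Fin d → ℕ)
    (u : CAR (Mode N m) ≃⋆ₐ[ℂ] CAR (Mode N m)) (hu : IsFQCA N m L u) :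
    ∃ w : QAlg N (2 ^ (m + (m + 2 * d))) ≃⋆ₐ[ℂ] QAlg N (2 ^ (m + (m + 2 * d))),
      IsQCA N (2 ^ (m + (m + 2 * d))) (6 * L) w ∧
      Simulates (QAlg N (2 ^ (m + (m + 2 * d)))) (qLocal N (2 ^ (m + (m + 2 * d)))) w
        (CAR (Mode N m)) (fObs N m) u := by
  -- The modes at a site are, in this order: `m` for the first copy, `m` for the second, `d` for
  -- outgoing links and `d` for incoming links.
  let K : LinkModes d (m + (m + 2 * d)) :=
    { pos := fun j => ⟨m + (m + j), by lia⟩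
      neg := fun j => ⟨m + (m + (d + j)), by lia⟩
      pos_inj := fun i j h => by
        have := Fin.mk.inj_iff.1 h
        exact Fin.ext (by lia)
      neg_inj := fun i j h => by
        have := Fin.mk.inj_iff.1 h
        exact Fin.ext (by lia)
      pos_ne_neg := fun i j h => by
        have := Fin.mk.inj_iff.1 h
        lia }
  let f₁ : Fin m ↪o Fin (m + (m + 2 * d)) :=
    OrderEmbedding.ofStrictMono (fun i => ⟨i, by lia⟩) fun i j h => h
  let f₂ : Fin m ↪o Fin (m + (m + 2 * d)) :=
    OrderEmbedding.ofStrictMono (fun i => ⟨m + i, by lia⟩) fun i j h =>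
      Fin.mk_lt_mk.2 (Nat.add_lt_add_left h m)
  refine exists_qca_simulates (K := K) (f₁ := f₁) (f₂ := f₂) (fun i j => ⟨fun h => ?_, fun h => ?_⟩)
    (fun i j => ⟨fun h => ?_, fun h => ?_⟩) (fun i j h => ?_) hu
  all_goals
    have := Fin.mk.inj_iff.1 h
    lia

end

noncomputable section

/-! ## Exchanging two copies of a matrix algebra -/

section MatrixSwap

variable {R J : Type*} [Ring R] [StarRing R] [Fintype J] [DecidableEq J]

/-- A system of matrix units. -/
structure IsMatrixUnits (A : J → J → R) : Prop where
  mul : ∀ a b c e, A a b * A c e = if b = c then A a e else 0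
  sum : ∑ a, A a a = 1
  star : ∀ a b, star (A a b) = A b a

/-- Two commuting systems of matrix units. -/
structure IsMatrixPair (A B : J → J → R) : Prop where
  unitsA : IsMatrixUnits A
  unitsB : IsMatrixUnits B
  comm : ∀ a b c e, Commute (A a b) (B c e)

theorem isMatrixUnits_map_equiv {O : Type*} [Ring O] [Algebra ℂ O] [StarRing O] [StarModule ℂ O]
    [Algebra ℂ R] {S : StarSubalgebra ℂ O} (w : S ≃⋆ₐ[ℂ] S) (φ : O →⋆ₐ[ℂ] R) {A : J → J → S}
    (h : IsMatrixUnits fun a b => (A a b : O)) :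
    IsMatrixUnits fun a b => φ (w (A a b) : O) := by
  have hm : ∀ a b c e, A a b * A c e = if b = c then A a e else 0 := fun a b c e =>
    Subtype.ext ((h.mul a b c e).trans (by split_ifs <;> rfl))
  have hs : ∑ a, A a a = 1 := Subtype.ext ((map_sum S.subtype _ _).trans h.sum)
  have ht : ∀ a b, star (A a b) = A b a := fun a b => Subtype.ext (h.star a b)
  let ψ : S →⋆ₐ[ℂ] R := (φ.comp S.subtype).comp (equivHom w)
  refine ⟨fun a b c e => ?_, ?_, fun a b => ?_⟩
  · change ψ (A a b) * ψ (A c e) = if b = c then ψ (A a e) else 0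
    rw [← map_mul, hm]
    split_ifs
    · rfl
    · exact map_zero ψ
  · change ∑ a, ψ (A a a) = 1
    rw [← map_sum, hs, map_one]
  · change star (ψ (A a b)) = ψ (A b a)
    rw [← map_star, ht]

/-- The operator that exchanges two systems of matrix units. -/
def matrixSwap (A B : J → J → R) : R := ∑ a, ∑ b, A a b * B b a

namespace IsMatrixPair

variable {A B : J → J → R} (h : IsMatrixPair A B)
include h

/-- The flip times `A a b` and `B a b` times the flip reduce to the same sum; together with
`swap_sq` this gives the exchange. -/
theorem swap_mul (a b : J) : matrixSwap A B * A a b = ∑ c, A c b * B a c := by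
  rw [matrixSwap, Finset.sum_mul]
  refine Finset.sum_congr rfl fun c _ => ?_
  rw [Finset.sum_mul, Finset.sum_eq_single a]
  · rw [mul_assoc, ← (h.comm a b a c).eq, ← mul_assoc, h.unitsA.mul, if_pos rfl]
  · intro e _ he
    rw [mul_assoc, ← (h.comm a b e c).eq, ← mul_assoc, h.unitsA.mul, if_neg he, zero_mul]
  · exact fun he => (he (Finset.mem_univ a)).elim

theorem mul_swap (a b : J) : B a b * matrixSwap A B = ∑ c, A c b * B a c := by
  rw [matrixSwap, Finset.mul_sum]
  refine Finset.sum_congr rfl fun c _ => ?_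
  rw [Finset.mul_sum, Finset.sum_eq_single b]
  · rw [← mul_assoc, ← (h.comm c b a b).eq, mul_assoc, h.unitsB.mul, if_pos rfl]
  · intro e _ he
    rw [← mul_assoc, ← (h.comm c e a b).eq, mul_assoc, h.unitsB.mul, if_neg he.symm, mul_zero]
  · exact fun he => (he (Finset.mem_univ b)).elim

theorem swap_sq : matrixSwap A B * matrixSwap A B = 1 := by
  nth_rw 2 [matrixSwap]
  have e : ∀ a b, matrixSwap A B * (A a b * B b a) = A b b * B a a := fun a b => by
    rw [← mul_assoc, h.swap_mul, Finset.sum_mul, Finset.sum_eq_single b]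
    · rw [mul_assoc, h.unitsB.mul, if_pos rfl]
    · intro c _ hc
      rw [mul_assoc, h.unitsB.mul, if_neg hc, mul_zero]
    · exact fun he => (he (Finset.mem_univ b)).elim
  simp_rw [Finset.mul_sum, e, ← Finset.sum_mul, h.unitsA.sum, one_mul]
  exact h.unitsB.sum

theorem star_swap : star (matrixSwap A B) = matrixSwap A B := by
  simp_rw [matrixSwap, star_sum, star_mul, h.unitsA.star, h.unitsB.star, ← (h.comm _ _ _ _).eq]
  exact Finset.sum_comm

theorem swap_conj (a b : J) : matrixSwap A B * A a b * matrixSwap A B = B a b := by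
  rw [h.swap_mul, ← h.mul_swap, mul_assoc, h.swap_sq, mul_one]

end IsMatrixPair

theorem matrixSwap_commute {A B : J → J → R} {x : R} (hA : ∀ a b, Commute (A a b) x)
    (hB : ∀ a b, Commute (B a b) x) : Commute (matrixSwap A B) x :=
  Commute.sum_left _ _ _ fun a _ => Commute.sum_left _ _ _ fun b _ => (hA a b).mul_left (hB b a)

end MatrixSwap

/-! ## Two copies of a system inside a larger one -/

section Ambient

/-- The projection onto the span of a set of basis vectors. -/
def indic {X : Type} (S : Set X) : ℓ²(X, ℂ) →L[ℂ] ℓ²(X, ℂ) :=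
  open Classical in wcomp (fun x => if x ∈ S then 1 else 0) id (by intro x; split_ifs <;> simp)
    (Function.injective_id.injOn)

open Classical in
theorem indic_apply {X : Type} (S : Set X) (ψ x) : indic S ψ x = if x ∈ S then ψ x else 0 := by
  refine (wcomp_apply _ _ _ _ ψ x).trans ?_
  split_ifs <;> simp

theorem star_indic {X : Type} (S : Set X) : star (indic S) = indic S :=
  star_wcomp _ _ _ _ (fun x _ => ⟨rfl, by simp only [id]; split_ifs <;> simp⟩)
    fun x _ => ⟨rfl, by simp only [id]; split_ifs <;> simp⟩

theorem indic_mul_indic {X : Type} (S T : Set X) : indic S * indic T = indic (S ∩ T) :=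
  l2op_ext fun ψ x => by
    classical
    rw [mul_apply_eq_comp, indic_apply, indic_apply, indic_apply]
    by_cases h1 : x ∈ S <;> by_cases h2 : x ∈ T <;> simp [h1, h2]

variable {d : ℕ} {N : Fin d → ℕ} {D F : ℕ} [NeZero D] [NeZero F]

variable (N D F) in
/-- Configurations of two systems of cell dimension `D` and one of cell dimension `F`. -/
abbrev Amb : Type := (Site N →₀ Fin D) × (Site N →₀ Fin D) × (Site N →₀ Fin F)

variable (N D F) in
/-- Operators on the space spanned by `Amb N D F`. -/
abbrev AmbOp : Type := ℓ²(Amb N D F, ℂ) →L[ℂ] ℓ²(Amb N D F, ℂ)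

variable (N D F) in
/-- Operators of the first system. -/
def firstHom : QOp N D →⋆ₐ[ℂ] AmbOp N D F := ampl _ _

variable (N D F) in
/-- Exchange of the first two systems. -/
def swapAmb : Amb N D F ≃ Amb N D F where
  toFun x := (x.2.1, x.1, x.2.2)
  invFun x := (x.2.1, x.1, x.2.2)

variable (N D F) in
/-- Operators of the second system. -/
def secondHom : QOp N D →⋆ₐ[ℂ] AmbOp N D F :=
  (equivHom (relabelOp (swapAmb N D F))).comp (firstHom N D F)

variable (N D F) in
/-- Cyclic exchange of the systems. -/
def cycleAmb : (Site N →₀ Fin F) × (Site N →₀ Fin D) × (Site N →₀ Fin D) ≃ Amb N D F where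
  toFun x := (x.2.1, x.2.2, x.1)
  invFun x := (x.2.2, x.1, x.2.1)

variable (N D F) in
/-- Operators of the third system. -/
def thirdHom : QOp N F →⋆ₐ[ℂ] AmbOp N D F :=
  (equivHom (relabelOp (cycleAmb N D F))).comp (ampl _ _)

open Classical in
theorem firstHom_qUnit (n : Site N) (a b : Fin D) (ψ) (x : Amb N D F) :
    firstHom N D F (qUnit N D n a b) ψ x
      = if x.1 n = a then ψ (x.1.update n b, x.2) else 0 := by
  refine (ampl_apply _ ψ x).trans ((qUnit_apply n a b _ x.1).trans ?_)
  rw [slice_apply]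

open Classical in
theorem secondHom_qUnit (n : Site N) (a b : Fin D) (ψ) (x : Amb N D F) :
    secondHom N D F (qUnit N D n a b) ψ x
      = if x.2.1 n = a then ψ (x.1, x.2.1.update n b, x.2.2) else 0 := by
  refine (relabelOp_apply (swapAmb N D F) _ ψ x).trans ((firstHom_qUnit n a b _ _).trans ?_)
  rw [relabel_apply]
  rfl

open Classical in
theorem thirdHom_qUnit (n : Site N) (a b : Fin F) (ψ) (x : Amb N D F) :
    thirdHom N D F (qUnit N F n a b) ψ x
      = if x.2.2 n = a then ψ (x.1, x.2.1, x.2.2.update n b) else 0 := by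
  refine (relabelOp_apply (cycleAmb N D F) _ ψ x).trans
    ((ampl_apply _ _ _).trans ((qUnit_apply n a b _ _).trans ?_))
  rw [slice_apply, relabel_apply]
  rfl

/-- States of the first system tensored with the reference configurations of the other two satisfy
the condition on the third system, and on them the operator acts as `A`. -/
theorem firstHom_injective {A : QOp N D} (h : indic {x : Amb N D F | ∀ n, x.2.2 n = 0}
    * firstHom N D F A = 0) : A = 0 := by
  refine l2op_ext fun ψ s => ?_
  have h1 := congrArg (fun B : AmbOp N D F =>
    B (ContinuousLinearMap.adjoint (slice (0, 0)) ψ) (s, 0, 0)) h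
  have h2 : slice ((0, 0) : (Site N →₀ Fin D) × (Site N →₀ Fin F))
      (ContinuousLinearMap.adjoint (slice (0, 0)) ψ) = ψ := by
    ext x
    rw [slice_apply, adjoint_slice_apply, if_pos rfl]
  have h3 := (indic_apply {x : Amb N D F | ∀ n, x.2.2 n = 0} (firstHom N D F A
    (ContinuousLinearMap.adjoint (slice (0, 0)) ψ)) (s, 0, 0))
  rw [if_pos (show (s, 0, 0) ∈ {x : Amb N D F | ∀ n, x.2.2 n = 0} from fun n => rfl)] at h3
  have h4 : firstHom N D F A (ContinuousLinearMap.adjoint (slice (0, 0)) ψ) (s, 0, 0)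
      = A ψ s := by
    refine (ampl_apply _ _ _).trans ?_
    change A (slice (0, 0) _) s = _
    rw [h2]
  exact h4.symm.trans (h3.symm.trans h1)

theorem hom_commute_of_mem_qLocal {B : Type*} [Ring B] [Algebra ℂ B] [StarRing B] [StarModule ℂ B]
    (f : QOp N D →⋆ₐ[ℂ] B) {z : B} {V : Set (Site N)}
    (h : ∀ n ∈ V, ∀ a b, Commute z (f (qUnit N D n a b))) {A : QOp N D} (hA : A ∈ qLocal N D V) :
    Commute z (f A) := by
  refine intertwine_of_mem_adjoin f f z ?_ hA
  rintro _ ⟨n, hn, a, b, rfl⟩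
  rw [star_qUnit]
  exact ⟨h n hn a b, h n hn b a⟩

theorem first_commute_second {A B : QOp N D} (hA : A ∈ QAlg N D) (hB : B ∈ QAlg N D) :
    Commute (firstHom N D F A) (secondHom N D F B) := by
  refine hom_commute_of_mem_qLocal _ (fun n _ a b => ?_) hB
  refine (hom_commute_of_mem_qLocal _ (fun m _ c e => ?_) hA).symm
  refine l2op_ext fun ψ x => ?_
  rw [mul_apply_eq_comp, mul_apply_eq_comp, firstHom_qUnit, secondHom_qUnit, firstHom_qUnit,
    secondHom_qUnit]
  simp only
  split_ifs <;> rfl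

theorem third_commute_first (n : Site N) (a b : Fin F) {A : QOp N D} (hA : A ∈ QAlg N D) :
    Commute (thirdHom N D F (qUnit N F n a b)) (firstHom N D F A) := by
  refine hom_commute_of_mem_qLocal _ (fun m _ c e => ?_) hA
  refine l2op_ext fun ψ x => ?_
  rw [mul_apply_eq_comp, mul_apply_eq_comp, firstHom_qUnit, thirdHom_qUnit, firstHom_qUnit,
    thirdHom_qUnit]
  simp only
  split_ifs <;> rfl

theorem third_commute_second (n : Site N) (a b : Fin F) {A : QOp N D} (hA : A ∈ QAlg N D) :
    Commute (thirdHom N D F (qUnit N F n a b)) (secondHom N D F A) := by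
  refine hom_commute_of_mem_qLocal _ (fun m _ c e => ?_) hA
  refine l2op_ext fun ψ x => ?_
  rw [mul_apply_eq_comp, mul_apply_eq_comp, secondHom_qUnit, thirdHom_qUnit, secondHom_qUnit,
    thirdHom_qUnit]
  simp only
  split_ifs <;> rfl

theorem indic_commute_first {S : Set (Amb N D F)} {V : Set (Site N)}
    (hS : ∀ n ∈ V, ∀ (b : Fin D) (x : Amb N D F), open Classical in
      ((x.1.update n b, x.2) ∈ S ↔ x ∈ S)) {A : QOp N D} (hA : A ∈ qLocal N D V) :
    Commute (indic S) (firstHom N D F A) := by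
  classical
  refine hom_commute_of_mem_qLocal _ (fun n hn a b => ?_) hA
  refine l2op_ext fun ψ x => ?_
  rw [mul_apply_eq_comp, mul_apply_eq_comp, firstHom_qUnit, indic_apply, indic_apply,
    firstHom_qUnit]
  simp only [hS n hn b x]
  split_ifs <;> rfl

theorem indic_commute_second {S : Set (Amb N D F)} {V : Set (Site N)}
    (hS : ∀ n ∈ V, ∀ (b : Fin D) (x : Amb N D F), open Classical in
      ((x.1, x.2.1.update n b, x.2.2) ∈ S ↔ x ∈ S)) {A : QOp N D} (hA : A ∈ qLocal N D V) :
    Commute (indic S) (secondHom N D F A) := by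
  classical
  refine hom_commute_of_mem_qLocal _ (fun n hn a b => ?_) hA
  refine l2op_ext fun ψ x => ?_
  rw [mul_apply_eq_comp, mul_apply_eq_comp, secondHom_qUnit, indic_apply, indic_apply,
    secondHom_qUnit]
  simp only [hS n hn b x]
  split_ifs <;> rfl

variable (F) in
/-- Operators of the first two systems at the sites in `W`. -/
def pairLocal (W : Set (Site N)) : StarSubalgebra ℂ (AmbOp N D F) :=
  StarAlgebra.adjoin ℂ (firstHom N D F '' qLocal N D W ∪ secondHom N D F '' qLocal N D W)

theorem first_mem_pairLocal {W : Set (Site N)} {A : QOp N D} (hA : A ∈ qLocal N D W) :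
    firstHom N D F A ∈ pairLocal F W :=
  StarAlgebra.subset_adjoin ℂ _ (Or.inl ⟨A, hA, rfl⟩)

theorem second_mem_pairLocal {W : Set (Site N)} {A : QOp N D} (hA : A ∈ qLocal N D W) :
    secondHom N D F A ∈ pairLocal F W :=
  StarAlgebra.subset_adjoin ℂ _ (Or.inr ⟨A, hA, rfl⟩)

theorem commute_pairLocal {W : Set (Site N)} {z : AmbOp N D F}
    (h1 : ∀ A ∈ qLocal N D W, Commute z (firstHom N D F A))
    (h2 : ∀ A ∈ qLocal N D W, Commute z (secondHom N D F A)) {X : AmbOp N D F}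
    (hX : X ∈ pairLocal F W) : Commute z X := by
  refine commute_of_mem_adjoin ?_ hX
  rintro _ (⟨A, hA, rfl⟩ | ⟨A, hA, rfl⟩)
  · exact ⟨h1 A hA, (map_star (firstHom N D F) A) ▸ h1 (star A) (star_mem hA)⟩
  · exact ⟨h2 A hA, (map_star (secondHom N D F) A) ▸ h2 (star A) (star_mem hA)⟩

theorem indic_commute_pairLocal {S : Set (Amb N D F)} {W : Set (Site N)}
    (h1 : ∀ n ∈ W, ∀ (b : Fin D) (x : Amb N D F), open Classical in
      ((x.1.update n b, x.2) ∈ S ↔ x ∈ S))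
    (h2 : ∀ n ∈ W, ∀ (b : Fin D) (x : Amb N D F), open Classical in
      ((x.1, x.2.1.update n b, x.2.2) ∈ S ↔ x ∈ S)) {X : AmbOp N D F} (hX : X ∈ pairLocal F W) :
    Commute (indic S) X :=
  commute_pairLocal (fun _ hA => indic_commute_first h1 hA)
    (fun _ hA => indic_commute_second h2 hA) hX

end Ambient

end

noncomputable section

/-! ## Encoding two copies of a system -/

/-- An encoding of pairs of states of `D`-dimensional systems as even states of an `F`-dimensional
system. -/
structure PairCode (D F : ℕ) [NeZero D] [NeZero F] (par : Fin F → ℤˣ) where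
  code : Fin D × Fin D → Fin F
  inj : Function.Injective code
  zero : code 0 = 0
  even : ∀ t, par (code t) = 1

section Encode

variable {d : ℕ} {N : Fin d → ℕ} {D F : ℕ} [NeZero D] [NeZero F] {par : Fin F → ℤˣ}
  (C : PairCode D F par)

namespace PairCode

open Classical in
/-- The pair of states encoded by a state. -/
def dec₁ (a : Fin F) : Fin D × Fin D :=
  if a ∈ Set.range C.code then Function.invFun C.code a else 0

open Classical in
/-- The part of a state that does not encode a pair of states. -/
def dec₂ (a : Fin F) : Fin F := if a ∈ Set.range C.code then 0 else a

/-- The inverse of `dec₁` and `dec₂`. -/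
def enc (t : Fin D × Fin D) (a : Fin F) : Fin F := if a = 0 then C.code t else a

theorem dec₁_code (t) : C.dec₁ (C.code t) = t := by
  rw [dec₁, if_pos ⟨t, rfl⟩, Function.leftInverse_invFun C.inj]

theorem dec₂_code (t) : C.dec₂ (C.code t) = 0 := if_pos ⟨t, rfl⟩

theorem dec₂_of_notMem {a : Fin F} (h : a ∉ Set.range C.code) : C.dec₂ a = a := if_neg h

theorem dec₁_zero : C.dec₁ 0 = 0 := by rw [← C.zero, dec₁_code]

theorem dec₂_zero : C.dec₂ 0 = 0 := by rw [← C.zero, dec₂_code, C.zero]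

theorem mem_range_of_dec₂ {a : Fin F} (h : C.dec₂ a = 0) : a ∈ Set.range C.code := by
  by_contra ha
  rw [dec₂_of_notMem C ha] at h
  exact ha ⟨0, by rw [C.zero, h]⟩

theorem enc_dec (a : Fin F) : C.enc (C.dec₁ a) (C.dec₂ a) = a := by
  by_cases ha : a ∈ Set.range C.code
  · obtain ⟨t, rfl⟩ := ha
    rw [dec₁_code, dec₂_code, enc, if_pos rfl]
  · rw [dec₂_of_notMem C ha, enc, if_neg]
    rintro rfl
    exact ha ⟨0, C.zero⟩

/-- The decoded configurations. -/
def dec (f : Site N →₀ Fin F) : Amb N D F :=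
  (f.mapRange (fun a => (C.dec₁ a).1) (by rw [dec₁_zero]; rfl),
    f.mapRange (fun a => (C.dec₁ a).2) (by rw [dec₁_zero]; rfl), f.mapRange C.dec₂ C.dec₂_zero)

/-- The encoded configuration. -/
def encAll (x : Amb N D F) : Site N →₀ Fin F :=
  Finsupp.ofSupportFinite (fun n => C.enc (x.1 n, x.2.1 n) (x.2.2 n)) (by
    classical
    refine (x.1.support ∪ x.2.1.support ∪ x.2.2.support).finite_toSet.subset fun n hn => ?_
    by_contra h
    simp only [Finset.coe_union, Set.mem_union, Finset.mem_coe, Finsupp.mem_support_iff, not_or,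
      not_not] at h
    refine hn ?_
    change C.enc (x.1 n, x.2.1 n) (x.2.2 n) = 0
    rw [h.1.1, h.1.2, h.2, enc, if_pos rfl]
    exact C.zero)

/-- The decoded configurations are characterised by this. -/
def good (N : Fin d → ℕ) : Set (Amb N D F) :=
  {x | ∀ n, C.dec₁ (C.enc (x.1 n, x.2.1 n) (x.2.2 n)) = (x.1 n, x.2.1 n) ∧
    C.dec₂ (C.enc (x.1 n, x.2.1 n) (x.2.2 n)) = x.2.2 n}

theorem encAll_dec (f : Site N →₀ Fin F) : C.encAll (C.dec f) = f := by
  ext1 n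
  exact C.enc_dec (f n)

theorem dec_mem_good (f : Site N →₀ Fin F) : C.dec f ∈ C.good N := fun n => by
  have e : C.enc ((C.dec f).1 n, (C.dec f).2.1 n) ((C.dec f).2.2 n) = f n := C.enc_dec (f n)
  rw [e]
  exact ⟨rfl, rfl⟩

theorem dec_encAll {x : Amb N D F} (hx : x ∈ C.good N) : C.dec (C.encAll x) = x := by
  refine Prod.ext ?_ (Prod.ext ?_ ?_)
  · ext1 n
    exact congrArg Prod.fst (hx n).1
  · ext1 n
    exact congrArg Prod.snd (hx n).1
  · ext1 n
    exact (hx n).2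

/-- Restriction to decoded configurations. -/
def restr (N : Fin d → ℕ) : ℓ²(Amb N D F, ℂ) →L[ℂ] ℓ²(Site N →₀ Fin F, ℂ) :=
  wcomp (fun _ => 1) C.dec (by simp) fun f _ g _ h => by
    rw [← C.encAll_dec f, h, C.encAll_dec]

theorem restr_apply (ψ) (f : Site N →₀ Fin F) : C.restr N ψ f = ψ (C.dec f) :=
  (wcomp_apply _ _ _ _ ψ f).trans (one_mul _)

/-- The isometry given by the decoded configurations. -/
def isom (N : Fin d → ℕ) : ℓ²(Site N →₀ Fin F, ℂ) →L[ℂ] ℓ²(Amb N D F, ℂ) :=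
  ContinuousLinearMap.adjoint (C.restr N)

open Classical in
theorem isom_apply (ψ) (x : Amb N D F) :
    C.isom N ψ x = if x ∈ C.good N then ψ (C.encAll x) else 0 := by
  have h1 : ∀ x : Amb N D F, (if x ∈ C.good N then (1 : ℂ) else 0) ≠ 0 → x ∈ C.good N :=
    fun x hx => by
      by_contra h
      rw [if_neg h] at hx
      exact hx rfl
  refine (adjoint_wcomp_apply _ _ (fun x => if x ∈ C.good N then 1 else 0) C.encAll
    (by intro x; split_ifs <;> simp) ?_ ?_ ?_ ψ x).trans ?_
  · intro x hx y hy h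
    rw [← C.dec_encAll (h1 x hx), h, C.dec_encAll (h1 y hy)]
  · intro f _
    exact ⟨C.encAll_dec f, by rw [if_pos (C.dec_mem_good f), star_one]⟩
  · intro x hx
    exact ⟨C.dec_encAll (h1 x hx), by rw [if_pos (h1 x hx), star_one]⟩
  · split_ifs <;> simp

theorem restr_comp_isom : C.restr N ∘L C.isom N = 1 := l2op_ext fun ψ f => by
  refine (C.restr_apply _ f).trans ((C.isom_apply ψ _).trans ?_)
  rw [if_pos (C.dec_mem_good f), C.encAll_dec]
  rfl

theorem isom_comp_restr : C.isom N ∘L C.restr N = indic (C.good N) := l2op_ext fun ψ x => by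
  refine (C.isom_apply _ x).trans (Eq.trans ?_ (indic_apply _ ψ x).symm)
  split_ifs with h
  · exact (C.restr_apply ψ _).trans (by rw [C.dec_encAll h])
  · rfl

/-- The configurations that encode states of two copies at the sites in `W`. -/
def coded (W : Set (Site N)) : Set (Amb N D F) := {x | x ∈ C.good N ∧ ∀ n ∈ W, x.2.2 n = 0}

/-- The encoded operator that acts like `X` on states of two copies. -/
def sandwich (A : AmbOp N D F) : QOp N F := C.restr N ∘L A ∘L C.isom N

theorem sandwich_mul (A B : AmbOp N D F) :
    C.sandwich A * C.sandwich B = C.sandwich (A * (indic (C.good N) * B)) := by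
  rw [← C.isom_comp_restr]
  rfl

theorem star_sandwich (A : AmbOp N D F) : star (C.sandwich A) = C.sandwich (star A) := by
  rw [sandwich, ContinuousLinearMap.star_eq_adjoint, ContinuousLinearMap.adjoint_comp,
    ContinuousLinearMap.adjoint_comp, isom, ContinuousLinearMap.adjoint_adjoint]
  rfl

theorem sandwich_add (A B : AmbOp N D F) :
    C.sandwich (A + B) = C.sandwich A + C.sandwich B := by
  rw [sandwich, ContinuousLinearMap.add_comp, ContinuousLinearMap.comp_add]
  rfl

/-- The operator that acts as `X` where all sites in `W` encode states of two copies, and vanishes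
otherwise. -/
def lift (W : Set (Site N)) (X : AmbOp N D F) : QOp N F := C.sandwich (X * indic (C.coded W))

variable {C} {W W' : Set (Site N)} {X Y : AmbOp N D F}

/-- At a site of `W` the third component is 0, and then every pair of states is a valid code word.
So operators of the first two systems on `W` cannot leave the coded configurations. -/
theorem coded_commute (hX : X ∈ pairLocal F W) : Commute (indic (C.coded W)) X := by
  classical
  have key : ∀ (x y : Amb N D F) (n : Site N), n ∈ W → y.2.2 = x.2.2 →
      (∀ m, m ≠ n → y.1 m = x.1 m ∧ y.2.1 m = x.2.1 m) → x ∈ C.coded W → y ∈ C.coded W := by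
    intro x y n hn h2 h1 hx
    refine ⟨fun m => ?_, fun m hm => by rw [h2]; exact hx.2 m hm⟩
    by_cases hmn : m = n
    · have h0 : x.2.2 m = 0 := hx.2 m (hmn ▸ hn)
      rw [h2, h0, enc, if_pos rfl, dec₁_code, dec₂_code]
      exact ⟨rfl, rfl⟩
    · rw [h2, (h1 m hmn).1, (h1 m hmn).2]
      exact hx.1 m
  refine indic_commute_pairLocal (fun n hn b x => ?_) (fun n hn b x => ?_) hX
  · have e : ∀ m, m ≠ n → (x.1.update n b) m = x.1 m := fun m hm => by
      rw [Finsupp.coe_update, Function.update_of_ne hm]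
    exact ⟨key _ _ n hn rfl fun m hm => ⟨(e m hm).symm, rfl⟩,
      key _ _ n hn rfl fun m hm => ⟨e m hm, rfl⟩⟩
  · have e : ∀ m, m ≠ n → (x.2.1.update n b) m = x.2.1 m := fun m hm => by
      rw [Finsupp.coe_update, Function.update_of_ne hm]
    exact ⟨key _ _ n hn rfl fun m hm => ⟨rfl, (e m hm).symm⟩,
      key _ _ n hn rfl fun m hm => ⟨rfl, e m hm⟩⟩

theorem third_commute (V : Set (Site N)) (hX : X ∈ pairLocal F W) :
    Commute (indic {x : Amb N D F | ∀ n ∈ V, x.2.2 n = 0}) X :=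
  indic_commute_pairLocal (fun _ _ _ _ => Iff.rfl) (fun _ _ _ _ => Iff.rfl) hX

theorem coded_union : (C.coded W : Set (Amb N D F)) ∩ C.coded W'
    = C.coded W ∩ {x | ∀ n ∈ W', x.2.2 n = 0} := by
  ext x
  exact ⟨fun h => ⟨h.1, h.2.2⟩, fun h => ⟨h.1, h.1.1, h.2⟩⟩

theorem coded_inter_commute (hX : X ∈ pairLocal F W) :
    Commute (indic (C.coded W ∩ C.coded W')) X := by
  rw [coded_union, ← indic_mul_indic]
  exact (coded_commute hX).mul_left (third_commute W' hX)

theorem star_lift (hX : X ∈ pairLocal F W) : star (C.lift W X) = C.lift W (star X) := by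
  rw [lift, star_sandwich, star_mul, star_indic, (coded_commute (star_mem hX)).eq]
  rfl

/-- Between `X` and `Y` only the projection onto configurations coded on both sets remains. -/
theorem lift_mul_lift' (hY : Y ∈ pairLocal F W') :
    C.lift W X * C.lift W' Y = C.sandwich (X * (indic (C.coded W ∩ C.coded W') * Y)) := by
  have h1 : indic (C.good N) * indic (C.coded W' : Set (Amb N D F)) = indic (C.coded W') := by
    rw [indic_mul_indic]
    congr 1
    exact Set.inter_eq_right.2 fun x hx => hx.1
  rw [lift, lift, sandwich_mul, ← (coded_commute hY).eq, ← indic_mul_indic]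
  congr 1
  rw [← mul_assoc (indic (C.good N)), h1, mul_assoc, mul_assoc]

theorem lift_mul_lift (hY : Y ∈ pairLocal F W) :
    C.lift W X * C.lift W Y = C.lift W (X * Y) := by
  rw [lift_mul_lift' hY, Set.inter_self, (coded_commute hY).eq, ← mul_assoc, lift]

/-- Both operators commute with the projection onto configurations coded on both sets, so the two
products of lifts come from `X * Y` and `Y * X`. -/
theorem lift_commute (hX : X ∈ pairLocal F W) (hY : Y ∈ pairLocal F W') (h : Commute X Y) :
    Commute (C.lift W X) (C.lift W' Y) := by
  have h1 := lift_mul_lift' (C := C) (W := W) (X := X) hY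
  have h2 := lift_mul_lift' (C := C) (W := W') (X := Y) hX
  have c1 := coded_inter_commute (C := C) (W' := W') hX
  have c2 := coded_inter_commute (C := C) (W' := W) hY
  rw [Set.inter_comm] at c2 h2
  refine h1.trans (Eq.trans (congrArg C.sandwich ?_) h2.symm)
  rw [← mul_assoc, ← c1.eq, mul_assoc, h.eq, ← mul_assoc, c2.eq, mul_assoc]

theorem lift_involution (hX : X ∈ pairLocal F W) (h : X * X = 2 * X) :
    (1 - C.lift W X) * (1 - C.lift W X) = 1 := by
  have h1 := lift_mul_lift (C := C) (X := X) hX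
  have h2 : C.lift W (X + X) = C.lift W X + C.lift W X := by
    rw [lift, add_mul, sandwich_add]
    rfl
  rw [h, two_mul, h2] at h1
  generalize C.lift W X = D at h1
  calc (1 - D) * (1 - D) = 1 - (D + D) + D * D := by noncomm_ring
    _ = 1 := by rw [h1, sub_add_cancel]

end PairCode

end Encode

end

noncomputable section

/-! ### Locality, translation covariance and faithfulness of the encoding. -/

section EncodeLocal

variable {d : ℕ} {N : Fin d → ℕ} {D F : ℕ} [NeZero D] [NeZero F] {par : Fin F → ℤˣ}
  {C : PairCode D F par}

namespace PairCode

variable {W : Set (Site N)} {X : AmbOp N D F}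

/-! ### Locality -/

variable (C) in
/-- The operator on the decoded configurations that corresponds to `qUnit`. -/
def decUnit (n : Site N) (a b : Fin F) : AmbOp N D F :=
  firstHom N D F (qUnit N D n (C.dec₁ a).1 (C.dec₁ b).1)
    * (secondHom N D F (qUnit N D n (C.dec₁ a).2 (C.dec₁ b).2)
      * thirdHom N D F (qUnit N F n (C.dec₂ a) (C.dec₂ b)))

open Classical in
theorem decUnit_apply (n : Site N) (a b : Fin F) (ψ) (x : Amb N D F) :
    C.decUnit n a b ψ x = if x.1 n = (C.dec₁ a).1 ∧ x.2.1 n = (C.dec₁ a).2 ∧ x.2.2 n = C.dec₂ a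
      then ψ (x.1.update n (C.dec₁ b).1, x.2.1.update n (C.dec₁ b).2, x.2.2.update n (C.dec₂ b))
      else 0 := by
  rw [decUnit, mul_apply_eq_comp, mul_apply_eq_comp, firstHom_qUnit, secondHom_qUnit,
    thirdHom_qUnit]
  simp only
  split_ifs <;> first | rfl | (exfalso; tauto)

theorem qUnit_comp_restr (n : Site N) (a b : Fin F) :
    qUnit N F n a b ∘L C.restr N = C.restr N ∘L C.decUnit n a b := l2op_ext fun ψ f => by
  classical
  refine (qUnit_apply n a b _ f).trans (Eq.trans ?_ ((C.restr_apply _ f).trans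
    (decUnit_apply n a b ψ _)).symm)
  have h1 : f n = a ↔ (C.dec f).1 n = (C.dec₁ a).1 ∧ (C.dec f).2.1 n = (C.dec₁ a).2 ∧
      (C.dec f).2.2 n = C.dec₂ a := by
    constructor
    · rintro rfl
      exact ⟨rfl, rfl, rfl⟩
    · rintro ⟨h1, h2, h3⟩
      have h4 : C.dec₁ (f n) = C.dec₁ a := Prod.ext h1 h2
      have h5 : C.dec₂ (f n) = C.dec₂ a := h3
      rw [← C.enc_dec (f n), h4, h5, C.enc_dec]
  have h2 : C.dec (f.update n b) = ((C.dec f).1.update n (C.dec₁ b).1,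
      (C.dec f).2.1.update n (C.dec₁ b).2, (C.dec f).2.2.update n (C.dec₂ b)) := by
    refine Prod.ext ?_ (Prod.ext ?_ ?_) <;> ext1 m <;> by_cases hm : m = n
    all_goals simp [dec, Finsupp.coe_update, hm]
  simp only [h1, ← h2]
  split_ifs
  · exact C.restr_apply ψ _
  · rfl

theorem decUnit_commute_indic {n : Site N} {S : Set (Amb N D F)} (a b : Fin F)
    (hS : ∀ x y : Amb N D F, (x.1 n = (C.dec₁ a).1 ∧ x.2.1 n = (C.dec₁ a).2 ∧ x.2.2 n = C.dec₂ a) →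
      (y.1 n = (C.dec₁ b).1 ∧ y.2.1 n = (C.dec₁ b).2 ∧ y.2.2 n = C.dec₂ b) →
      (∀ m, m ≠ n → x.1 m = y.1 m ∧ x.2.1 m = y.2.1 m ∧ x.2.2 m = y.2.2 m) → (x ∈ S ↔ y ∈ S)) :
    Commute (C.decUnit n a b) (indic S) := l2op_ext fun ψ x => by
  classical
  rw [mul_apply_eq_comp, mul_apply_eq_comp, decUnit_apply, indic_apply, indic_apply,
    decUnit_apply]
  by_cases hx : x.1 n = (C.dec₁ a).1 ∧ x.2.1 n = (C.dec₁ a).2 ∧ x.2.2 n = C.dec₂ a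
  · rw [if_pos hx, if_pos hx]
    have := hS x (x.1.update n (C.dec₁ b).1, x.2.1.update n (C.dec₁ b).2,
      x.2.2.update n (C.dec₂ b)) hx (by simp [Finsupp.coe_update])
      (fun m hm => by simp [Finsupp.coe_update, Function.update_of_ne hm])
    simp only [this]
  · rw [if_neg hx, if_neg hx, ite_self]

theorem mem_good_congr {n : Site N} {a b : Fin F} {x y : Amb N D F}
    (hx : x.1 n = (C.dec₁ a).1 ∧ x.2.1 n = (C.dec₁ a).2 ∧ x.2.2 n = C.dec₂ a)
    (hy : y.1 n = (C.dec₁ b).1 ∧ y.2.1 n = (C.dec₁ b).2 ∧ y.2.2 n = C.dec₂ b)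
    (h : ∀ m, m ≠ n → x.1 m = y.1 m ∧ x.2.1 m = y.2.1 m ∧ x.2.2 m = y.2.2 m) :
    x ∈ C.good N ↔ y ∈ C.good N := by
  have key : ∀ {b : Fin F} {x y : Amb N D F},
      (y.1 n = (C.dec₁ b).1 ∧ y.2.1 n = (C.dec₁ b).2 ∧ y.2.2 n = C.dec₂ b) →
      (∀ m, m ≠ n → x.1 m = y.1 m ∧ x.2.1 m = y.2.1 m ∧ x.2.2 m = y.2.2 m) →
      x ∈ C.good N → y ∈ C.good N := by
    intro b x y hy h hx m
    by_cases hm : m = n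
    · rw [hm, hy.1, hy.2.1, hy.2.2]
      have e : C.enc ((C.dec₁ b).1, (C.dec₁ b).2) (C.dec₂ b) = b := C.enc_dec b
      rw [e]
      exact ⟨rfl, rfl⟩
    · rw [← (h m hm).1, ← (h m hm).2.1, ← (h m hm).2.2]
      exact hx m
  exact ⟨key hy h, key hx fun m hm => ⟨(h m hm).1.symm, (h m hm).2.1.symm, (h m hm).2.2.symm⟩⟩

/-- Validity of a decoded configuration is a condition on each site separately, and the triples
decoded from `a` and from `b` are both valid. -/
theorem decUnit_commute_good (n : Site N) (a b : Fin F) :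
    Commute (C.decUnit n a b) (indic (C.good N)) :=
  decUnit_commute_indic a b fun _ _ hx hy h => mem_good_congr hx hy h

theorem decUnit_commute_coded {n : Site N} (hn : n ∉ W) (a b : Fin F) :
    Commute (C.decUnit n a b) (indic (C.coded W)) :=
  decUnit_commute_indic a b fun x y hx hy h => by
    have e : ∀ m ∈ W, x.2.2 m = y.2.2 m := fun m hm => (h m fun e => hn (e ▸ hm)).2.2
    refine and_congr (mem_good_congr hx hy h) (forall₂_congr fun m hm => ?_)
    rw [e m hm]

theorem decUnit_commute_pairLocal {n : Site N} (hn : n ∉ W) (a b : Fin F)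
    (hX : X ∈ pairLocal F W) : Commute (C.decUnit n a b) X := by
  have hd : Disjoint {n} W := Set.disjoint_singleton_left.2 hn
  have hs : ∀ a b, qUnit N D n a b ∈ qLocal N D {n} := fun a b =>
    qUnit_mem (Set.mem_singleton n) a b
  have hu : ∀ {V} {A : QOp N D}, A ∈ qLocal N D V → A ∈ QAlg N D := fun hA =>
    qLocal_mono (Set.subset_univ _) hA
  refine commute_pairLocal (fun A hA => ?_) (fun A hA => ?_) hX
  · exact ((qLocal_commute hd (hs _ _) hA).map (firstHom N D F)).mul_left
      ((first_commute_second (hu hA) (hu (hs _ _))).symm.mul_left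
        (third_commute_first n _ _ (hu hA)))
  · exact (first_commute_second (hu (hs _ _)) (hu hA)).mul_left
      (((qLocal_commute hd (hs _ _) hA).map (secondHom N D F)).mul_left
        (third_commute_second n _ _ (hu hA)))

/-- The counterpart of `qUnit_comp_restr` for the isometry; it needs that `decUnit` preserves its
range. -/
theorem isom_comp_qUnit (n : Site N) (a b : Fin F) :
    C.isom N ∘L qUnit N F n a b = C.decUnit n a b ∘L C.isom N := by
  have h1 := qUnit_comp_restr (C := C) n a b
  have h2 : C.isom N ∘L C.restr N ∘L C.decUnit n a b ∘L C.isom N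
      = C.decUnit n a b ∘L C.isom N := by
    rw [← ContinuousLinearMap.comp_assoc, C.isom_comp_restr, ← ContinuousLinearMap.comp_assoc]
    have h3 : indic (C.good N) ∘L C.decUnit n a b = C.decUnit n a b ∘L indic (C.good N) :=
      (decUnit_commute_good n a b).eq.symm
    rw [h3, ← C.isom_comp_restr, ContinuousLinearMap.comp_assoc, ContinuousLinearMap.comp_assoc,
      C.restr_comp_isom]
    rfl
  rw [← h2, ← ContinuousLinearMap.comp_assoc (C.restr N), ← h1, ContinuousLinearMap.comp_assoc,
    C.restr_comp_isom]
  rfl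

theorem qUnit_mul_sandwich (n : Site N) (a b : Fin F) (A : AmbOp N D F) :
    qUnit N F n a b * C.sandwich A = C.sandwich (C.decUnit n a b * A) := by
  have h1 := qUnit_comp_restr (C := C) n a b
  change (qUnit N F n a b ∘L C.restr N) ∘L (A ∘L C.isom N) = _
  rw [h1]
  rfl

theorem sandwich_mul_qUnit (n : Site N) (a b : Fin F) (A : AmbOp N D F) :
    C.sandwich A * qUnit N F n a b = C.sandwich (A * C.decUnit n a b) := by
  have h1 := isom_comp_qUnit (C := C) n a b
  change C.restr N ∘L A ∘L (C.isom N ∘L qUnit N F n a b) = _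
  rw [h1]
  rfl

theorem qUnit_commute_lift {n : Site N} (hn : n ∉ W) (a b : Fin F) (hX : X ∈ pairLocal F W) :
    Commute (qUnit N F n a b) (C.lift W X) := by
  have h1 := qUnit_mul_sandwich (C := C) n a b (X * indic (C.coded W))
  have h2 := sandwich_mul_qUnit (C := C) n a b (X * indic (C.coded W))
  have h3 := (decUnit_commute_pairLocal (C := C) hn a b hX).mul_right
    (decUnit_commute_coded (C := C) hn a b)
  exact h1.trans ((congrArg C.sandwich h3.eq).trans h2.symm)

theorem qPar_apply (n : Site N) (ψ) (f : Site N →₀ Fin F) :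
    qPar par n ψ f = signC (par (f n)) * ψ f := by
  classical
  rw [qPar, l2op_sum_apply, Finset.sum_eq_single (f n)]
  · rw [l2op_smul_apply, qUnit_apply, if_pos rfl, Finsupp.update_self]
  · intro a _ ha
    rw [l2op_smul_apply, qUnit_apply, if_neg ha.symm, mul_zero]
  · exact fun h => (h (Finset.mem_univ _)).elim

theorem star_qPar (n : Site N) : star (qPar (N := N) par n) = qPar par n := by
  rw [qPar, star_sum]
  refine Finset.sum_congr rfl fun a _ => ?_
  rw [star_smul, star_qUnit, star_signC]

/-- The lift is nonzero only on configurations with code words on `W`, and code words are even. -/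
theorem qPar_mul_lift {n : Site N} (hn : n ∈ W) (hX : X ∈ pairLocal F W) :
    qPar par n * C.lift W X = C.lift W X := by
  classical
  have h : qPar par n ∘L C.restr N ∘L indic (C.coded W) = C.restr N ∘L indic (C.coded W) := by
    refine l2op_ext fun ψ f => ?_
    refine (qPar_apply n _ f).trans ?_
    change signC (par (f n)) * (C.restr N (indic (C.coded W) ψ)) f
      = (C.restr N (indic (C.coded W) ψ)) f
    rw [C.restr_apply, indic_apply]
    by_cases hf : C.dec f ∈ C.coded W
    · obtain ⟨t, ht⟩ := C.mem_range_of_dec₂ (hf.2 n hn)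
      rw [← ht, C.even, signC_one, one_mul]
    · rw [if_neg hf, mul_zero]
  rw [lift, ← (coded_commute hX).eq]
  exact congrArg (fun A => A ∘L (X ∘L C.isom N)) h

/-- A lift commutes with one-site operators outside `W`, and it absorbs the site signs in `W` from
both sides, so the commutant criterion applies. -/
theorem lift_mem_qEven (hW : W.Finite) (hX : X ∈ pairLocal F W) :
    C.lift W X ∈ qEven N par W := by
  obtain ⟨V, rfl⟩ := hW.exists_finset_coe
  refine mem_qEven_of_commute V (fun n hn a b => qUnit_commute_lift hn a b hX) fun n hn => ?_
  have h1 := qPar_mul_lift (C := C) (Finset.mem_coe.2 hn) hX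
  have h2 := congrArg star (qPar_mul_lift (C := C) (Finset.mem_coe.2 hn) (star_mem hX))
  rw [star_mul, star_lift (star_mem hX), star_star, star_qPar] at h2
  exact h1.trans h2.symm

/-! ### Translations -/

variable (N D F) in
/-- Translation of configurations. -/
def shiftAmb (v : Site N) : Amb N D F ≃ Amb N D F :=
  (Finsupp.equivCongrLeft (Equiv.addRight v)).prodCongr
    ((Finsupp.equivCongrLeft (Equiv.addRight v)).prodCongr
      (Finsupp.equivCongrLeft (Equiv.addRight v)))

theorem shiftAmb_symm (v : Site N) (x : Amb N D F) : (shiftAmb N D F v).symm x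
    = (x.1.equivMapDomain (Equiv.addRight (-v)), x.2.1.equivMapDomain (Equiv.addRight (-v)),
      x.2.2.equivMapDomain (Equiv.addRight (-v))) := by
  rw [← Equiv.addRight_symm]
  rfl

theorem shiftAmb_symm_apply (v : Site N) (x : Amb N D F) (m : Site N) :
    ((shiftAmb N D F v).symm x).1 m = x.1 (m + v)
      ∧ ((shiftAmb N D F v).symm x).2.1 m = x.2.1 (m + v)
      ∧ ((shiftAmb N D F v).symm x).2.2 m = x.2.2 (m + v) := by
  rw [shiftAmb_symm]
  simp

theorem qTrans_comp_restr (v : Site N) :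
    qTrans N F v ∘L C.restr N = C.restr N ∘L relabel (shiftAmb N D F v) := l2op_ext fun ψ f => by
  have h : C.dec (f.equivMapDomain (Equiv.addRight (-v))) = (shiftAmb N D F v).symm (C.dec f) := by
    rw [shiftAmb_symm]
    refine Prod.ext ?_ (Prod.ext ?_ ?_) <;> ext1 m <;> simp [dec]
  refine (qTrans_apply v _ f).trans ((C.restr_apply ψ _).trans (Eq.trans ?_
    ((C.restr_apply _ f).trans (relabel_apply _ ψ _)).symm))
  rw [h]

theorem qShift_sandwich (v : Site N) (A : AmbOp N D F) :
    qShift N F v (C.sandwich A) = C.sandwich (relabelOp (shiftAmb N D F v) A) := by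
  have h1 := qTrans_comp_restr (C := C) v
  have h2 := congrArg ContinuousLinearMap.adjoint h1
  rw [ContinuousLinearMap.adjoint_comp, ContinuousLinearMap.adjoint_comp, adjoint_relabel] at h2
  rw [qShift_apply]
  change (qTrans N F v ∘L C.restr N) ∘L A ∘L (C.isom N ∘L star (qTrans N F v)) = _
  have h3 : C.isom N ∘L star (qTrans N F v) = relabel (shiftAmb N D F v).symm ∘L C.isom N := h2
  rw [h1, h3]
  rfl

theorem relabelOp_indic {Z Z' : Type} (e : Z ≃ Z') (S : Set Z) (T : Set Z')
    (h : ∀ x, e.symm x ∈ S ↔ x ∈ T) : relabelOp e (indic S) = indic T := l2op_ext fun ψ x => by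
  classical
  rw [relabelOp_apply, indic_apply, indic_apply, relabel_apply]
  simp only [h, Equiv.symm_symm, Equiv.apply_symm_apply]

theorem relabelOp_coded (v : Site N) {W W' : Set (Site N)} (h : ∀ p, p ∈ W ↔ p + v ∈ W') :
    relabelOp (shiftAmb N D F v) (indic (C.coded W)) = indic (C.coded W') := by
  refine relabelOp_indic _ _ _ fun x => ?_
  have e := shiftAmb_symm_apply v x
  refine and_congr ⟨fun hx m => ?_, fun hx m => ?_⟩ ⟨fun hx m hm => ?_, fun hx m hm => ?_⟩
  · have := hx (m - v)
    rwa [(e _).1, (e _).2.1, (e _).2.2, sub_add_cancel] at this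
  · rw [(e m).1, (e m).2.1, (e m).2.2]
    exact hx (m + v)
  · have := hx (m - v) ((h _).2 (by rwa [sub_add_cancel]))
    rwa [(e _).2.2, sub_add_cancel] at this
  · rw [(e m).2.2]
    exact hx _ ((h m).1 hm)

theorem qShift_lift (v : Site N) {W W' : Set (Site N)} (h : ∀ p, p ∈ W ↔ p + v ∈ W')
    (X : AmbOp N D F) :
    qShift N F v (C.lift W X) = C.lift W' (relabelOp (shiftAmb N D F v) X) := by
  rw [lift, qShift_sandwich, map_mul, relabelOp_coded v h, lift]

theorem update_shift {E : ℕ} [NeZero E] (v n : Site N) (b : Fin E) (f : Site N →₀ Fin E) :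
    open Classical in (f.update (n + v) b).equivMapDomain (Equiv.addRight (-v))
      = (f.equivMapDomain (Equiv.addRight (-v))).update n b := by
  classical
  ext1 m
  simp only [Finsupp.coe_update, Finsupp.equivMapDomain_apply, Equiv.addRight_symm, neg_neg,
    Equiv.coe_addRight, Function.update_apply, add_left_inj]

theorem relabelOp_first (v : Site N) {A : QOp N D} (hA : A ∈ QAlg N D) :
    relabelOp (shiftAmb N D F v) (firstHom N D F A) = firstHom N D F (qShift N D v A) := by
  classical
  refine eq_of_mem_adjoin ((equivHom (relabelOp (shiftAmb N D F v))).comp (firstHom N D F))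
    ((firstHom N D F).comp (equivHom (qShift N D v))) ?_ hA
  rintro _ ⟨n, -, a, b, rfl⟩
  change relabelOp (shiftAmb N D F v) (firstHom N D F (qUnit N D n a b))
    = firstHom N D F (qShift N D v (qUnit N D n a b))
  rw [qShift_qUnit]
  refine l2op_ext fun ψ x => ?_
  refine (relabelOp_apply _ _ ψ x).trans ((firstHom_qUnit _ _ _ _ _).trans
    (Eq.trans ?_ (firstHom_qUnit _ _ _ _ _).symm))
  have h : (shiftAmb N D F v).symm (x.1.update (n + v) b, x.2)
      = (((shiftAmb N D F v).symm x).1.update n b, ((shiftAmb N D F v).symm x).2) := by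
    rw [shiftAmb_symm, shiftAmb_symm]
    exact Prod.ext (update_shift v n b x.1) rfl
  rw [(shiftAmb_symm_apply v x n).1, relabel_apply, Equiv.symm_symm,
    ← (Equiv.symm_apply_eq _).1 h]

theorem relabelOp_second (v : Site N) {A : QOp N D} (hA : A ∈ QAlg N D) :
    relabelOp (shiftAmb N D F v) (secondHom N D F A) = secondHom N D F (qShift N D v A) := by
  classical
  refine eq_of_mem_adjoin ((equivHom (relabelOp (shiftAmb N D F v))).comp (secondHom N D F))
    ((secondHom N D F).comp (equivHom (qShift N D v))) ?_ hA
  rintro _ ⟨n, -, a, b, rfl⟩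
  change relabelOp (shiftAmb N D F v) (secondHom N D F (qUnit N D n a b))
    = secondHom N D F (qShift N D v (qUnit N D n a b))
  rw [qShift_qUnit]
  refine l2op_ext fun ψ x => ?_
  refine (relabelOp_apply _ _ ψ x).trans ((secondHom_qUnit _ _ _ _ _).trans
    (Eq.trans ?_ (secondHom_qUnit _ _ _ _ _).symm))
  have h : (shiftAmb N D F v).symm (x.1, x.2.1.update (n + v) b, x.2.2)
      = (((shiftAmb N D F v).symm x).1, ((shiftAmb N D F v).symm x).2.1.update n b,
        ((shiftAmb N D F v).symm x).2.2) := by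
    rw [shiftAmb_symm, shiftAmb_symm]
    exact Prod.ext rfl (Prod.ext (update_shift v n b x.2.1) rfl)
  rw [(shiftAmb_symm_apply v x n).2.1, relabel_apply, Equiv.symm_symm,
    ← (Equiv.symm_apply_eq _).1 h]

/-! ### The subspace of encoded states -/

variable (C) in
/-- The configurations of two copies as encoded states. -/
def embed (N : Fin d → ℕ) : ℓ²(Amb N D F, ℂ) →L[ℂ] ℓ²(Site N →₀ Fin F, ℂ) :=
  C.restr N ∘L indic {x | ∀ n, x.2.2 n = 0}

theorem mem_good_of_zero {x : Amb N D F} (h : ∀ n, x.2.2 n = 0) : x ∈ C.good N := fun n => by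
  rw [h n, enc, if_pos rfl, C.dec₁_code, C.dec₂_code]
  exact ⟨rfl, rfl⟩

theorem zero_commute (hX : X ∈ pairLocal F W) :
    Commute (indic {x : Amb N D F | ∀ n, x.2.2 n = 0}) X :=
  indic_commute_pairLocal (fun _ _ _ _ => Iff.rfl) (fun _ _ _ _ => Iff.rfl) hX

/-- If the third component vanishes everywhere, all configurations are valid and coded, so the
projections in the lift disappear. -/
theorem lift_comp_embed (hX : X ∈ pairLocal F W) :
    C.lift W X ∘L C.embed N = C.embed N ∘L X := by
  have h1 : indic (C.good N) * indic {x : Amb N D F | ∀ n, x.2.2 n = 0}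
      = indic {x : Amb N D F | ∀ n, x.2.2 n = 0} := by
    rw [indic_mul_indic]
    congr 1
    exact Set.inter_eq_right.2 fun x hx => mem_good_of_zero hx
  have h2 : indic (C.coded W) * indic {x : Amb N D F | ∀ n, x.2.2 n = 0}
      = indic {x : Amb N D F | ∀ n, x.2.2 n = 0} := by
    rw [indic_mul_indic]
    congr 1
    exact Set.inter_eq_right.2 fun x hx => ⟨mem_good_of_zero hx, fun n _ => hx n⟩
  have h3 := (zero_commute hX).eq
  rw [← C.isom_comp_restr] at h1
  have h4 : X * indic (C.coded W) * ((C.isom N ∘L C.restr N)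
      * indic {x : Amb N D F | ∀ n, x.2.2 n = 0})
      = indic {x : Amb N D F | ∀ n, x.2.2 n = 0} * X := by
    rw [h1, mul_assoc, h2, h3]
  exact congrArg (C.restr N ∘L ·) h4

theorem eq_zero_of_embed_comp {A : QOp N D}
    (h : C.embed N ∘L firstHom N D F A = 0) : A = 0 := by
  refine firstHom_injective (F := F) ?_
  have h1 : indic (C.good N) * indic {x : Amb N D F | ∀ n, x.2.2 n = 0}
      = indic {x : Amb N D F | ∀ n, x.2.2 n = 0} := by
    rw [indic_mul_indic]
    congr 1
    exact Set.inter_eq_right.2 fun x hx => mem_good_of_zero hx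
  rw [← h1, ← C.isom_comp_restr]
  change C.isom N ∘L (C.embed N ∘L firstHom N D F A) = 0
  rw [h, ContinuousLinearMap.comp_zero]

end PairCode

end EncodeLocal

end

noncomputable section

/-! ## Fermions simulate quantum cellular automata -/

section QubitsToFermions

variable {d : ℕ} {N : Fin d → ℕ} {D : ℕ} [NeZero D] {L : ℕ}

theorem isMatrixUnits_qUnit (n : Site N) : IsMatrixUnits (qUnit N D n) :=
  ⟨qUnit_mul n, sum_qUnit n, star_qUnit n⟩

section Exchange

variable {F : ℕ} [NeZero F] {u : QAlg N D ≃⋆ₐ[ℂ] QAlg N D}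

variable (F) in
/-- Matrix units after one timestep, in the first system. -/
def evolvedUnit (u : QAlg N D ≃⋆ₐ[ℂ] QAlg N D) (n : Site N) (a b : Fin D) : AmbOp N D F :=
  firstHom N D F (u (qGen N D n a b) : QOp N D)

variable (F) in
/-- Matrix units in the second system. -/
def copyUnit (n : Site N) (a b : Fin D) : AmbOp N D F := secondHom N D F (qUnit N D n a b)

theorem isMatrixPair_copies (u : QAlg N D ≃⋆ₐ[ℂ] QAlg N D) (n : Site N) :
    IsMatrixPair (evolvedUnit F u n) (copyUnit F n) where
  unitsA := isMatrixUnits_map_equiv (A := qGen N D n) u (firstHom N D F) (isMatrixUnits_qUnit n)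
  unitsB := isMatrixUnits_map_equiv (A := qGen N D n) (StarAlgEquiv.refl ℂ _) (secondHom N D F)
    (isMatrixUnits_qUnit n)
  comm a b c e := first_commute_second (u (qGen N D n a b)).2 (qGen N D n c e).2

theorem evolvedUnit_commute (u : QAlg N D ≃⋆ₐ[ℂ] QAlg N D) {n p : Site N} (h : n ≠ p)
    (a b c e : Fin D) : Commute (evolvedUnit F u n a b) (evolvedUnit F u p c e) := by
  have h1 : Commute (qGen N D n a b) (qGen N D p c e) := Subtype.ext (qUnit_commute h a b c e)
  exact h1.map (((firstHom N D F).comp (QAlg N D).subtype).comp (equivHom u))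

theorem copyUnit_commute {n p : Site N} (h : n ≠ p) (a b c e : Fin D) :
    Commute (copyUnit F n a b) (copyUnit F p c e) :=
  (qUnit_commute h a b c e).map (secondHom N D F)

variable (F) in
/-- The operator that exchanges an evolved site of the first system with a site of the second. -/
def exchange (u : QAlg N D ≃⋆ₐ[ℂ] QAlg N D) (x : Site N × Unit) : AmbOp N D F :=
  matrixSwap (evolvedUnit F u x.1) (copyUnit F x.1)

theorem exchange_sq (u : QAlg N D ≃⋆ₐ[ℂ] QAlg N D) (x : Site N × Unit) :
    exchange F u x * exchange F u x = 1 := (isMatrixPair_copies u x.1).swap_sq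

theorem star_exchange (u : QAlg N D ≃⋆ₐ[ℂ] QAlg N D) (x : Site N × Unit) :
    star (exchange F u x) = exchange F u x := (isMatrixPair_copies u x.1).star_swap

theorem exchange_commute_evolved (u : QAlg N D ≃⋆ₐ[ℂ] QAlg N D) {x : Site N × Unit} {p : Site N}
    (h : x.1 ≠ p) (a b : Fin D) : Commute (exchange F u x) (evolvedUnit F u p a b) :=
  matrixSwap_commute (fun _ _ => evolvedUnit_commute u h _ _ _ _) fun _ _ =>
    (first_commute_second (u (qGen N D p a b)).2 (qGen N D x.1 _ _).2).symm

theorem exchange_commute (u : QAlg N D ≃⋆ₐ[ℂ] QAlg N D) (x y : Site N × Unit) :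
    Commute (exchange F u x) (exchange F u y) := by
  by_cases h : x.1 = y.1
  · rw [show x = y from Prod.ext h rfl]
  refine (matrixSwap_commute (fun a b => (exchange_commute_evolved u h a b).symm)
    fun a b => ?_).symm
  refine (matrixSwap_commute (fun _ _ => ?_) fun _ _ => copyUnit_commute h _ _ _ _).symm
  exact first_commute_second (u (qGen N D x.1 _ _)).2 (qGen N D y.1 a b).2

/-- For a matrix unit at `n` only the gate at `n` matters, and it is the flip of the evolved units
of the first system with those of the second. -/
theorem eventually_exchange_conj (u : QAlg N D ≃⋆ₐ[ℂ] QAlg N D) (x : QAlg N D) :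
    ∀ᶠ s in Filter.atTop, gateProd (exchange F u) (exchange_commute u) s * firstHom N D F (u x)
      * gateProd (exchange F u) (exchange_commute u) s = secondHom N D F x := by
  refine eventually_conj_of_mem_adjoin (S := QAlg N D) rfl
    (((firstHom N D F).comp (QAlg N D).subtype).comp (equivHom u))
    ((secondHom N D F).comp (QAlg N D).subtype) (exchange_commute u) (star_exchange u)
    (exchange_sq u) (fun x hx => ?_) x
  obtain ⟨n, _, a, b, h⟩ := hx
  have h' : x = qGen N D n a b := Subtype.ext h
  subst h'
  filter_upwards [Filter.eventually_ge_atTop {(n, ())}] with s hs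
  refine (gateProd_conj_eq (a := evolvedUnit F u n a b) (exchange_commute u) (exchange_sq u)
    (i := (n, ())) (fun j hj => ?_) (Finset.singleton_subset_iff.1 hs)).trans
    ((isMatrixPair_copies u n).swap_conj a b)
  exact exchange_commute_evolved u (fun h => hj (Prod.ext h rfl)) a b

theorem exchange_mem (hu : IsQCA N D L u) (x : Site N × Unit) :
    exchange F u x ∈ pairLocal F (siteBall x.1 L) := by
  rw [exchange, matrixSwap]
  refine sum_mem fun a _ => sum_mem fun b _ => mul_mem (first_mem_pairLocal ?_)
    (second_mem_pairLocal (qUnit_mem (D := D) (mem_siteBall_self _ _) _ _))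
  exact hu.causal x.1 (qGen N D x.1 a b) (qUnit_mem (Set.mem_singleton x.1) a b)

theorem relabelOp_exchange (hu : IsQCA N D L u) (v n : Site N) (i : Unit) :
    relabelOp (PairCode.shiftAmb N D F v) (exchange F u (n, i)) = exchange F u (n + v, i) := by
  rw [exchange, matrixSwap, map_sum, exchange, matrixSwap]
  refine Finset.sum_congr rfl fun a _ => ?_
  rw [map_sum]
  refine Finset.sum_congr rfl fun b _ => ?_
  rw [map_mul]
  refine congrArg₂ _ ((PairCode.relabelOp_first v (u (qGen N D n a b)).2).trans ?_)
    ((PairCode.relabelOp_second v (qGen N D n b a).2).trans ?_)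
  · exact congrArg (firstHom N D F) (hu.translation v n a b).symm
  · exact congrArg (secondHom N D F) (qShift_qUnit v n b a)

end Exchange

variable {k : ℕ} (C : PairCode D (2 ^ k) (codeParity k)) {u : QAlg N D ≃⋆ₐ[ℂ] QAlg N D}

/-- The gate on encoded states that acts as `exchange`. -/
def encodedGate (L : ℕ) (u : QAlg N D ≃⋆ₐ[ℂ] QAlg N D) (x : Site N × Unit) : QOp N (2 ^ k) :=
  1 - C.lift (siteBall x.1 L) (1 - exchange (2 ^ k) u x)

variable (N k) in
/-- Operators of `2 ^ k`-dimensional systems as operators of fermionic modes. -/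
def ofQ : QOp N (2 ^ k) →⋆ₐ[ℂ] FOp (Mode N k) := equivHom (toQ N k).symm

/-- The fermionic gate that acts as `exchange`. -/
def fermionGate (L : ℕ) (u : QAlg N D ≃⋆ₐ[ℂ] QAlg N D) (x : Site N × Unit) : FOp (Mode N k) :=
  ofQ N k (encodedGate C L u x)

theorem one_sub_exchange_mem (hu : IsQCA N D L u) (x : Site N × Unit) :
    1 - exchange (2 ^ k) u x ∈ pairLocal (2 ^ k) (siteBall x.1 L) :=
  sub_mem (one_mem _) (exchange_mem hu x)

theorem encodedGate_mem (hu : IsQCA N D L u) (x : Site N × Unit) :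
    encodedGate C L u x ∈ qEven N (codeParity k) (siteBall x.1 L) :=
  sub_mem (one_mem _) (PairCode.lift_mem_qEven (siteBall_finite _ _) (one_sub_exchange_mem hu x))

theorem isGateLayer_fermionGate (hu : IsQCA N D L u) :
    IsGateLayer (fObs N k) L (fermionGate C L u) where
  comm x y := by
    refine Commute.map ?_ (ofQ N k)
    refine (Commute.one_left _).sub_left ((Commute.one_right _).sub_right
      (PairCode.lift_commute (one_sub_exchange_mem hu x) (one_sub_exchange_mem hu y) ?_))
    exact (Commute.one_left _).sub_left ((Commute.one_right _).sub_right (exchange_commute u x y))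
  self x := by
    rw [fermionGate, ← map_star, encodedGate, star_sub, star_one,
      PairCode.star_lift (one_sub_exchange_mem hu x), star_sub, star_one, star_exchange]
  sq x := by
    have h : (1 - exchange (2 ^ k) u x) * (1 - exchange (2 ^ k) u x)
        = 2 * (1 - exchange (2 ^ k) u x) := by
      have := exchange_sq (F := 2 ^ k) u x
      generalize exchange (2 ^ k) u x = t at this
      calc (1 - t) * (1 - t) = 1 - t - t + t * t := by noncomm_ring
        _ = 2 * (1 - t) := by rw [this]; noncomm_ring
    rw [fermionGate, ← map_mul, encodedGate,
      PairCode.lift_involution (one_sub_exchange_mem hu x) h, map_one]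
  mem n i := toQ_symm_mem_carEven (encodedGate_mem C hu (n, i))

theorem permConj_fermionGate (hu : IsQCA N D L u) (v n : Site N) (i : Unit) :
    permConj (shiftModes N k v) (fermionGate C L u (n, i)) = fermionGate C L u (n + v, i) := by
  refine (permConj_toQ_symm v (encodedGate_mem C hu (n, i))).trans
    (congrArg (ofQ N k) ?_)
  rw [encodedGate, encodedGate, map_sub, map_one,
    C.qShift_lift v (fun p => (add_mem_siteBall_add v).symm), map_sub, map_one,
    relabelOp_exchange hu]

/-- The embedding of two copies of the system into the space of fermions. -/
def encodedEmb (N : Fin d → ℕ) :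
    ℓ²(Amb N D (2 ^ k), ℂ) →L[ℂ] ℓ²(Finset (Mode N k), ℂ) :=
  relabel (modeConf N k).symm ∘L C.embed N

theorem ofQ_comp_encodedEmb {W : Set (Site N)} {X : AmbOp N D (2 ^ k)}
    (hX : X ∈ pairLocal (2 ^ k) W) :
    ofQ N k (C.lift W X) ∘L encodedEmb C N = encodedEmb C N ∘L X := by
  rw [encodedEmb, ← ContinuousLinearMap.comp_assoc]
  refine (congrArg (· ∘L C.embed N) (relabelOp_symm_comp_relabel (modeConf N k) _)).trans ?_
  exact congrArg (relabel (modeConf N k).symm ∘L ·) (PairCode.lift_comp_embed hX)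

/-- Here a single subspace suffices, because the reference state of a site is itself a code word;
hence the principal filter on one point. -/
theorem actsAs_ofQ_lift {W : Set (Site N)} {X : AmbOp N D (2 ^ k)}
    (hX : X ∈ pairLocal (2 ^ k) W) : ActsAs (pure ()) (fun _ : Unit => encodedEmb C N)
      (ofQ N k (C.lift W X)) X := by
  refine Filter.eventually_pure.2 ⟨ofQ_comp_encodedEmb C hX, ?_⟩
  rw [← map_star, PairCode.star_lift hX]
  exact ofQ_comp_encodedEmb C (star_mem hX)

/-- The lift vanishes off the code, so lifting 1 minus the exchange and subtracting from 1 gives the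
exchange on the code and the identity elsewhere. -/
theorem actsAs_fermionGate (hu : IsQCA N D L u) (x : Site N × Unit) :
    ActsAs (pure ()) (fun _ : Unit => encodedEmb C N) (fermionGate C L u x)
      (exchange (2 ^ k) u x) := by
  have h := ActsAs.one.sub (actsAs_ofQ_lift C (one_sub_exchange_mem hu x))
  rw [sub_sub_cancel] at h
  rw [fermionGate, encodedGate, map_sub, map_one]
  exact h

theorem IsQCA.refl (N : Fin d → ℕ) (D : ℕ) [NeZero D] :
    IsQCA N D 0 (StarAlgEquiv.refl ℂ (QAlg N D)) where
  causal n A hA := qLocal_mono (Set.singleton_subset_iff.2 (mem_siteBall_self n 0)) hA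
  translation v n a b := (qShift_qUnit v n a b).symm
  unitary _ := ⟨1, by simp, fun A => by simp, fun v => by simp⟩

theorem eq_zero_of_actsAs_encodedEmb {A : QOp N D}
    (h : ActsAs (pure ()) (fun _ : Unit => encodedEmb C N) 0 (firstHom N D (2 ^ k) A)) : A = 0 := by
  have h2 := (Filter.eventually_pure.1 h).1
  rw [ContinuousLinearMap.zero_comp] at h2
  refine C.eq_zero_of_embed_comp ?_
  ext1 ψ
  have h3 := congrArg (fun A => relabel (modeConf N k) (A ψ)) h2
  simp only [zero_apply, map_zero] at h3
  exact (relabel_comp_symm (modeConf N k) _).symm.trans h3.symm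

theorem exists_fObs_actsAs (n : Site N) (r : ℕ) {A : QOp N D}
    (hA : A ∈ qLocal N D (siteBall n r)) : ∃ y : CAR (Mode N k),
      (y : FOp (Mode N k)) ∈ fObs N k (siteBall n r) ∧
        ActsAs (pure ()) (fun _ : Unit => encodedEmb C N) y (firstHom N D (2 ^ k) A) := by
  have hm : firstHom N D (2 ^ k) A ∈ pairLocal (2 ^ k) (siteBall n r) := first_mem_pairLocal hA
  have hq : ofQ N k (C.lift (siteBall n r) (firstHom N D (2 ^ k) A)) ∈ fObs N k (siteBall n r) :=
    toQ_symm_mem_carEven (PairCode.lift_mem_qEven (siteBall_finite n r) hm)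
  exact ⟨⟨_, carLocal_mono (Set.subset_univ _) (carEven_le_carLocal _ hq)⟩, hq,
    actsAs_ofQ_lift C hm⟩

set_option maxHeartbeats 400000 in
include C in
-- The same two layers as for fermions. Encoded gates need no enlarged balls, so a gate has the
-- radius of the evolution and a layer twice that range.
theorem exists_fqca_simulates (hu : IsQCA N D L u) :
    ∃ w : CAR (Mode N k) ≃⋆ₐ[ℂ] CAR (Mode N k), IsFQCA N k (2 * L) w ∧
      Simulates (CAR (Mode N k)) (fObs N k) w (QAlg N D) (qLocal N D) u := by
  have h0 := isGateLayer_fermionGate C (IsQCA.refl N D)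
  have h1 := isGateLayer_fermionGate C hu
  refine ⟨(h0.aut (isLocalNet_fObs N k)).trans (h1.aut (isLocalNet_fObs N k)), ?_, ?_⟩
  · have h := (h0.isFQCA (permConj_fermionGate C (IsQCA.refl N D))).trans
      (h1.isFQCA (permConj_fermionGate C hu))
    have e : 2 * 0 + 2 * L = 2 * L := by lia
    exact Eq.mp (congrArg (fun r => IsFQCA N k r _) e) h
  · refine simulates_of_swaps (l := pure ()) (V := fun _ : Unit => encodedEmb C N)
      (isLocalNet_fObs N k) h0 h1 (exchange_commute (StarAlgEquiv.refl ℂ (QAlg N D)))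
      (exchange_commute u) (exchange_sq _) (exchange_sq u)
      (actsAs_fermionGate C (IsQCA.refl N D)) (actsAs_fermionGate C hu)
      (fun S => qLocal_mono (Set.subset_univ S)) (fun x => iff_of_true (u x).2 x.2)
      (firstHom N D (2 ^ k)) (secondHom N D (2 ^ k))
      (eventually_exchange_conj (StarAlgEquiv.refl ℂ (QAlg N D))) (eventually_exchange_conj u)
      (fun x _ h => eq_zero_of_actsAs_encodedEmb C h) fun n r x hx => exists_fObs_actsAs C n r hx

end QubitsToFermions

/-- Pairs of states of `D`-dimensional systems as even states of `D * D` fermionic modes. -/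
def pairCode (D : ℕ) [NeZero D] : PairCode D (2 ^ (D * D)) (codeParity (D * D)) where
  -- One mode for each pair of states. The symmetric difference with the mode of the pair 0 makes
  -- every code word even and sends the pair 0 to the empty set, the reference state.
  code t := modeCode _ (symmDiff {finProdFinEquiv t} {finProdFinEquiv 0})
  inj t t' h := by
    have h1 := symmDiff_left_injective _ ((modeCode _).injective h)
    exact finProdFinEquiv.injective (Finset.singleton_injective h1)
  zero := by
    rw [symmDiff_self]
    exact modeCode_empty _
  even t := by
    rw [codeParity, Equiv.symm_apply_apply, parity_symmDiff]
    simp [parity]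

theorem mainTheorem9 :
    -- qubits simulate fermions: `k` additional qubits per site, independently of the lattice size
    (∀ d m : ℕ, ∃ k : ℕ, ∀ L : ℕ, ∃ R : ℕ, ∀ (N : Fin d → ℕ)
      (u : CAR (Mode N m) ≃⋆ₐ[ℂ] CAR (Mode N m)), IsFQCA N m L u →
      ∃ w : QAlg N (2 ^ (m + k)) ≃⋆ₐ[ℂ] QAlg N (2 ^ (m + k)),
        IsQCA N (2 ^ (m + k)) R w ∧
        Simulates (QAlg N (2 ^ (m + k))) (qLocal N (2 ^ (m + k))) w
          (CAR (Mode N m)) (fObs N m) u) ∧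
    -- fermions simulate `D`-dimensional systems: `k` modes per site
    (∀ (D : ℕ) [NeZero D], ∃ k : ℕ, ∀ d L : ℕ, ∃ R : ℕ, ∀ (N : Fin d → ℕ)
      (u : QAlg N D ≃⋆ₐ[ℂ] QAlg N D), IsQCA N D L u →
      ∃ w : CAR (Mode N k) ≃⋆ₐ[ℂ] CAR (Mode N k),
        IsFQCA N k R w ∧
        Simulates (CAR (Mode N k)) (fObs N k) w (QAlg N D) (qLocal N D) u) :=
  -- The additional qubits are `m` modes for the second copy and `2 * d` link modes; the `D * D`
  -- fermionic modes are one for each pair of states.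
  ⟨fun d m => ⟨m + 2 * d, fun L => ⟨6 * L, fun N u hu => qubits_simulate_fermions d m L N u hu⟩⟩,
    fun D _ => ⟨D * D, fun _ L => ⟨2 * L, fun _ _ hu => exists_fqca_simulates (pairCode D) hu⟩⟩⟩

end
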